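/- Let $M$ be a compact smooth manifold, $U\subset\mathbb R^m$ compact and convex with $0\in\mathrm{int}\,U$, $A\subset\mathbb R^k$ compact and $\alpha^0\in\mathrm{int}\,A$. Consider the parametrized control-affine system $$\Sigma^\alpha:\quad \dot x(t)=f_0(\alpha,x(t))+\sum_{i=1}^m u_i(t)f_i(\alpha,x(t)),\qquad u\in\mathcal U=L^\infty(\mathbb R,U),\ \alpha\in A,$$ with $f_0,\dots,f_m$ of class $C^\infty$ in $(\alpha,x)\in A\times M$ and all solutions defined on $\mathbb R$. Let $\varphi^\alpha(t,x,u)$ be the solution with $\varphi^\alpha(0,x,u)=x$, give $\mathcal U$ the weak$^*$-topology of $L^\infty(\mathbb R,\mathbb R^m)=L^1(\mathbb R,\mathbb R^m)^*$, and let $\Phi^\alpha_t(u,x)=(u(t+\cdot),\varphi^\alpha(t,x,u))$ be the control flow on $\mathcal U\times M$. For $T>0$ put $\mathcal O^{\alpha,\pm}_{\le T}(x)=\{\varphi^\alpha(\pm t,x,u): u\in\mathcal U,\ t\in[0,T]\}$. $\Sigma^\alpha$ is locally accessible if these sets have nonempty interior for all $x\in M$ and $T>0$. A control set of $\Sigma^\alpha$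 is a set $D\subset M$ that is maximal (w.r.t. inclusion) with the properties: for each $x\in D$ there is $u\in\mathcal U$ with $\varphi^\alpha([0,\infty),x,u)\subset D$; and $D\subset\mathrm{cl}\bigcup_{T>0}\mathcal O^{\alpha,+}_{\le T}(x)$ for all $x\in D$. Its lift is $\mathcal D=\mathrm{cl}\{(u,x)\in\mathcal U\times M:\varphi^\alpha(\mathbb R,x,u)\subset\mathrm{int}\,D\}$. The Lie algebra rank condition holds at $x$ if the Lie algebra generated by the vector fields $f_0(\alpha,\cdot),\dots,f_m(\alpha,\cdot)$, evaluated at $x$, equals $T_xM$. Assume: (i) $\Sigma^\alpha$ is locally accessible for all $\alpha$ in a neighborhood of $\alpha^0$. (ii) $D^{\alpha^0}$ is a control set of $\Sigma^{\alpha^0}$ with nonempty interior, and for $\alpha$ in a neighborhood of $\alpha^0$ there is at most one control set $C$ of $\Sigma^\alpha$ with $\mathrm{int}\,D^{\alpha^0}\cap\mathrm{int}\,C\ne\emptyset$; it is denoted by $D^\alpha$. (iii) $\Sigma^{\alpha^0}$ satisfies the Lie algebra rank condition at every point of $\mathrm{int}\,D^{\alpha^0}$. (iv) $\kappa^\alpha:\mathbb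 R\times(\mathcal U\times M)\to[0,\infty)$, $\alpha\in A$, are functions such that $(t,\alpha,u,x)\mapsto\kappa^\alpha_t(u,x)$ is continuous, $\kappa^\alpha_{t+s}(u,x)\le\kappa^\alpha_t(u,x)+\kappa^\alpha_s(\Phi^\alpha_t(u,x))$ for all $t,s\in\mathbb R$ and $(u,x)\in\mathcal U\times M$, and, for $\alpha$ in a neighborhood of $\alpha^0$, $\kappa^\alpha$ has the restriction property: $\kappa^\alpha_t(u,x)=\kappa^\alpha_t(v,x)$ whenever $t>0$, $(u,x),(v,x)\in\mathcal D^\alpha$ and $u=v$ almost everywhere on $[0,t]$. Define the Floquet spectrum $$\Sigma_{\mathrm{Fl}}(\kappa^\alpha,\mathcal D^\alpha)=\Bigl\{\lim_{t\to\infty}\tfrac1t\kappa^\alpha_t(u,x)\ :\ (u,x)\ \Phi^\alpha\text{-periodic},\ x\in\mathrm{int}\,D^\alpha\Bigr\}.$$ Then, for all $\alpha$ in a neighborhood of $\alpha^0$, the control set $D^\alpha$ exists and $\Sigma_{\mathrm{Fl}}(\kappa^\alpha,\mathcal D^\alpha)$ is nonempty, and the map $\alpha\mapsto\inf\Sigma_{\mathrm{Fl}}(\kappa^\alpha,\mathcal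 D^\alpha)$ is upper semicontinuous at $\alpha^0$. -/

import Mathlib

open MeasureTheory Filter Topology Set
open scoped Manifold ContDiff ENNReal

noncomputable section

namespace ControlAffine

/-- The space `L^∞(ℝ, U)` of admissible control functions: essentially bounded measurable functions
`ℝ → ℝ^m`, modulo equality almost everywhere, with values in `U` almost everywhere. -/
def Control {m : ℕ} (U : Set (EuclideanSpace ℝ (Fin m))) : Type :=
  {u : Lp (EuclideanSpace ℝ (Fin m)) ∞ (volume : Measure ℝ) // ∀ᵐ t : ℝ, u t ∈ U}

/-- A representative of a control function. -/
def Control.val {m : ℕ} {U : Set (EuclideanSpace ℝ (Fin m))} (u : Control U) :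
    ℝ → EuclideanSpace ℝ (Fin m) :=
  fun t => u.1 t

/-- The weak-* topology on `L^∞(ℝ, U) ⊆ L^∞(ℝ, ℝ^m) = L^1(ℝ, ℝ^m)^*`: the coarsest topology for
which `u ↦ ∫ ⟨g(t), u(t)⟩ dt` is continuous for every `g ∈ L^1(ℝ, ℝ^m)`. -/
instance Control.instTopologicalSpace {m : ℕ} (U : Set (EuclideanSpace ℝ (Fin m))) :
    TopologicalSpace (Control U) :=
  TopologicalSpace.induced
    (fun (u : Control U) (g : Lp (EuclideanSpace ℝ (Fin m)) 1 (volume : Measure ℝ)) =>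
      ∫ t : ℝ, inner ℝ (g t) (u.val t))
    inferInstance

/-- The shift `θ_t u = u(t + ·)`. -/
def Control.shift {m : ℕ} {U : Set (EuclideanSpace ℝ (Fin m))} (t : ℝ) (u : Control U) :
    Control U :=
  ⟨Lp.compMeasurePreserving (fun s : ℝ => t + s) (measurePreserving_add_left volume t) u.1, by
    have h := Lp.coeFn_compMeasurePreserving u.1 (measurePreserving_add_left (volume : Measure ℝ) t)
    have h2 := (measurePreserving_add_left (volume : Measure ℝ) t).quasiMeasurePreserving.ae u.2
    filter_upwards [h, h2] with s hs hs2
    rw [hs]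
    exact hs2⟩

section System

variable {d m : ℕ} {M : Type*} [TopologicalSpace M] [ChartedSpace (EuclideanSpace ℝ (Fin d)) M]

/-- The right-hand side `f₀(x) + ∑ i, wᵢ fᵢ(x)` for a control value `w ∈ ℝ^m`. The vector fields of
the system are collected in one family `f` indexed by `Fin (m + 1)`, `f 0` being the drift. -/
def controlField (f : Fin (m + 1) → (x : M) → TangentSpace (𝓡 d) x)
    (w : EuclideanSpace ℝ (Fin m)) (x : M) : TangentSpace (𝓡 d) x :=
  f 0 x + ∑ i : Fin m, w i • f i.succ x

/-- `γ : ℝ → M` is a (Carathéodory) solution of `ẋ = f₀(x) + ∑ i, uᵢ(t) fᵢ(x)` on all of `ℝ` with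
`γ(0) = x`: it is continuous and, around each time `t₀`, its representation in the chart at `γ(t₀)`
satisfies the integral equation. -/
structure IsSolution (f : Fin (m + 1) → (x : M) → TangentSpace (𝓡 d) x)
    {U : Set (EuclideanSpace ℝ (Fin m))} (u : Control U) (x : M) (γ : ℝ → M) : Prop where
  continuous : Continuous γ
  initial : γ 0 = x
  integral_eq : ∀ t₀ : ℝ, ∀ᶠ t in 𝓝 t₀,
    extChartAt (𝓡 d) (γ t₀) (γ t) = extChartAt (𝓡 d) (γ t₀) (γ t₀) +
      ∫ s in t₀..t,
        (mfderiv (𝓡 d) 𝓘(ℝ, EuclideanSpace ℝ (Fin d)) (extChartAt (𝓡 d) (γ t₀)) (γ s)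
          (controlField f (u.val s) (γ s)) : EuclideanSpace ℝ (Fin d))

/-- All solutions are defined on `ℝ`. -/
def Complete (f : Fin (m + 1) → (x : M) → TangentSpace (𝓡 d) x)
    (U : Set (EuclideanSpace ℝ (Fin m))) : Prop :=
  ∀ (u : Control U) (x : M), ∃ γ : ℝ → M, IsSolution f u x γ

open Classical in
/-- The transition map `φ(t, x, u)`: the value at time `t` of the solution with initial value `x` and
control `u` (and `x` if there is no solution on `ℝ`). -/
def transition (f : Fin (m + 1) → (x : M) → TangentSpace (𝓡 d) x)
    {U : Set (EuclideanSpace ℝ (Fin m))} (t : ℝ) (x : M) (u : Control U) : M :=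
  if h : ∃ γ : ℝ → M, IsSolution f u x γ then h.choose t else x

/-- The control flow `Φ_t(u, x) = (θ_t u, φ(t, x, u))`. -/
def controlFlow (f : Fin (m + 1) → (x : M) → TangentSpace (𝓡 d) x)
    {U : Set (EuclideanSpace ℝ (Fin m))} (t : ℝ) (p : Control U × M) : Control U × M :=
  (p.1.shift t, transition f t p.2 p.1)

/-- `O⁺_{≤T}(x)`, the set of points reachable from `x` up to time `T`. -/
def reachUpTo (f : Fin (m + 1) → (x : M) → TangentSpace (𝓡 d) x)
    (U : Set (EuclideanSpace ℝ (Fin m))) (T : ℝ) (x : M) : Set M :=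
  {y | ∃ (u : Control U) (t : ℝ), t ∈ Icc 0 T ∧ y = transition f t x u}

/-- `O⁻_{≤T}(x)`, the set of points reachable from `x` up to time `T` in reversed time. -/
def coreachUpTo (f : Fin (m + 1) → (x : M) → TangentSpace (𝓡 d) x)
    (U : Set (EuclideanSpace ℝ (Fin m))) (T : ℝ) (x : M) : Set M :=
  {y | ∃ (u : Control U) (t : ℝ), t ∈ Icc 0 T ∧ y = transition f (-t) x u}

/-- The positive orbit `O⁺(x)`. -/
def posOrbit (f : Fin (m + 1) → (x : M) → TangentSpace (𝓡 d) x)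
    (U : Set (EuclideanSpace ℝ (Fin m))) (x : M) : Set M :=
  ⋃ T > (0 : ℝ), reachUpTo f U T x

/-- Local accessibility (from every point): `O⁺_{≤T}(x)` and `O⁻_{≤T}(x)` have nonempty interior for
all `x` and all `T > 0`. -/
def LocallyAccessible (f : Fin (m + 1) → (x : M) → TangentSpace (𝓡 d) x)
    (U : Set (EuclideanSpace ℝ (Fin m))) : Prop :=
  ∀ (x : M) (T : ℝ), 0 < T →
    (interior (reachUpTo f U T x)).Nonempty ∧ (interior (coreachUpTo f U T x)).Nonempty

/-- Control sets: sets maximal (w.r.t. inclusion) among the controlled invariant sets on which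
approximate controllability holds. -/
def IsControlSet (f : Fin (m + 1) → (x : M) → TangentSpace (𝓡 d) x)
    (U : Set (EuclideanSpace ℝ (Fin m))) (D : Set M) : Prop :=
  Maximal (fun C : Set M =>
    (∀ x ∈ C, ∃ u : Control U, ∀ t : ℝ, 0 ≤ t → transition f t x u ∈ C) ∧
    (∀ x ∈ C, C ⊆ closure (posOrbit f U x))) D

/-- The Lie algebra of vector fields generated by a family `f` of (smooth) vector fields. -/
inductive LieGenerated (f : Fin (m + 1) → (x : M) → TangentSpace (𝓡 d) x) :
    ((x : M) → TangentSpace (𝓡 d) x) → Prop where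
  | of (i : Fin (m + 1)) : LieGenerated f (f i)
  | add {V W : (x : M) → TangentSpace (𝓡 d) x} :
      LieGenerated f V → LieGenerated f W → LieGenerated f (fun x => V x + W x)
  | smul (c : ℝ) {V : (x : M) → TangentSpace (𝓡 d) x} :
      LieGenerated f V → LieGenerated f (fun x => c • V x)
  | bracket {V W : (x : M) → TangentSpace (𝓡 d) x} :
      LieGenerated f V → LieGenerated f W →
        LieGenerated f (VectorField.mlieBracket (𝓡 d) V W)

/-- The Lie algebra rank condition at `x`. -/
def LieRankCondition (f : Fin (m + 1) → (x : M) → TangentSpace (𝓡 d) x) (x : M) : Prop :=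
  {v : TangentSpace (𝓡 d) x | ∃ V : (y : M) → TangentSpace (𝓡 d) y,
    LieGenerated f V ∧ V x = v} = univ

/-- The lift of a control set `D`: the closure of the set of `(u, x)` with
`φ(ℝ, x, u) ⊆ int D`. -/
def lift (f : Fin (m + 1) → (x : M) → TangentSpace (𝓡 d) x)
    (U : Set (EuclideanSpace ℝ (Fin m))) (D : Set M) : Set (Control U × M) :=
  closure {p | ∀ t : ℝ, transition f t p.2 p.1 ∈ interior D}

/-- The subadditivity inequality for a cocycle over the control flow. -/
def IsSubadditive (f : Fin (m + 1) → (x : M) → TangentSpace (𝓡 d) x)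
    {U : Set (EuclideanSpace ℝ (Fin m))} (κ : ℝ → Control U × M → ℝ) : Prop :=
  ∀ (t s : ℝ) (p : Control U × M), κ (t + s) p ≤ κ t p + κ s (controlFlow f t p)

/-- The restriction property of `κ` over the lift of `D`: on the lift, `κ_t(u, x)` with `t > 0`
depends on `u` only through its restriction to `[0, t]`. -/
def RestrictionProperty (f : Fin (m + 1) → (x : M) → TangentSpace (𝓡 d) x)
    {U : Set (EuclideanSpace ℝ (Fin m))} (D : Set M) (κ : ℝ → Control U × M → ℝ) : Prop :=
  ∀ (t : ℝ) (u v : Control U) (x : M), 0 < t → (u, x) ∈ lift f U D → (v, x) ∈ lift f U D →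
    (∀ᵐ s : ℝ, s ∈ Icc 0 t → u.val s = v.val s) → κ t (u, x) = κ t (v, x)

/-- Periodic points of the control flow. -/
def IsPeriodic (f : Fin (m + 1) → (x : M) → TangentSpace (𝓡 d) x)
    {U : Set (EuclideanSpace ℝ (Fin m))} (p : Control U × M) : Prop :=
  ∃ T : ℝ, 0 < T ∧ controlFlow f T p = p

/-- The Floquet spectrum of `κ` over the lift of `D`: the set of the limits
`lim_{t → ∞} κ_t(u, x) / t` for periodic `(u, x)` with `x ∈ int D`. -/
def floquetSpectrum (f : Fin (m + 1) → (x : M) → TangentSpace (𝓡 d) x)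
    {U : Set (EuclideanSpace ℝ (Fin m))} (D : Set M) (κ : ℝ → Control U × M → ℝ) : Set ℝ :=
  {l | ∃ p : Control U × M, IsPeriodic f p ∧ p.2 ∈ interior D ∧
    Tendsto (fun t : ℝ => (1 / t) * κ t p) atTop (𝓝 l)}

end System

end ControlAffine

end

open ControlAffine

/-!
The proof rests on the persistence of closed trajectories under perturbations of the parameter.

Upper semicontinuity. Let `(u, x)` be a periodic point over `int (D α₀)` with growth rate less than
`r`. Starting from a point `y₀` of `int (D α₀)`, consider the closed trajectory that goes to `x`,
follows `u` for `n` periods and then returns to `y₀`. By subadditivity the value of the cocycle along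
it is at most the sum of the values on the three arcs. All points of the loop belong to the lift of
`D α₀`, so that by the restriction property the first and the last of these values do not depend on
`n`; hence for large `n` the mean value along the loop is less than `r`
(`exists_cocycle_loop_lt`). This uses exact controllability in the interior of control sets, a
consequence of local accessibility (`TransitionLaws.mem_posOrbit_of_mem_interior`). If the loop
persists for nearby parameters, up to small changes of finitely many switching times in its last
arc, then joint continuity of the cocycle keeps the mean value below `r`, and by Fekete's lemma
(`exists_tendsto_of_periodic`) the growth rate of the perturbed periodic trajectory exists and is at
most this mean value (`eventually_exists_mem_floquetSpectrum_lt`).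

Persistence of loops. The last arc is built from flows of the vector fields `f₀` and `f₀ + ε fᵢ`. A
concatenation of such flows is chosen whose tangent space, spanned by varying the switching times,
has maximal dimension (`exists_word_forall_chain_mem`). Then the generating vector fields stay
in this space along all further flows. By differentiating in time, this passes on to their brackets,
and the Jacobi identity extends it to the whole Lie algebra (`chartRep_mem_of_lieGenerated`). The
Lie algebra rank condition thus makes the derivative with respect to the switching times surjective;
the switching times can be made positive since this is an open condition. The open mapping
property for the map (switching times, parameter, initial point) ↦ (parameter, initial point,
endpoint) then closes trajectories near the loop for all nearby parameters
(`exists_regular_times`, `exists_closing_loops`). With `n = 0` it also shows that points near `y₀`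
can be steered to each other for nearby parameters, so that they lie in a control set, which is
`D α` by uniqueness (`eventually_isControlSet_and_mem_interior`).

Two technical points. The flows in question are those of smooth vector fields that are cut off in a
chart, and their joint smoothness in time and space is obtained from the implicit function theorem
in a space of continuous curves (`exists_smooth_flow`). Carathéodory solutions on `M` are compared
in a Euclidean space in which `M` is embedded: the image of a solution satisfies, at every time, a
first order expansion that involves the integral of the control (`DrivenAt`), and Grönwall's
inequality applies to such curves. This gives uniqueness, the cocycle property, causality and
continuous dependence (`transitionLaws`, `continuousAt_transition`).
-/


namespace ControlAffine
/-! ### Smooth flows -/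

section Nemytskii

universe w

variable {X : Type*} {E F : Type w} [TopologicalSpace X] [CompactSpace X]
  [NormedAddCommGroup E] [NormedSpace ℝ E] [NormedAddCommGroup F] [NormedSpace ℝ F]

/-- The pointwise action of operator-valued functions on vector-valued functions. -/
noncomputable def pointwiseApply (X : Type*) (E F : Type w) [TopologicalSpace X] [CompactSpace X]
    [NormedAddCommGroup E] [NormedSpace ℝ E] [NormedAddCommGroup F] [NormedSpace ℝ F] :
    C(X, E →L[ℝ] F) →L[ℝ] C(X, E) →L[ℝ] C(X, F) :=
  LinearMap.mkContinuous₂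
    (LinearMap.mk₂ ℝ (fun (A : C(X, E →L[ℝ] F)) (h : C(X, E)) =>
        (⟨fun x => A x (h x), A.continuous.clm_apply h.continuous⟩ : C(X, F)))
      (fun _ _ _ => by ext; simp) (fun _ _ _ => by ext; simp) (fun _ _ _ => by ext; simp)
      (fun _ _ _ => by ext; simp)) 1
    (fun A h => by
      rw [ContinuousMap.norm_le _ (by positivity)]
      intro x
      refine (ContinuousLinearMap.le_opNorm _ _).trans ?_
      rw [one_mul]
      exact mul_le_mul (A.norm_coe_le_norm x) (h.norm_coe_le_norm x) (norm_nonneg _)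
        (norm_nonneg A))

/-- The superposition operator `γ ↦ v ∘ γ` is differentiable on continuous functions on a compact
space. Continuity of `γ ↦ v' ∘ γ` in the uniform norm makes the mean value estimate uniform. -/
lemma hasFDerivAt_superposition {v : E → F} {v' : E → E →L[ℝ] F}
    (hv : ∀ x, HasFDerivAt v (v' x) x) (hv' : Continuous v') (γ : C(X, E)) :
    HasFDerivAt (fun γ : C(X, E) =>
        (⟨v, continuous_iff_continuousAt.2 fun x => (hv x).continuousAt⟩ : C(E, F)).comp γ)
      (pointwiseApply X E F ((⟨v', hv'⟩ : C(E, E →L[ℝ] F)).comp γ)) γ := by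
  rw [hasFDerivAt_iff_isLittleO, Asymptotics.isLittleO_iff]
  intro c hc
  have hcont : Continuous (fun γ : C(X, E) => (⟨v', hv'⟩ : C(E, E →L[ℝ] F)).comp γ) :=
    ContinuousMap.continuous_postcomp _
  obtain ⟨δ, hδ, hδc⟩ := (Metric.continuousAt_iff
    (f := fun γ : C(X, E) => (⟨v', hv'⟩ : C(E, E →L[ℝ] F)).comp γ)).1
    (hcont.continuousAt (x := γ)) c hc
  filter_upwards [Metric.ball_mem_nhds γ hδ] with γ₁ hγ₁
  rw [ContinuousMap.norm_le _ (by positivity)]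
  intro x
  have key : ∀ y ∈ Metric.ball (γ x) δ, ‖v' y - v' (γ x)‖ ≤ c := by
    intro y hy
    have h1 : dist (γ + ContinuousMap.const X (y - γ x)) γ < δ := by
      rw [dist_eq_norm, add_sub_cancel_left]
      refine lt_of_le_of_lt ((ContinuousMap.norm_le _ (norm_nonneg (y - γ x))).2
        (fun _ => by simp)) ?_
      rwa [← dist_eq_norm]
    have h2 := (ContinuousMap.dist_apply_le_dist (x := x)).trans (hδc h1).le
    rw [dist_eq_norm] at h2
    simpa using h2
  have hx : γ₁ x ∈ Metric.ball (γ x) δ :=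
    lt_of_le_of_lt (ContinuousMap.dist_apply_le_dist x) hγ₁
  have := (convex_ball (γ x) δ).norm_image_sub_le_of_norm_hasFDerivWithin_le'
    (fun y _ => (hv y).hasFDerivWithinAt) key (Metric.mem_ball_self hδ) hx
  refine this.trans ?_
  gcongr
  exact (γ₁ - γ).norm_coe_le_norm x

lemma contDiff_superposition (n : ℕ) : ∀ {F : Type w} [NormedAddCommGroup F] [NormedSpace ℝ F]
    {v : E → F} (hv : ContDiff ℝ n v),
    ContDiff ℝ n (fun γ : C(X, E) => (⟨v, hv.continuous⟩ : C(E, F)).comp γ) := by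
  induction n with
  | zero =>
    intro F _ _ v hv
    exact contDiff_zero.2 (ContinuousMap.continuous_postcomp _)
  | succ n ih =>
    intro F _ _ v hv
    obtain ⟨v', hv', hvv'⟩ := contDiff_succ_iff_hasFDerivAt.1 (by exact_mod_cast hv)
    have : ContDiff ℝ (n + 1) (fun γ : C(X, E) => (⟨v, hv.continuous⟩ : C(E, F)).comp γ) :=
      contDiff_succ_iff_hasFDerivAt.2 ⟨fun γ => pointwiseApply X E F
        ((⟨v', hv'.continuous⟩ : C(E, E →L[ℝ] F)).comp γ),
        (show ContDiff ℝ n (fun A => pointwiseApply X E F A) from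
          by fun_prop).comp (ih hv'),
        fun γ => hasFDerivAt_superposition hvv' hv'.continuous γ⟩
    exact_mod_cast this

end Nemytskii

section LocalFlow

variable {E : Type*} [NormedAddCommGroup E] [NormedSpace ℝ E]

/-- The primitive `τ ↦ ∫_0^τ γ` of a continuous function on `[0, 1]`. -/
noncomputable def primitiveCLM (E : Type*) [NormedAddCommGroup E] [NormedSpace ℝ E] :
    C(unitInterval, E) →L[ℝ] C(unitInterval, E) :=
  LinearMap.mkContinuous
    { toFun := fun γ => ⟨fun τ => ∫ σ in (0 : ℝ)..τ, γ (projIcc 0 1 zero_le_one σ), by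
          have h : Continuous fun σ : ℝ => γ (projIcc 0 1 zero_le_one σ) :=
            γ.continuous.comp continuous_projIcc
          exact (intervalIntegral.continuous_primitive (fun a b => h.intervalIntegrable a b) 0).comp
            continuous_subtype_val⟩
      map_add' := fun γ₁ γ₂ => by
        ext τ
        exact intervalIntegral.integral_add
          ((γ₁.continuous.comp continuous_projIcc).intervalIntegrable _ _)
          ((γ₂.continuous.comp continuous_projIcc).intervalIntegrable _ _)
      map_smul' := fun c γ => by
        ext τ
        exact intervalIntegral.integral_smul _ _ } 1
    (fun γ => by
      rw [ContinuousMap.norm_le _ (by positivity)]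
      intro τ
      refine (intervalIntegral.norm_integral_le_of_norm_le_const
        (C := ‖γ‖) (fun σ _ => γ.norm_coe_le_norm _)).trans ?_
      rw [sub_zero, abs_of_nonneg τ.2.1, one_mul]
      exact mul_le_of_le_one_right (norm_nonneg _) τ.2.2)

lemma norm_primitiveCLM_le (γ : C(unitInterval, E)) : ‖primitiveCLM E γ‖ ≤ ‖γ‖ := by
  refine (ContinuousLinearMap.le_opNorm _ _).trans ?_
  exact mul_le_of_le_one_left (norm_nonneg _) (LinearMap.mkContinuous_norm_le _ zero_le_one _)

/-- A smooth vector field with Lipschitz constant `K` has a smooth flow for times `|t| K < 1`. The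
orbit `τ ↦ F (t τ) z` on `[0, 1]` solves `γ = z + t ∫ v ∘ γ`, an equation in `C([0, 1], E)`
which is smooth in `(t, z, γ)` and uniquely solvable in `γ`, by contraction; the implicit function
theorem makes the solution smooth in `(t, z)`. -/
theorem exists_smooth_flow [CompleteSpace E] {v : E → E} (n : ℕ) (hn : n ≠ 0) (hv : ContDiff ℝ n v)
    {K : NNReal} (hK : LipschitzWith K v) {T : ℝ} (hT0 : 0 < T) (hT : T * K < 1) :
    ∃ F : ℝ → E → E, ContDiffOn ℝ n (fun p : ℝ × E => F p.1 p.2) (Ioo (-T) T ×ˢ univ) ∧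
      (∀ z, F 0 z = z) ∧
      (∀ t ∈ Ioo (-T) T, ∀ z, HasDerivAt (fun s => F s z) (v (F t z)) t) ∧
      ∀ t ∈ Ioo (-T) T, ∀ z, F (-t) (F t z) = z := by
  let N : C(unitInterval, E) → C(unitInterval, E) := fun γ => (⟨v, hv.continuous⟩ : C(E, E)).comp γ
  have hN : ContDiff ℝ n N := contDiff_superposition n hv
  have hNlip : ∀ γ₁ γ₂, ‖N γ₁ - N γ₂‖ ≤ K * ‖γ₁ - γ₂‖ := by
    intro γ₁ γ₂
    rw [ContinuousMap.norm_le _ (by positivity)]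
    intro x
    refine (hK.norm_sub_le _ _).trans ?_
    gcongr
    exact (γ₁ - γ₂).norm_coe_le_norm x
  let cst : E →L[ℝ] C(unitInterval, E) := ContinuousLinearMap.const ℝ unitInterval
  let Φ : ℝ × E → C(unitInterval, E) → C(unitInterval, E) :=
    fun p γ => cst p.2 + p.1 • primitiveCLM E (N γ)
  have hΦlip : ∀ p : ℝ × E, p.1 ∈ Ioo (-T) T → ∀ γ₁ γ₂,
      ‖Φ p γ₁ - Φ p γ₂‖ ≤ (|p.1| * K) * ‖γ₁ - γ₂‖ := by
    intro p hp γ₁ γ₂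
    have : Φ p γ₁ - Φ p γ₂ = p.1 • primitiveCLM E (N γ₁ - N γ₂) := by
      simp only [Φ, map_sub, smul_sub]; abel
    rw [this, norm_smul, Real.norm_eq_abs, mul_assoc]
    gcongr
    exact (norm_primitiveCLM_le _).trans (hNlip _ _)
  have habs : ∀ t ∈ Ioo (-T) T, |t| * K < 1 := fun t ht =>
    lt_of_le_of_lt (mul_le_mul_of_nonneg_right (abs_lt.2 ht).le K.2) hT
  have hcontr : ∀ p : ℝ × E, p.1 ∈ Ioo (-T) T →
      ContractingWith (Real.toNNReal (|p.1| * K)) (Φ p) := by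
    intro p hp
    refine ⟨?_, LipschitzWith.of_dist_le_mul fun γ₁ γ₂ => ?_⟩
    · rw [← NNReal.coe_lt_coe, Real.coe_toNNReal _ (by positivity)]; exact habs _ hp
    · rw [dist_eq_norm, dist_eq_norm, Real.coe_toNNReal _ (by positivity)]
      exact hΦlip p hp _ _
  have hsol : ∀ p : ℝ × E, p.1 ∈ Ioo (-T) T → ∃ γ, Φ p γ = γ := fun p hp =>
    ⟨_, (hcontr p hp).fixedPoint_isFixedPt⟩
  choose! S hS using hsol
  have huniq : ∀ p : ℝ × E, p.1 ∈ Ioo (-T) T → ∀ γ, Φ p γ = γ → γ = S p := fun p hp γ hγ =>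
    (hcontr p hp).fixedPoint_unique' hγ (hS p hp)
  -- smoothness of the solution operator
  have hSsmooth : ∀ p : ℝ × E, p.1 ∈ Ioo (-T) T → ContDiffAt ℝ n S p := by
    intro p hp
    let H : (ℝ × E) × C(unitInterval, E) → C(unitInterval, E) := fun q => q.2 - Φ q.1 q.2
    have hH : ContDiff ℝ n H := by
      refine contDiff_snd.sub ((cst.contDiff.comp (contDiff_snd.comp contDiff_fst)).add ?_)
      exact (contDiff_fst.comp contDiff_fst).smul
        ((primitiveCLM E).contDiff.comp (hN.comp contDiff_snd))
    have hn' : (n : WithTop ℕ∞) ≠ 0 := by exact_mod_cast hn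
    have hHd : DifferentiableAt ℝ H (p, S p) := (hH.differentiable hn') _
    set L := fderiv ℝ H (p, S p) ∘L .inr ℝ (ℝ × E) C(unitInterval, E) with hL
    have hLd : HasFDerivAt (fun γ => H (p, γ)) L (S p) := by
      have := hHd.hasFDerivAt.comp (S p) (hasFDerivAt_prodMk_right p (S p))
      exact this
    have hPd : HasFDerivAt (Φ p) (1 - L) (S p) := by
      have := (hasFDerivAt_id (𝕜 := ℝ) (S p)).sub hLd
      refine this.congr_of_eventuallyEq (Eventually.of_forall fun γ => ?_)
      simp [H]
    have hnorm : ‖(1 : C(unitInterval, E) →L[ℝ] C(unitInterval, E)) - L‖ < 1 := by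
      refine lt_of_le_of_lt (hPd.le_of_lip' (C := |p.1| * K) (by positivity)
        (Eventually.of_forall fun γ => hΦlip p hp _ _)) (habs _ hp)
    have hinv : L.IsInvertible := by
      have hu : IsUnit L := by
        have := isUnit_one_sub_of_norm_lt_one
          (x := (1 : C(unitInterval, E) →L[ℝ] C(unitInterval, E)) - L) hnorm
        simpa using this
      obtain ⟨uu, huu⟩ := hu
      exact ⟨ContinuousLinearEquiv.ofUnit uu, by ext; simp [← huu]; rfl⟩
    have h1 := hH.contDiffAt (x := (p, S p))
    have h2 := h1.contDiffAt_implicitFunction hn' hinv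
    refine h2.congr_of_eventuallyEq ?_
    have h3 := h1.eventually_apply_implicitFunction hn' hinv
    have h4 : ∀ᶠ q : ℝ × E in 𝓝 p, q.1 ∈ Ioo (-T) T :=
      continuous_fst.continuousAt.eventually (isOpen_Ioo.mem_nhds hp)
    filter_upwards [h3, h4] with q hq hq2
    refine (huniq q hq2 _ ?_).symm
    have h0 : H (p, S p) = 0 := by simp [H, hS p hp]
    rw [h0] at hq
    exact (sub_eq_zero.1 hq).symm
  have hSapply : ∀ p : ℝ × E, p.1 ∈ Ioo (-T) T → ∀ τ : unitInterval,
      S p τ = p.2 + p.1 • ∫ σ in (0 : ℝ)..τ, v (S p (projIcc 0 1 zero_le_one σ)) := by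
    intro p hp τ
    conv_lhs => rw [← hS p hp]
    rfl
  -- the solution for `t τ` is the initial part of the solution for `t`, rescaled
  have hscale : ∀ t ∈ Ioo (-T) T, ∀ z, ∀ τ : unitInterval, S (t, z) τ = S (t * τ, z) 1 := by
    intro t ht z τ
    have hmem : t * τ ∈ Ioo (-T) T := by
      have : |t * τ| ≤ |t| := by
        rw [abs_mul, abs_of_nonneg τ.2.1]; exact mul_le_of_le_one_right (abs_nonneg _) τ.2.2
      exact abs_lt.1 (this.trans_lt (abs_lt.2 ht))
    have := huniq (t * τ, z) hmem
      ((S (t, z)).comp ⟨fun σ => τ * σ, by fun_prop⟩) ?_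
    · rw [← this]; simp
    ext σ
    change z + (t * (τ : ℝ)) • ∫ r in (0 : ℝ)..σ, v (S (t, z) (τ * projIcc 0 1 zero_le_one r)) =
      S (t, z) (τ * σ)
    rw [hSapply (t, z) ht, mul_smul]
    congr 2
    have h5 : ∀ r ∈ uIcc (0 : ℝ) σ, v (S (t, z) (τ * projIcc 0 1 zero_le_one r)) =
        v (S (t, z) (projIcc 0 1 zero_le_one (τ * r))) := by
      intro r hr
      rw [uIcc_of_le σ.2.1] at hr
      have hr1 : r ∈ Icc (0 : ℝ) 1 := ⟨hr.1, hr.2.trans σ.2.2⟩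
      rw [projIcc_of_mem _ hr1, projIcc_of_mem _ (show (τ : ℝ) * r ∈ Icc (0 : ℝ) 1 from
        ⟨mul_nonneg τ.2.1 hr1.1, mul_le_one₀ τ.2.2 hr1.1 hr1.2⟩)]
      rfl
    rw [intervalIntegral.integral_congr h5]
    have := intervalIntegral.smul_integral_comp_mul_left (a := 0) (b := (σ : ℝ))
      (fun r => v (S (t, z) (projIcc 0 1 zero_le_one r))) (τ : ℝ)
    rw [this]; simp
  let F : ℝ → E → E := fun t z => S (t, z) 1
  have hFsmooth : ∀ p : ℝ × E, p.1 ∈ Ioo (-T) T →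
      ContDiffAt ℝ n (fun p : ℝ × E => F p.1 p.2) p := fun p hp =>
    (show ContDiff ℝ n (fun γ : C(unitInterval, E) => γ 1) from
      (ContinuousMap.evalCLM ℝ (1 : unitInterval) :
        C(unitInterval, E) →L[ℝ] E).contDiff).contDiffAt.comp p (hSsmooth p hp)
  have hF0 : ∀ z, F 0 z = z := by
    intro z
    have := hSapply (0, z) ⟨by simpa using hT0, hT0⟩ 1
    simpa [F] using this
  have hFderiv : ∀ t ∈ Ioo (-T) T, ∀ z, HasDerivAt (fun s => F s z) (v (F t z)) t := by
    intro t ht z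
    have hint : ∀ t ∈ Ioo (-T) T, F t z = z + ∫ s in (0 : ℝ)..t, v (F s z) := by
      intro t ht
      have h1 := hSapply (t, z) ht 1
      have h2 : ∀ σ ∈ uIcc (0 : ℝ) 1, v (S (t, z) (projIcc 0 1 zero_le_one σ)) =
          v (F (t * σ) z) := by
        intro σ hσ
        rw [uIcc_of_le zero_le_one] at hσ
        rw [hscale t ht z, projIcc_of_mem _ hσ]
      change S (t, z) 1 = _
      rw [h1]
      simp only [Icc.coe_one]
      rw [intervalIntegral.integral_congr h2,
        intervalIntegral.smul_integral_comp_mul_left (fun s => v (F s z)) t]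
      simp
    have hFc : ContinuousOn (fun s => v (F s z)) (Ioo (-T) T) := by
      intro s hs
      have h1 := (hFsmooth (s, z) hs).continuousAt
      have h2 : ContinuousAt (fun s : ℝ => (s, z)) s := by fun_prop
      exact (hv.continuous.continuousAt.comp
        (ContinuousAt.comp (f := fun s : ℝ => (s, z)) h1 h2)).continuousWithinAt
    have hsub : uIcc 0 t ⊆ Ioo (-T) T :=
      (convex_Ioo (-T) T).ordConnected.uIcc_subset ⟨by linarith, hT0⟩ ht
    have hd := intervalIntegral.integral_hasDerivAt_right
      ((hFc.mono hsub).intervalIntegrable)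
      (hFc.stronglyMeasurableAtFilter isOpen_Ioo t ht)
      (hFc.continuousAt (isOpen_Ioo.mem_nhds ht))
    refine (hd.const_add z).congr_of_eventuallyEq ?_
    filter_upwards [isOpen_Ioo.mem_nhds ht] with s hs using hint s hs
  refine ⟨F, fun p hp => (hFsmooth p hp.1).contDiffWithinAt, hF0, hFderiv, ?_⟩
  intro t ht z
  -- both `r ↦ F (t + r) z` and `r ↦ F r (F t z)` are orbits through `F t z`
  have hsub : ∀ r ∈ Ioo (max (-T - t) (-T)) (min (T - t) T),
      t + r ∈ Ioo (-T) T ∧ r ∈ Ioo (-T) T := by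
    intro r hr
    obtain ⟨h1, h2⟩ := max_lt_iff.1 hr.1
    obtain ⟨h3, h4⟩ := lt_min_iff.1 hr.2
    exact ⟨⟨by linarith, by linarith⟩, h2, h4⟩
  have h0 : (0 : ℝ) ∈ Ioo (max (-T - t) (-T)) (min (T - t) T) :=
    ⟨max_lt (by linarith [ht.1]) (by linarith), lt_min (by linarith [ht.2]) hT0⟩
  have hneg : -t ∈ Ioo (max (-T - t) (-T)) (min (T - t) T) :=
    ⟨max_lt (by linarith) (by linarith [ht.2]), lt_min (by linarith) (by linarith [ht.1])⟩
  have heq := ODE_solution_unique_of_mem_Ioo (v := fun _ => v) (s := fun _ => univ) (K := K)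
    (fun _ _ => hK.lipschitzOnWith) h0
    (f := fun r => F (t + r) z) (g := fun r => F r (F t z))
    (fun r hr => ⟨(hFderiv _ (hsub r hr).1 z).comp_const_add t r, mem_univ _⟩)
    (fun r hr => ⟨hFderiv _ (hsub r hr).2 _, mem_univ _⟩) (by simp [hF0]) hneg
  simpa [hF0] using heq.symm

end LocalFlow
end ControlAffine

namespace ControlAffine
/-! ### Krener's argument in a vector space -/

section Krener

variable {E : Type*} [NormedAddCommGroup E] [NormedSpace ℝ E]

/-- `F t z` is a flow of the vector field `v`, of class `C²` and defined for `|t| < T`. -/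
structure IsSmoothFlow (v : E → E) (T : ℝ) (F : ℝ → E → E) : Prop where
  pos : 0 < T
  contDiffOn : ContDiffOn ℝ 2 (fun p : ℝ × E => F p.1 p.2) (Ioo (-T) T ×ˢ univ)
  zero : ∀ z, F 0 z = z
  hasDerivAt : ∀ t ∈ Ioo (-T) T, ∀ z, HasDerivAt (fun s => F s z) (v (F t z)) t
  neg_apply : ∀ t ∈ Ioo (-T) T, ∀ z, F (-t) (F t z) = z

namespace IsSmoothFlow

variable {v : E → E} {T : ℝ} {F : ℝ → E → E}

lemma zero_mem (hF : IsSmoothFlow v T F) : (0 : ℝ) ∈ Ioo (-T) T := ⟨by linarith [hF.pos], hF.pos⟩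

lemma contDiffAt (hF : IsSmoothFlow v T F) {t : ℝ} (ht : t ∈ Ioo (-T) T) (z : E) :
    ContDiffAt ℝ 2 (fun p : ℝ × E => F p.1 p.2) (t, z) :=
  hF.contDiffOn.contDiffAt ((isOpen_Ioo.prod isOpen_univ).mem_nhds ⟨ht, mem_univ _⟩)

lemma hasFDerivAt_prod (hF : IsSmoothFlow v T F) {t : ℝ} (ht : t ∈ Ioo (-T) T) (z : E) :
    HasFDerivAt (fun p : ℝ × E => F p.1 p.2)
      (fderiv ℝ (fun p : ℝ × E => F p.1 p.2) (t, z)) (t, z) :=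
  ((hF.contDiffAt ht z).differentiableAt (by norm_num)).hasFDerivAt

lemma hasFDerivAt_right (hF : IsSmoothFlow v T F) {t : ℝ} (ht : t ∈ Ioo (-T) T) (z : E) :
    HasFDerivAt (F t)
      (fderiv ℝ (fun p : ℝ × E => F p.1 p.2) (t, z) ∘L .inr ℝ ℝ E) z :=
  (hF.hasFDerivAt_prod ht z).comp z (hasFDerivAt_prodMk_right t z)

lemma differentiableAt (hF : IsSmoothFlow v T F) {t : ℝ} (ht : t ∈ Ioo (-T) T) (z : E) :
    DifferentiableAt ℝ (F t) z :=
  (hF.hasFDerivAt_right ht z).differentiableAt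

lemma fderiv_prod_apply (hF : IsSmoothFlow v T F) {t : ℝ} (ht : t ∈ Ioo (-T) T) (z : E) (τ : ℝ)
    (h : E) :
    fderiv ℝ (fun p : ℝ × E => F p.1 p.2) (t, z) (τ, h) =
      τ • v (F t z) + fderiv ℝ (F t) z h := by
  have h1 : fderiv ℝ (fun p : ℝ × E => F p.1 p.2) (t, z) (1, 0) = v (F t z) := by
    have h2 := HasFDerivAt.comp (f := fun s : ℝ => (s, z)) t (hF.hasFDerivAt_prod ht z)
      (hasFDerivAt_prodMk_left t z)
    have := h2.hasDerivAt.unique (hF.hasDerivAt t ht z)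
    simpa using this
  have h3 := congrArg (fun L : E →L[ℝ] E => L h) (hF.hasFDerivAt_right ht z).fderiv
  have h4 : ((τ, h) : ℝ × E) = τ • (1, 0) + (0, h) := by simp
  rw [h4, map_add, map_smul, h1, h3]
  simp

lemma fderiv_zero (hF : IsSmoothFlow v T F) (z : E) : fderiv ℝ (F 0) z = .id ℝ E := by
  have : F 0 = id := funext hF.zero
  rw [this, fderiv_id]

lemma fderiv_injective (hF : IsSmoothFlow v T F) {t : ℝ} (ht : t ∈ Ioo (-T) T) (z : E) :
    Function.Injective (fderiv ℝ (F t) z) := by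
  have ht' : -t ∈ Ioo (-T) T := ⟨by linarith [ht.2], by linarith [ht.1]⟩
  have h1 : HasFDerivAt (fun z => F (-t) (F t z)) _ z :=
    (hF.differentiableAt ht' (F t z)).hasFDerivAt.comp z (hF.differentiableAt ht z).hasFDerivAt
  have h2 : (fun z => F (-t) (F t z)) = id := funext (hF.neg_apply t ht)
  rw [h2] at h1
  have h3 := h1.unique (hasFDerivAt_id z)
  intro a b hab
  have ha := congrArg (fun L : E →L[ℝ] E => L a) h3
  have hb := congrArg (fun L : E →L[ℝ] E => L b) h3
  simp only [ContinuousLinearMap.comp_apply, ContinuousLinearMap.id_apply] at ha hb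
  rw [← ha, ← hb, hab]

lemma norm_sub_le (hF : IsSmoothFlow v T F) {L : ℝ} (hL : ∀ z, ‖v z‖ ≤ L) {t : ℝ}
    (ht : t ∈ Ioo (-T) T) (z : E) :
    ‖F t z - z‖ ≤ L * |t| := by
  have := (convex_Ioo (-T) T).norm_image_sub_le_of_norm_hasDerivWithin_le
    (f := fun s => F s z) (fun s hs => (hF.hasDerivAt s hs z).hasDerivWithinAt)
    (fun s _ => hL _) hF.zero_mem ht
  simpa [hF.zero] using this

/-- The derivative in time, at time zero, of the linearized flow is the linearized vector field. -/
lemma hasDerivAt_fderiv (hF : IsSmoothFlow v T F) (hv : Differentiable ℝ v) (z : E) :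
    HasDerivAt (fun t => fderiv ℝ (F t) z) (fderiv ℝ v z) 0 := by
  set Φ : ℝ × E → E := fun p => F p.1 p.2 with hΦ
  have hC := hF.contDiffAt hF.zero_mem z
  have hd : DifferentiableAt ℝ (fderiv ℝ Φ) (0, z) :=
    (hC.fderiv_right (m := 1) (by norm_num)).differentiableAt (by norm_num)
  have hsymm : IsSymmSndFDerivAt ℝ Φ (0, z) := hC.isSymmSndFDerivAt (by simp)
  set B := fderiv ℝ (fderiv ℝ Φ) (0, z) with hB
  have h1 : HasDerivAt (fun t : ℝ => fderiv ℝ Φ (t, z)) (B (1, 0)) 0 := by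
    have : HasFDerivAt (fun t : ℝ => fderiv ℝ Φ (t, z)) _ 0 :=
      hd.hasFDerivAt.comp (0 : ℝ) (hasFDerivAt_prodMk_left (0 : ℝ) z)
    simpa using this.hasDerivAt
  have h2 : HasDerivAt (fun t : ℝ => fderiv ℝ Φ (t, z) ∘L .inr ℝ ℝ E)
      (B (1, 0) ∘L .inr ℝ ℝ E) 0 := by
    have := ((ContinuousLinearMap.compL ℝ E (ℝ × E) E).flip
      (.inr ℝ ℝ E)).hasFDerivAt.comp_hasDerivAt (0 : ℝ) h1
    simpa using! this
  have h3 : B (1, 0) ∘L .inr ℝ ℝ E = fderiv ℝ v z := by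
    ext h
    have h4 : HasFDerivAt (fun y : E => fderiv ℝ Φ (0, y) (1, 0))
        (((ContinuousLinearMap.apply ℝ E ((1 : ℝ), (0 : E))) ∘L B) ∘L .inr ℝ ℝ E) z :=
      ((ContinuousLinearMap.apply ℝ E ((1 : ℝ), (0 : E))).hasFDerivAt.comp (0, z)
        hd.hasFDerivAt).comp z (hasFDerivAt_prodMk_right (0 : ℝ) z)
    have h5 : (fun y : E => fderiv ℝ Φ (0, y) (1, 0)) = v := by
      funext y
      have := hF.fderiv_prod_apply hF.zero_mem y 1 0
      simpa [hF.zero] using this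
    rw [h5] at h4
    have h6 := congrArg (fun L : E →L[ℝ] E => L h) (h4.unique (hv z).hasFDerivAt)
    rw [← h6]
    simpa using hsymm.eq (1, 0) (0, h)
  rw [h3] at h2
  refine h2.congr_of_eventuallyEq ?_
  filter_upwards [isOpen_Ioo.mem_nhds hF.zero_mem] with t ht
  exact (hF.hasFDerivAt_right ht z).fderiv

/-- If a vector field `Y` along the forward orbit of `z` stays in the image of a subspace under the
linearized flow, then the subspace contains the bracket of the two fields. -/
lemma lieBracket_mem (hF : IsSmoothFlow v T F) [FiniteDimensional ℝ E] (hv : Differentiable ℝ v)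
    {z : E} {Y : E → E} (hY : DifferentiableAt ℝ Y z) {S : Submodule ℝ E} {δ : ℝ} (hδ : 0 < δ)
    (h : ∀ t ∈ Ico 0 δ, Y (F t z) ∈ S.map (fderiv ℝ (F t) z : E →ₗ[ℝ] E)) :
    VectorField.lieBracket ℝ v Y z ∈ S := by
  have hA := hF.hasDerivAt_fderiv hv z
  have hA0 : fderiv ℝ (F 0) z = ((1 : (E →L[ℝ] E)ˣ) : E →L[ℝ] E) := hF.fderiv_zero z
  have hinv : HasDerivAt (fun t => Ring.inverse (fderiv ℝ (F t) z)) (-fderiv ℝ v z) 0 := by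
    have h1 := hasFDerivAt_ringInverse (𝕜 := ℝ) (1 : (E →L[ℝ] E)ˣ)
    rw [← hA0] at h1
    have h2 := h1.comp_hasDerivAt (0 : ℝ) hA
    have h3 : (-ContinuousLinearMap.mulLeftRight ℝ (E →L[ℝ] E) ↑(1 : (E →L[ℝ] E)ˣ)⁻¹
        ↑(1 : (E →L[ℝ] E)ˣ)⁻¹) (fderiv ℝ v z) = -fderiv ℝ v z := by simp
    rw [h3] at h2
    exact h2
  have hYt : HasDerivAt (fun t => Y (F t z)) (fderiv ℝ Y z (v z)) 0 := by
    have h1 := hF.hasDerivAt 0 hF.zero_mem z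
    have h2 : HasFDerivAt Y (fderiv ℝ Y z) (F 0 z) := by rw [hF.zero]; exact hY.hasFDerivAt
    have h3 := h2.comp_hasDerivAt (0 : ℝ) h1
    rw [hF.zero] at h3
    exact h3
  have he := hinv.clm_apply hYt
  have hval : (-fderiv ℝ v z) (Y (F 0 z)) + Ring.inverse (fderiv ℝ (F 0) z) (fderiv ℝ Y z (v z)) =
      VectorField.lieBracket ℝ v Y z := by
    rw [hA0, hF.zero, Ring.inverse_unit]
    simp [VectorField.lieBracket, sub_eq_neg_add]
  rw [hval] at he
  have hmem : ∀ᶠ t in 𝓝[>] (0 : ℝ), Ring.inverse (fderiv ℝ (F t) z) (Y (F t z)) ∈ S := by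
    have hunit : ∀ᶠ t in 𝓝 (0 : ℝ), IsUnit (fderiv ℝ (F t) z) := by
      have := Units.nhds (1 : (E →L[ℝ] E)ˣ)
      rw [← hA0] at this
      exact hA.continuousAt.eventually this
    filter_upwards [hunit.filter_mono nhdsWithin_le_nhds, Ioo_mem_nhdsGT hδ] with t hu ht
    obtain ⟨w, hw, hwY⟩ := h t ⟨ht.1.le, ht.2⟩
    rw [← hwY]
    obtain ⟨uu, huu⟩ := hu
    rw [← huu, Ring.inverse_unit]
    have : (↑uu⁻¹ : E →L[ℝ] E) ((↑uu : E →L[ℝ] E) w) = w := by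
      rw [← mul_apply_eq_comp, Units.inv_mul]; rfl
    exact this.symm ▸ hw
  have hmem0 : Ring.inverse (fderiv ℝ (F 0) z) (Y (F 0 z)) ∈ S := by
    obtain ⟨w, hw, hwY⟩ := h 0 ⟨le_rfl, hδ⟩
    rw [← hwY, hA0, Ring.inverse_unit]
    simpa using hw
  have hslope := (hasDerivAt_iff_tendsto_slope.1 he).mono_left
    (nhdsWithin_mono (0 : ℝ) (s := Ioi 0) (t := {0}ᶜ) (fun t ht => (mem_Ioi.1 ht).ne'))
  refine S.closed_of_finiteDimensional.mem_of_tendsto hslope ?_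
  filter_upwards [hmem] with t ht
  rw [slope_def_module]
  exact S.smul_mem _ (S.sub_mem ht hmem0)

end IsSmoothFlow

/-- The endpoint of the concatenation of the flows `F (J 0)`, `F (J 1)`, …, followed for the times
`s 0`, `s 1`, …, starting at `z`. -/
def flowWord {ι : Type*} (F : ι → ℝ → E → E) : (n : ℕ) → (Fin n → ι) → (Fin n → ℝ) → E → E
  | 0, _, _, z => z
  | n + 1, J, s, z => F (J (Fin.last n)) (s (Fin.last n))
      (flowWord F n (fun i => J i.castSucc) (fun i => s i.castSucc) z)

/-- `FlowChain F q σ q' A`: the point `q'` is the endpoint of a concatenation of flows `F j` of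
total duration `σ` that starts at `q`, and `A` is the derivative at `q` of that concatenation. -/
inductive FlowChain {ι : Type*} (F : ι → ℝ → E → E) (q : E) : ℝ → E → (E →L[ℝ] E) → Prop where
  | refl : FlowChain F q 0 q (.id ℝ E)
  | step {σ : ℝ} {q' : E} {A : E →L[ℝ] E} (j : ι) {t : ℝ} (ht : 0 ≤ t) :
      FlowChain F q σ q' A → FlowChain F q (σ + t) (F j t q') (fderiv ℝ (F j t) q' ∘L A)

variable {ι : Type*} {v : ι → E → E} {T : ℝ} {F : ι → ℝ → E → E}

lemma flowWord_snoc {E : Type*} {F : ι → ℝ → E → E} (n : ℕ) (J : Fin n → ι) (j : ι)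
    (s : Fin (n + 1) → ℝ) (z : E) :
    flowWord F (n + 1) (Fin.snoc (α := fun _ => ι) J j) s z =
      F j (s (Fin.last n)) (flowWord F n J (fun i => s i.castSucc) z) := by
  simp [flowWord]

lemma FlowChain.nonneg {q q' : E} {σ : ℝ} {A : E →L[ℝ] E} (h : FlowChain F q σ q' A) : 0 ≤ σ := by
  induction h with
  | refl => exact le_rfl
  | step j ht _ ih => exact add_nonneg ih ht

lemma FlowChain.norm_sub_le (hF : ∀ j, IsSmoothFlow (v j) T (F j)) {L : ℝ}
    (hL : ∀ j z, ‖v j z‖ ≤ L) {q q' : E} {σ : ℝ} {A : E →L[ℝ] E} (h : FlowChain F q σ q' A)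
    (hσ : σ < T) : ‖q' - q‖ ≤ L * σ := by
  induction h with
  | refl => simp
  | @step σ q' A j t ht hc ih =>
    have h0 := hc.nonneg
    have h1 := (hF j).norm_sub_le (hL j) (t := t) ⟨by linarith, by linarith⟩ q'
    have h2 := ih (by linarith)
    rw [abs_of_nonneg ht] at h1
    have h3 := norm_add_le (F j t q' - q') (q' - q)
    rw [sub_add_sub_cancel] at h3
    linarith

lemma FlowChain.injective (hF : ∀ j, IsSmoothFlow (v j) T (F j)) {q q' : E} {σ : ℝ}
    {A : E →L[ℝ] E} (h : FlowChain F q σ q' A) (hσ : σ < T) : Function.Injective A := by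
  induction h with
  | refl => exact fun _ _ h => h
  | @step σ q' A j t ht hc ih =>
    have h0 := hc.nonneg
    exact ((hF j).fderiv_injective (t := t) ⟨by linarith, by linarith⟩ q').comp
      (ih (by linarith))

lemma contDiffOn_flowWord (hF : ∀ j, IsSmoothFlow (v j) T (F j)) (n : ℕ) (J : Fin n → ι) :
    ContDiffOn ℝ 2 (fun p : (Fin n → ℝ) × E => flowWord F n J p.1 p.2)
      ({s | ∀ i, s i ∈ Ioo (-T) T} ×ˢ univ) := by
  induction n with
  | zero => exact contDiffOn_snd
  | succ n ih =>
    have h1 : ContDiffOn ℝ 2 (fun p : (Fin (n + 1) → ℝ) × E =>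
        ((fun i : Fin n => p.1 i.castSucc), p.2)) ({s | ∀ i, s i ∈ Ioo (-T) T} ×ˢ univ) := by
      refine ContDiff.contDiffOn ?_
      fun_prop
    have h2 := (ih (fun i => J i.castSucc)).comp h1 (fun p hp => ⟨fun i => hp.1 _, mem_univ _⟩)
    have h3 : ContDiffOn ℝ 2 (fun p : (Fin (n + 1) → ℝ) × E => p.1 (Fin.last n))
        ({s | ∀ i, s i ∈ Ioo (-T) T} ×ˢ univ) := by
      refine ContDiff.contDiffOn ?_
      fun_prop
    exact (hF (J (Fin.last n))).contDiffOn.comp (h3.prodMk h2)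
      (fun p hp => ⟨hp.1 _, mem_univ _⟩)

lemma isOpen_times (n : ℕ) (T : ℝ) : IsOpen {s : Fin n → ℝ | ∀ i, s i ∈ Ioo (-T) T} := by
  simp only [ofPred_forall]
  exact isOpen_iInter_of_finite fun i => isOpen_Ioo.preimage (continuous_apply i)

lemma contDiffAt_flowWord (hF : ∀ j, IsSmoothFlow (v j) T (F j)) (n : ℕ) (J : Fin n → ι)
    {s : Fin n → ℝ} (hs : ∀ i, s i ∈ Ioo (-T) T) (z : E) :
    ContDiffAt ℝ 2 (fun p : (Fin n → ℝ) × E => flowWord F n J p.1 p.2) (s, z) :=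
  (contDiffOn_flowWord hF n J).contDiffAt (((isOpen_times n T).prod isOpen_univ).mem_nhds
    ⟨hs, mem_univ _⟩)

lemma contDiffAt_flowWord_left (hF : ∀ j, IsSmoothFlow (v j) T (F j)) (n : ℕ) (J : Fin n → ι)
    {s : Fin n → ℝ} (hs : ∀ i, s i ∈ Ioo (-T) T) (z : E) :
    ContDiffAt ℝ 2 (fun s : Fin n → ℝ => flowWord F n J s z) s :=
  ContDiffAt.comp (f := fun s : Fin n → ℝ => (s, z)) s (contDiffAt_flowWord hF n J hs z)
    (contDiffAt_id.prodMk contDiffAt_const)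

/-- The tangent space spanned by varying the switching times of a concatenation of flows. -/
noncomputable def wordTangent (F : ι → ℝ → E → E) (n : ℕ) (J : Fin n → ι) (s : Fin n → ℝ) (z : E) :
    Submodule ℝ E :=
  LinearMap.range (fderiv ℝ (fun s : Fin n → ℝ => flowWord F n J s z) s : (Fin n → ℝ) →ₗ[ℝ] E)

lemma wordTangent_snoc (hF : ∀ j, IsSmoothFlow (v j) T (F j)) (n : ℕ) (J : Fin n → ι)
    {s : Fin n → ℝ} (hs : ∀ i, s i ∈ Ioo (-T) T) (z : E) (j : ι) {t : ℝ} (ht : t ∈ Ioo (-T) T) :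
    (wordTangent F n J s z).map (fderiv ℝ (F j t) (flowWord F n J s z) : E →ₗ[ℝ] E) ≤
        wordTangent F (n + 1) (Fin.snoc (α := fun _ => ι) J j)
          (Fin.snoc (α := fun _ => ℝ) s t) z ∧
      v j (F j t (flowWord F n J s z)) ∈ wordTangent F (n + 1) (Fin.snoc (α := fun _ => ι) J j)
          (Fin.snoc (α := fun _ => ℝ) s t) z := by
  set s' : Fin (n + 1) → ℝ := Fin.snoc (α := fun _ => ℝ) s t with hs'
  have hs'i : (fun i : Fin n => s' i.castSucc) = s := by funext i; simp [hs']
  have hs'l : s' (Fin.last n) = t := by simp [hs']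
  let pr : (Fin (n + 1) → ℝ) →L[ℝ] (Fin n → ℝ) :=
    ContinuousLinearMap.pi fun i => ContinuousLinearMap.proj i.castSucc
  have hG : HasFDerivAt (fun s : Fin n → ℝ => flowWord F n J s z)
      (fderiv ℝ (fun s : Fin n → ℝ => flowWord F n J s z) s) (pr s') := by
    have : pr s' = s := hs'i
    rw [this]
    exact ((contDiffAt_flowWord_left hF n J hs z).differentiableAt (by norm_num)).hasFDerivAt
  have h1 : HasFDerivAt (fun r : Fin (n + 1) → ℝ =>
      (r (Fin.last n), flowWord F n J (fun i => r i.castSucc) z))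
      ((ContinuousLinearMap.proj (R := ℝ) (φ := fun _ : Fin (n + 1) => ℝ) (Fin.last n)).prod
        (fderiv ℝ (fun s : Fin n → ℝ => flowWord F n J s z) s ∘L pr)) s' :=
    (ContinuousLinearMap.proj (R := ℝ) (φ := fun _ : Fin (n + 1) => ℝ)
      (Fin.last n)).hasFDerivAt.prodMk (hG.comp s' pr.hasFDerivAt)
  have h2 := (hF j).hasFDerivAt_prod ht (flowWord F n J s z)
  have h3 : HasFDerivAt (fun r => flowWord F (n + 1) (Fin.snoc (α := fun _ => ι) J j) r z)
      (fderiv ℝ (fun p : ℝ × E => F j p.1 p.2) (t, flowWord F n J s z) ∘L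
        ((ContinuousLinearMap.proj (R := ℝ) (φ := fun _ : Fin (n + 1) => ℝ) (Fin.last n)).prod
        (fderiv ℝ (fun s : Fin n → ℝ => flowWord F n J s z) s ∘L pr))) s' := by
    simp only [flowWord_snoc]
    refine HasFDerivAt.comp (g := fun p : ℝ × E => F j p.1 p.2) s' ?_ h1
    rw [hs'i, hs'l]
    exact h2
  have h4 : ∀ r : Fin (n + 1) → ℝ,
      fderiv ℝ (fun r => flowWord F (n + 1) (Fin.snoc (α := fun _ => ι) J j) r z) s' r =
      r (Fin.last n) • v j (F j t (flowWord F n J s z)) +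
        fderiv ℝ (F j t) (flowWord F n J s z)
          (fderiv ℝ (fun s : Fin n → ℝ => flowWord F n J s z) s (pr r)) := by
    intro r
    rw [h3.fderiv]
    exact (hF j).fderiv_prod_apply ht _ _ _
  constructor
  · rintro _ ⟨_, ⟨r, rfl⟩, rfl⟩
    refine ⟨Fin.snoc (α := fun _ => ℝ) r 0, ?_⟩
    have : pr (Fin.snoc (α := fun _ => ℝ) r 0) = r := by ext i; simp [pr]
    simpa [this] using h4 (Fin.snoc (α := fun _ => ℝ) r 0)
  · refine ⟨Fin.snoc (α := fun _ => ℝ) 0 1, ?_⟩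
    have : pr (Fin.snoc (α := fun _ => ℝ) 0 1) = 0 := by ext i; simp [pr]
    simpa [this] using h4 (Fin.snoc (α := fun _ => ℝ) 0 1)

lemma FlowChain.exists_word (hF : ∀ j, IsSmoothFlow (v j) T (F j)) {n : ℕ} {J : Fin n → ι}
    {s : Fin n → ℝ} (hs : ∀ i, 0 ≤ s i) {z q' : E} {σ : ℝ} {A : E →L[ℝ] E}
    (h : FlowChain F (flowWord F n J s z) σ q' A) (hσ : ∑ i, s i + σ < T) :
    ∃ (n' : ℕ) (J' : Fin n' → ι) (s' : Fin n' → ℝ), (∀ i, 0 ≤ s' i) ∧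
      ∑ i, s' i = ∑ i, s i + σ ∧ flowWord F n' J' s' z = q' ∧
      (wordTangent F n J s z).map (A : E →ₗ[ℝ] E) ≤ wordTangent F n' J' s' z := by
  induction h with
  | refl => exact ⟨n, J, s, hs, by simp, rfl, by simp⟩
  | @step σ q' A j t ht hc ih =>
    obtain ⟨n', J', s', hs', hsum, hq, hle⟩ := ih (by linarith)
    have h0 := hc.nonneg
    have hS : 0 ≤ ∑ i, s i := Finset.sum_nonneg fun i _ => hs i
    have hs'T : ∀ i, s' i ∈ Ioo (-T) T := by
      intro i
      have h1 := Finset.single_le_sum (fun i _ => hs' i) (Finset.mem_univ i)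
      exact ⟨by linarith [hs' i], by linarith⟩
    have hw := (wordTangent_snoc hF n' J' hs'T z j (t := t) ⟨by linarith, by linarith⟩).1
    refine ⟨n' + 1, Fin.snoc (α := fun _ => ι) J' j, Fin.snoc (α := fun _ => ℝ) s' t, ?_, ?_, ?_,
      ?_⟩
    · intro i
      refine Fin.lastCases ?_ (fun i => ?_) i
      · simpa using ht
      · simpa using hs' i
    · rw [Fin.sum_univ_castSucc]; simp [hsum, add_assoc]
    · rw [flowWord_snoc]; simp [hq]
    · rw [hq] at hw
      refine le_trans ?_ hw
      rw [ContinuousLinearMap.toLinearMap_comp, Submodule.map_comp]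
      exact Submodule.map_mono hle

/-- Choose a concatenation of flows, of total duration less than `σ`, whose tangent space has
maximal dimension. Then no further flow adds a new direction: along every continuation, the vector
fields stay in the image of the tangent space under the linearized continuation. -/
theorem exists_word_forall_chain_mem [FiniteDimensional ℝ E] [Nonempty ι]
    (hF : ∀ j, IsSmoothFlow (v j) T (F j)) (z : E) {σ : ℝ} (hσ : 0 < σ) (hσT : σ ≤ T) :
    ∃ (n : ℕ) (J : Fin n → ι) (s : Fin n → ℝ), 0 < n ∧ (∀ i, 0 ≤ s i) ∧ ∑ i, s i < σ ∧
      ∃ β > 0, ∑ i, s i + β ≤ σ ∧ ∀ (τ : ℝ) (q' : E) (A : E →L[ℝ] E),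
        FlowChain F (flowWord F n J s z) τ q' A →
        τ < β → ∀ j, v j q' ∈ (wordTangent F n J s z).map (A : E →ₗ[ℝ] E) := by
  let P : Set ℕ := {r | ∃ (n : ℕ) (J : Fin n → ι) (s : Fin n → ℝ), 0 < n ∧ (∀ i, 0 ≤ s i) ∧
    ∑ i, s i < σ ∧ Module.finrank ℝ (wordTangent F n J s z) = r}
  have hne : P.Nonempty := ⟨_, 1, fun _ => Classical.arbitrary ι, fun _ => 0, one_pos,
    fun _ => le_rfl, by simpa using hσ, rfl⟩
  have hbdd : BddAbove P := ⟨Module.finrank ℝ E, by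
    rintro _ ⟨n, J, s, -, -, -, rfl⟩
    exact Submodule.finrank_le _⟩
  obtain ⟨n, J, s, hn, hs, hsσ, hr⟩ := Nat.sSup_mem hne hbdd
  refine ⟨n, J, s, hn, hs, hsσ, σ - ∑ i, s i, by linarith, by linarith, ?_⟩
  intro τ q' A hc hτ j
  obtain ⟨n', J', s', hs', hsum, hq, hle⟩ := hc.exists_word hF hs (by linarith)
  have hS : 0 ≤ ∑ i, s i := Finset.sum_nonneg fun i _ => hs i
  have hs'T : ∀ i, s' i ∈ Ioo (-T) T := by
    intro i
    have h1 := Finset.single_le_sum (fun i _ => hs' i) (Finset.mem_univ i)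
    exact ⟨by linarith [hs' i, (hF j).pos], by linarith⟩
  have hw := wordTangent_snoc hF n' J' hs'T z j (hF j).zero_mem
  rw [(hF j).zero, (hF j).fderiv_zero, hq] at hw
  set S := wordTangent F (n' + 1) (Fin.snoc (α := fun _ => ι) J' j)
    (Fin.snoc (α := fun _ => ℝ) s' 0) z
  have hle2 : (wordTangent F n J s z).map (A : E →ₗ[ℝ] E) ≤ S := by
    refine hle.trans ?_
    have := hw.1
    rwa [ContinuousLinearMap.coe_id, Submodule.map_id] at this
  have hdim : Module.finrank ℝ S ≤
      Module.finrank ℝ ((wordTangent F n J s z).map (A : E →ₗ[ℝ] E)) := by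
    have h1 : Module.finrank ℝ ((wordTangent F n J s z).map (A : E →ₗ[ℝ] E)) =
        Module.finrank ℝ (wordTangent F n J s z) :=
      (Submodule.equivMapOfInjective (A : E →ₗ[ℝ] E) (hc.injective hF (by linarith))
        (wordTangent F n J s z)).finrank_eq.symm
    rw [h1, hr]
    refine le_csSup hbdd ⟨n' + 1, _, _, Nat.succ_pos _, ?_, ?_, rfl⟩
    · intro i
      refine Fin.lastCases ?_ (fun i => ?_) i
      · simp
      · simpa using hs' i
    · rw [Fin.sum_univ_castSucc]; simp [hsum]; linarith
  rw [Submodule.eq_of_le_of_finrank_le hle2 hdim]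
  exact hw.2

/-- The vector fields that stay in the image of a subspace along all continuations are closed under
brackets with the generating vector fields. -/
lemma FlowChain.lieBracket_mem [FiniteDimensional ℝ E] (hF : ∀ j, IsSmoothFlow (v j) T (F j))
    (hv : ∀ j, Differentiable ℝ (v j)) {q : E} {β : ℝ} {S : Submodule ℝ E}
    {Y : E → E}
    (hYd : ∀ τ q' A, FlowChain F q τ q' A → τ < β → DifferentiableAt ℝ Y q')
    (hY : ∀ τ q' A, FlowChain F q τ q' A → τ < β → Y q' ∈ S.map (A : E →ₗ[ℝ] E)) (j : ι)
    {τ : ℝ} {q' : E} {A : E →L[ℝ] E} (hc : FlowChain F q τ q' A) (hτ : τ < β) :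
    VectorField.lieBracket ℝ (v j) Y q' ∈ S.map (A : E →ₗ[ℝ] E) := by
  refine (hF j).lieBracket_mem (hv j) (hYd τ q' A hc hτ) (sub_pos.2 hτ) fun t ht => ?_
  rw [← Submodule.map_comp, ← ContinuousLinearMap.toLinearMap_comp]
  exact hY _ _ _ (hc.step j ht.1) (by linarith [ht.2])

end Krener
end ControlAffine

namespace ControlAffine
/-! ### Vector fields in charts -/

section ChartRep

variable {d : ℕ} {M : Type*} [TopologicalSpace M] [ChartedSpace (EuclideanSpace ℝ (Fin d)) M]

/-- The representation of a vector field in the chart at `p`. -/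
noncomputable def chartRep (p : M) (V : (x : M) → TangentSpace (𝓡 d) x)
    (y : EuclideanSpace ℝ (Fin d)) : EuclideanSpace ℝ (Fin d) :=
  (mfderiv (𝓡 d) 𝓘(ℝ, EuclideanSpace ℝ (Fin d)) (extChartAt (𝓡 d) p)
    ((extChartAt (𝓡 d) p).symm y) (V ((extChartAt (𝓡 d) p).symm y)) : EuclideanSpace ℝ (Fin d))

lemma symm_mem_chart_source {p : M} {y : EuclideanSpace ℝ (Fin d)}
    (hy : y ∈ (extChartAt (𝓡 d) p).target) :
    (extChartAt (𝓡 d) p).symm y ∈ (chartAt (EuclideanSpace ℝ (Fin d)) p).source := by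
  rw [← extChartAt_source (𝓡 d)]
  exact (extChartAt (𝓡 d) p).map_target hy

variable [IsManifold (𝓡 d) ∞ M]

/-- The derivative of a chart is the second component of the associated trivialization of the
tangent bundle. -/
lemma mfderiv_extChartAt_apply_eq {p x : M}
    (hx : x ∈ (chartAt (EuclideanSpace ℝ (Fin d)) p).source) (v : TangentSpace (𝓡 d) x) :
    (mfderiv (𝓡 d) 𝓘(ℝ, EuclideanSpace ℝ (Fin d)) (extChartAt (𝓡 d) p) x v :
      EuclideanSpace ℝ (Fin d)) = (trivializationAt (EuclideanSpace ℝ (Fin d))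
        (TangentSpace (𝓡 d) : M → Type _) p (⟨x, v⟩ : TangentBundle (𝓡 d) M)).2 := by
  refine (DFunLike.congr_fun (TangentBundle.continuousLinearMapAt_trivializationAt hx).symm v).trans
    ?_
  rw [Bundle.Trivialization.continuousLinearMapAt_apply,
    Bundle.Trivialization.coe_linearMapAt_of_mem]
  exact hx

/-- The chart representation of a smooth parametrized family of vector fields is jointly smooth. -/
lemma contDiffOn_chartRep {k : ℕ} {f : EuclideanSpace ℝ (Fin k) → (x : M) → TangentSpace (𝓡 d) x}
    {A : Set (EuclideanSpace ℝ (Fin k))}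
    (hf : ContMDiffOn ((𝓡 k).prod (𝓡 d)) (𝓡 d).tangent ∞
      (fun p : EuclideanSpace ℝ (Fin k) × M => (⟨p.2, f p.1 p.2⟩ : TangentBundle (𝓡 d) M))
      (A ×ˢ univ)) (p : M) :
    ContDiffOn ℝ ∞ (fun q : EuclideanSpace ℝ (Fin k) × EuclideanSpace ℝ (Fin d) =>
      chartRep p (f q.1) q.2) (A ×ˢ (extChartAt (𝓡 d) p).target) := by
  have h1 : ContMDiffOn (𝓘(ℝ, EuclideanSpace ℝ (Fin k) × EuclideanSpace ℝ (Fin d)))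
      ((𝓡 k).prod (𝓡 d)) ∞
      (fun q : EuclideanSpace ℝ (Fin k) × EuclideanSpace ℝ (Fin d) =>
        (q.1, (extChartAt (𝓡 d) p).symm q.2)) (A ×ˢ (extChartAt (𝓡 d) p).target) := by
    refine ContMDiffOn.prodMk ?_ ?_
    · exact contDiff_fst.contMDiff.contMDiffOn
    · exact (contMDiffOn_extChartAt_symm p).comp contDiff_snd.contMDiff.contMDiffOn
        (fun q hq => hq.2)
  have h2 := hf.comp h1 (fun q hq => ⟨hq.1, mem_univ _⟩)
  have h3 := ((trivializationAt (EuclideanSpace ℝ (Fin d))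
    (TangentSpace (𝓡 d) : M → Type _) p).contMDiffOn_iff (fun q hq => by
      rw [Bundle.Trivialization.mem_source]
      exact symm_mem_chart_source hq.2)).1 h2
  refine ContMDiffOn.contDiffOn (h3.2.congr fun q hq => ?_)
  have hs := symm_mem_chart_source hq.2
  change chartRep p (f q.1) q.2 = _
  exact mfderiv_extChartAt_apply_eq hs _

lemma contDiffOn_chartRep_of_contMDiff {V : (x : M) → TangentSpace (𝓡 d) x}
    (hV : ContMDiff (𝓡 d) (𝓡 d).tangent ∞ (fun x => (⟨x, V x⟩ : TangentBundle (𝓡 d) M))) (p : M) :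
    ContDiffOn ℝ ∞ (chartRep p V) (extChartAt (𝓡 d) p).target := by
  have h2 := (hV.comp_contMDiffOn (contMDiffOn_extChartAt_symm (I := 𝓡 d) (n := ∞) p))
  have h3 := ((trivializationAt (EuclideanSpace ℝ (Fin d))
    (TangentSpace (𝓡 d) : M → Type _) p).contMDiffOn_iff (fun q hq => by
      rw [Bundle.Trivialization.mem_source]
      exact symm_mem_chart_source hq)).1 h2
  refine ContMDiffOn.contDiffOn (h3.2.congr fun q hq => ?_)
  have hs := symm_mem_chart_source hq
  exact mfderiv_extChartAt_apply_eq hs _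

lemma mpullback_symm_eq_chartRep (V : (x : M) → TangentSpace (𝓡 d) x) {p : M}
    {y : EuclideanSpace ℝ (Fin d)} (hy : y ∈ (extChartAt (𝓡 d) p).target) :
    VectorField.mpullback 𝓘(ℝ, EuclideanSpace ℝ (Fin d)) (𝓡 d) (extChartAt (𝓡 d) p).symm V y =
      chartRep p V y := by
  have h1 := mfderiv_extChartAt_comp_mfderivWithin_extChartAt_symm hy
  have h2 := mfderivWithin_extChartAt_symm_comp_mfderiv_extChartAt hy
  rw [ModelWithCorners.range_eq_univ, mfderivWithin_univ] at h1 h2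
  rw [VectorField.mpullback_apply, ContinuousLinearMap.inverse_eq h2 h1]
  rfl

lemma chartRep_mlieBracket {V W : (x : M) → TangentSpace (𝓡 d) x}
    (hV : ContMDiff (𝓡 d) (𝓡 d).tangent ∞ (fun x => (⟨x, V x⟩ : TangentBundle (𝓡 d) M)))
    (hW : ContMDiff (𝓡 d) (𝓡 d).tangent ∞ (fun x => (⟨x, W x⟩ : TangentBundle (𝓡 d) M)))
    {p : M} {y : EuclideanSpace ℝ (Fin d)} (hy : y ∈ (extChartAt (𝓡 d) p).target) :
    chartRep p (VectorField.mlieBracket (𝓡 d) V W) y =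
      VectorField.lieBracket ℝ (chartRep p V) (chartRep p W) y := by
  rw [← mpullback_symm_eq_chartRep _ hy]
  have hn : (∞ : WithTop ℕ∞) ≠ 0 := by simp
  have hi : IsManifold (𝓡 d) (minSmoothness ℝ 3) M := by
    rw [minSmoothness_of_isRCLikeNormedField]
    exact IsManifold.of_le (n := ∞) ENat.LEInfty.out
  rw [VectorField.mpullback_mlieBracket (n := ∞) (hV.mdifferentiable hn _)
    (hW.mdifferentiable hn _)
    ((contMDiffOn_extChartAt_symm p).contMDiffAt ((isOpen_extChartAt_target p).mem_nhds hy))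
    (by rw [minSmoothness_of_isRCLikeNormedField]; exact ENat.LEInfty.out),
    ← VectorField.mlieBracketWithin_univ, VectorField.mlieBracketWithin_eq_lieBracketWithin]
  refine (congrFun VectorField.lieBracketWithin_univ y).trans ?_
  have hev : ∀ V : (x : M) → TangentSpace (𝓡 d) x,
      VectorField.mpullback 𝓘(ℝ, EuclideanSpace ℝ (Fin d)) (𝓡 d) (extChartAt (𝓡 d) p).symm V
        =ᶠ[𝓝 y] chartRep p V := fun V => by
    filter_upwards [(isOpen_extChartAt_target p).mem_nhds hy] with z hz
      using mpullback_symm_eq_chartRep V hz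
  exact (hev V).lieBracket_vectorField_eq (hev W)

end ChartRep
end ControlAffine

namespace ControlAffine
/-! ### The Lie algebra generated by a control system -/

section LieRank

variable {d m : ℕ} {M : Type*} [TopologicalSpace M] [ChartedSpace (EuclideanSpace ℝ (Fin d)) M]

lemma chartRep_add (p : M) (V W : (x : M) → TangentSpace (𝓡 d) x)
    (y : EuclideanSpace ℝ (Fin d)) :
    chartRep p (fun x => V x + W x) y = chartRep p V y + chartRep p W y :=
  map_add (mfderiv (𝓡 d) 𝓘(ℝ, EuclideanSpace ℝ (Fin d)) (extChartAt (𝓡 d) p)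
    ((extChartAt (𝓡 d) p).symm y)) _ _

lemma chartRep_smul (p : M) (c : ℝ) (V : (x : M) → TangentSpace (𝓡 d) x)
    (y : EuclideanSpace ℝ (Fin d)) :
    chartRep p (fun x => c • V x) y = c • chartRep p V y :=
  map_smul (mfderiv (𝓡 d) 𝓘(ℝ, EuclideanSpace ℝ (Fin d)) (extChartAt (𝓡 d) p)
    ((extChartAt (𝓡 d) p).symm y)) _ _

/-- The control values `0, ε e₁, …, ε eₘ`. -/
noncomputable def cornerControl (ε : ℝ) (j : Fin (m + 1)) : EuclideanSpace ℝ (Fin m) :=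
  Fin.cases (motive := fun _ => EuclideanSpace ℝ (Fin m)) 0
    (fun i => EuclideanSpace.single i ε) j

lemma controlField_cornerControl_zero (f : Fin (m + 1) → (x : M) → TangentSpace (𝓡 d) x) (ε : ℝ) :
    controlField f (cornerControl ε 0) = f 0 := by
  funext x
  simp [controlField, cornerControl]

lemma controlField_cornerControl_succ (f : Fin (m + 1) → (x : M) → TangentSpace (𝓡 d) x) (ε : ℝ)
    (i : Fin m) : controlField f (cornerControl ε i.succ) = fun x => f 0 x + ε • f i.succ x := by
  funext x
  simp only [controlField, cornerControl, Fin.cases_succ]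
  congr 1
  rw [Finset.sum_eq_single i]
  · simp
  · intro b _ hb
    simp [hb]
  · simp

variable [IsManifold (𝓡 d) ∞ M]

/-- A vector field on `M`, as a section of the tangent bundle, is smooth. -/
def SmoothField (V : (x : M) → TangentSpace (𝓡 d) x) : Prop :=
  ContMDiff (𝓡 d) (𝓡 d).tangent ∞ (fun x => (⟨x, V x⟩ : TangentBundle (𝓡 d) M))

lemma SmoothField.add {V W : (x : M) → TangentSpace (𝓡 d) x} (hV : SmoothField V)
    (hW : SmoothField W) : SmoothField (fun x => V x + W x) :=
  ContMDiff.add_section hV hW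

lemma SmoothField.smul (c : ℝ) {V : (x : M) → TangentSpace (𝓡 d) x} (hV : SmoothField V) :
    SmoothField (fun x => c • V x) :=
  ContMDiff.const_smul_section hV

lemma SmoothField.mdiffAt {V : (x : M) → TangentSpace (𝓡 d) x} (hV : SmoothField V) (x : M) :
    MDifferentiableAt (𝓡 d) (𝓡 d).tangent (fun x => (⟨x, V x⟩ : TangentBundle (𝓡 d) M)) x :=
  ContMDiff.mdifferentiable hV (by simp) x

lemma SmoothField.mlieBracket {V W : (x : M) → TangentSpace (𝓡 d) x} (hV : SmoothField V)
    (hW : SmoothField W) : SmoothField (VectorField.mlieBracket (𝓡 d) V W) := by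
  have hi' : IsManifold (𝓡 d) (minSmoothness ℝ 3) M := by
    rw [minSmoothness_of_isRCLikeNormedField]
    exact IsManifold.of_le (n := ∞) ENat.LEInfty.out
  have hi2 : IsManifold (𝓡 d) (((⊤ : ℕ∞) : WithTop ℕ∞) + 1) M := by
    assumption
  exact ContDiff.mlieBracket_vectorField (m := ⊤) (n := ⊤) hV hW (by simp)

/-- Krener's argument: if along all chains of flows from `q` of duration less than `β` the vector
fields of the system stay in the image of a subspace `S` under the linearized chain, then so do all
elements of the Lie algebra they generate; the values of the latter at `q` therefore lie in `S`. -/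
theorem chartRep_mem_of_lieGenerated {f : Fin (m + 1) → (x : M) → TangentSpace (𝓡 d) x}
    (hf : ∀ i, SmoothField (f i)) {ε : ℝ} (hε : ε ≠ 0) {p : M} {T : ℝ}
    {v : Fin (m + 1) → EuclideanSpace ℝ (Fin d) → EuclideanSpace ℝ (Fin d)}
    {F : Fin (m + 1) → ℝ → EuclideanSpace ℝ (Fin d) → EuclideanSpace ℝ (Fin d)}
    (hF : ∀ j, IsSmoothFlow (v j) T (F j)) (hv : ∀ j, Differentiable ℝ (v j))
    {B : Set (EuclideanSpace ℝ (Fin d))} (hB : IsOpen B) (hBt : B ⊆ (extChartAt (𝓡 d) p).target)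
    (hvB : ∀ j, EqOn (v j) (chartRep p (controlField f (cornerControl ε j))) B)
    {q : EuclideanSpace ℝ (Fin d)} {β : ℝ} (hβ : 0 < β)
    {S : Submodule ℝ (EuclideanSpace ℝ (Fin d))}
    (hcB : ∀ τ q' A, FlowChain F q τ q' A → τ < β → q' ∈ B)
    (hS : ∀ τ q' A, FlowChain F q τ q' A → τ < β → ∀ j,
      v j q' ∈ S.map (A : EuclideanSpace ℝ (Fin d) →ₗ[ℝ] EuclideanSpace ℝ (Fin d)))
    {V : (x : M) → TangentSpace (𝓡 d) x} (hV : LieGenerated f V) : chartRep p V q ∈ S := by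
  have hi : IsManifold (𝓡 d) (minSmoothness ℝ 2) M := by
    rw [minSmoothness_of_isRCLikeNormedField]
    exact IsManifold.of_le (n := ∞) ENat.LEInfty.out
  have hi' : IsManifold (𝓡 d) (minSmoothness ℝ 3) M := by
    rw [minSmoothness_of_isRCLikeNormedField]
    exact IsManifold.of_le (n := ∞) ENat.LEInfty.out
  let P : ((x : M) → TangentSpace (𝓡 d) x) → Prop := fun V =>
    ∀ τ q' A, FlowChain F q τ q' A → τ < β →
      chartRep p V q' ∈ S.map (A : EuclideanSpace ℝ (Fin d) →ₗ[ℝ] EuclideanSpace ℝ (Fin d))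
  have hPadd : ∀ V W, P V → P W → P (fun x => V x + W x) := fun V W hV hW τ q' A hc hτ => by
    rw [chartRep_add]
    exact Submodule.add_mem _ (hV τ q' A hc hτ) (hW τ q' A hc hτ)
  have hPsmul : ∀ (c : ℝ) V, P V → P (fun x => c • V x) := fun c V hV τ q' A hc hτ => by
    rw [chartRep_smul]
    exact Submodule.smul_mem _ _ (hV τ q' A hc hτ)
  -- each `f i` is a combination of the fields with control values `cornerControl`
  have hspan : ∀ i : Fin m, f i.succ = fun x =>
      ε⁻¹ • (controlField f (cornerControl ε i.succ) x + (-1 : ℝ) • f 0 x) := by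
    intro i
    funext x
    rw [controlField_cornerControl_succ]
    rw [neg_one_smul, add_neg_cancel_comm, smul_smul, inv_mul_cancel₀ hε, one_smul]
  have hPcorner : ∀ j, P (controlField f (cornerControl ε j)) := fun j τ q' A hc hτ => by
    rw [← hvB j (hcB τ q' A hc hτ)]
    exact hS τ q' A hc hτ j
  have hP0 : P (f 0) := by
    have := hPcorner 0
    rwa [controlField_cornerControl_zero] at this
  have hPf : ∀ i, P (f i) := by
    intro i
    refine Fin.cases hP0 (fun i => ?_) i
    rw [hspan i]
    exact hPsmul _ _ (hPadd _ _ (hPcorner _) (hPsmul _ _ hP0))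
  have hscorner : ∀ j, SmoothField (controlField f (cornerControl ε j)) := by
    intro j
    refine Fin.cases ?_ (fun i => ?_) j
    · rw [controlField_cornerControl_zero]; exact hf 0
    · rw [controlField_cornerControl_succ]; exact (hf 0).add ((hf _).smul ε)
  have hbcorner : ∀ j W, SmoothField W → P W →
      P (VectorField.mlieBracket (𝓡 d) (controlField f (cornerControl ε j)) W) := by
    intro j W hW hPW τ q' A hc hτ
    have hq' := hcB τ q' A hc hτ
    rw [chartRep_mlieBracket (hscorner j) hW (hBt hq')]
    have hev : chartRep p (controlField f (cornerControl ε j)) =ᶠ[𝓝 q'] v j := by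
      filter_upwards [hB.mem_nhds hq'] with y hy using (hvB j hy).symm
    rw [hev.lieBracket_vectorField_eq EventuallyEq.rfl]
    refine FlowChain.lieBracket_mem hF hv (fun τ q' A hc hτ => ?_) hPW j hc hτ
    have := (contDiffOn_chartRep_of_contMDiff hW p).contDiffAt
      ((isOpen_extChartAt_target p).mem_nhds (hBt (hcB τ q' A hc hτ)))
    exact this.differentiableAt (by simp)
  have hb0 : ∀ W, SmoothField W → P W → P (VectorField.mlieBracket (𝓡 d) (f 0) W) := by
    intro W hW hPW
    have := hbcorner 0 W hW hPW
    rwa [controlField_cornerControl_zero] at this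
  have hbadd : ∀ V V' W : (x : M) → TangentSpace (𝓡 d) x,
      SmoothField V → SmoothField V' → SmoothField W →
      VectorField.mlieBracket (𝓡 d) (fun x => V x + V' x) W = fun x =>
        VectorField.mlieBracket (𝓡 d) V W x + VectorField.mlieBracket (𝓡 d) V' W x :=
    fun V V' W hV hV' _ => funext fun x =>
      VectorField.mlieBracket_add_left (W := W) (hV.mdiffAt x) (hV'.mdiffAt x)
  have hbsmul : ∀ (c : ℝ) (V W : (x : M) → TangentSpace (𝓡 d) x), SmoothField V → SmoothField W →
      VectorField.mlieBracket (𝓡 d) (fun x => c • V x) W = fun x =>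
        c • VectorField.mlieBracket (𝓡 d) V W x :=
    fun c V W hV _ => funext fun x =>
      VectorField.mlieBracket_const_smul_left (W := W) (hV.mdiffAt x)
  -- bracketing with `V` preserves the property `P`, which is what the Jacobi identity propagates
  have key : SmoothField V ∧ P V ∧ ∀ W, SmoothField W → P W →
      P (VectorField.mlieBracket (𝓡 d) V W) := by
    induction hV with
    | of i =>
      refine ⟨hf i, hPf i, ?_⟩
      intro W hW hPW
      refine Fin.cases (hb0 W hW hPW) (fun i => ?_) i
      rw [hspan i, hbsmul _ _ _ ((hscorner _).add ((hf 0).smul _)) hW,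
        hbadd _ _ _ (hscorner _) ((hf 0).smul _) hW, hbsmul _ _ _ (hf 0) hW]
      exact hPsmul _ _ (hPadd _ _ (hbcorner _ W hW hPW) (hPsmul _ _ (hb0 W hW hPW)))
    | add _ _ h1 h2 =>
      refine ⟨h1.1.add h2.1, hPadd _ _ h1.2.1 h2.2.1, fun W hW hPW => ?_⟩
      rw [hbadd _ _ _ h1.1 h2.1 hW]
      exact hPadd _ _ (h1.2.2 W hW hPW) (h2.2.2 W hW hPW)
    | smul c _ h =>
      refine ⟨h.1.smul c, hPsmul _ _ h.2.1, fun W hW hPW => ?_⟩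
      rw [hbsmul _ _ _ h.1 hW]
      exact hPsmul _ _ (h.2.2 W hW hPW)
    | @bracket V₁ V₂ _ _ h1 h2 =>
      refine ⟨h1.1.mlieBracket h2.1, h1.2.2 _ h2.1 h2.2.1, fun W hW hPW => ?_⟩
      -- the Jacobi identity
      have hj : VectorField.mlieBracket (𝓡 d) (VectorField.mlieBracket (𝓡 d) V₁ V₂) W = fun x =>
          VectorField.mlieBracket (𝓡 d) V₁ (VectorField.mlieBracket (𝓡 d) V₂ W) x +
          (-1 : ℝ) • VectorField.mlieBracket (𝓡 d) V₂ (VectorField.mlieBracket (𝓡 d) V₁ W) x := by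
        funext x
        have hle : minSmoothness ℝ 2 ≤ (∞ : WithTop ℕ∞) := by
          rw [minSmoothness_of_isRCLikeNormedField]; exact ENat.LEInfty.out
        rw [VectorField.leibniz_identity_mlieBracket_apply (U := V₁) (V := V₂) (W := W)
          ((h1.1 x).of_le hle) ((h2.1 x).of_le hle) ((hW x).of_le hle)]
        rw [neg_one_smul, add_neg_cancel_right]
      rw [hj]
      exact hPadd _ _ (h1.2.2 _ (h2.1.mlieBracket hW) (h2.2.2 W hW hPW))
        (hPsmul _ _ (h2.2.2 _ (h1.1.mlieBracket hW) (h1.2.2 W hW hPW)))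
  have := key.2.1 0 q _ FlowChain.refl hβ
  rwa [ContinuousLinearMap.coe_id, Submodule.map_id] at this

end LieRank
end ControlAffine

namespace ControlAffine
/-! ### Cut-off vector fields and flows with parameters -/

section CutOff

/-- Surjectivity of a linear map onto a finite-dimensional space is an open condition. -/
lemma eventually_range_eq_top {P E : Type*} [NormedAddCommGroup P] [NormedSpace ℝ P]
    [NormedAddCommGroup E] [NormedSpace ℝ E] [FiniteDimensional ℝ E] [FiniteDimensional ℝ P]
    {L : P →L[ℝ] E} (hL : LinearMap.range (L : P →ₗ[ℝ] E) = ⊤) :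
    ∀ᶠ L' in 𝓝 L, LinearMap.range ((L' : P →L[ℝ] E) : P →ₗ[ℝ] E) = ⊤ := by
  obtain ⟨R, hR⟩ := (L : P →ₗ[ℝ] E).exists_rightInverse_of_surjective hL
  let R' : E →L[ℝ] P := LinearMap.toContinuousLinearMap R
  have hLR : L ∘L R' = ((1 : (E →L[ℝ] E)ˣ) : E →L[ℝ] E) := by
    ext x
    exact DFunLike.congr_fun hR x
  have hc : Continuous fun L' : P →L[ℝ] E => L' ∘L R' := by fun_prop
  have hu := Units.nhds (1 : (E →L[ℝ] E)ˣ)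
  rw [← hLR] at hu
  filter_upwards [hc.continuousAt.eventually hu] with L' hL'
  obtain ⟨uu, huu⟩ := hL'
  rw [LinearMap.range_eq_top]
  intro y
  refine ⟨R' ((↑uu⁻¹ : E →L[ℝ] E) y), ?_⟩
  have : (L' ∘L R') ((↑uu⁻¹ : E →L[ℝ] E) y) = y := by
    rw [← huu, ← mul_apply_eq_comp, Units.mul_inv]; rfl
  exact this

/-- Finitely many smooth functions on an open set agree near a given point with smooth, bounded and
Lipschitz functions on the whole space. -/
lemma exists_cutOff {ι Z W : Type*} [Finite ι] [NormedAddCommGroup Z] [NormedSpace ℝ Z]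
    [FiniteDimensional ℝ Z] [NormedAddCommGroup W] [NormedSpace ℝ W] {Ω : Set Z} (hΩ : IsOpen Ω)
    {ζ₀ : Z} (hζ₀ : ζ₀ ∈ Ω) {X : ι → Z → W} (hX : ∀ j, ContDiffOn ℝ ∞ (X j) Ω) :
    ∃ (ρ L : ℝ) (K : NNReal) (v : ι → Z → W), 0 < ρ ∧ 0 ≤ L ∧ Metric.ball ζ₀ ρ ⊆ Ω ∧
      (∀ j, ContDiff ℝ ∞ (v j)) ∧ (∀ j, LipschitzWith K (v j)) ∧ (∀ j z, ‖v j z‖ ≤ L) ∧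
      ∀ j, EqOn (v j) (X j) (Metric.ball ζ₀ ρ) := by
  have := Fintype.ofFinite ι
  obtain ⟨r, hr, hrΩ⟩ := Metric.isOpen_iff.1 hΩ ζ₀ hζ₀
  let χ : ContDiffBump ζ₀ := ⟨r / 4, r / 2, by positivity, by linarith⟩
  have hts : tsupport χ ⊆ Ω := by
    rw [χ.tsupport_eq]
    exact (Metric.closedBall_subset_ball (by change r / 2 < r; linarith)).trans hrΩ
  let v : ι → Z → W := fun j z => χ z • X j z
  have hv : ∀ j, ContDiff ℝ ∞ (v j) := by
    intro j
    rw [contDiff_iff_contDiffAt]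
    intro z
    by_cases hz : z ∈ Ω
    · exact χ.contDiffAt.smul ((hX j).contDiffAt (hΩ.mem_nhds hz))
    · have h0 : v j =ᶠ[𝓝 z] fun _ => 0 := by
        have : (tsupport χ)ᶜ ∈ 𝓝 z :=
          (isClosed_tsupport χ).isOpen_compl.mem_nhds fun h => hz (hts h)
        filter_upwards [this] with y hy
        simp [v, image_eq_zero_of_notMem_tsupport hy]
      exact contDiffAt_const.congr_of_eventuallyEq h0
  have hcs : ∀ j, HasCompactSupport (v j) := fun j => χ.hasCompactSupport.smul_right
  have h1 : ∀ j, ∃ C, LipschitzWith C (v j) := fun j =>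
    (hv j).lipschitzWith_of_hasCompactSupport (hcs j) (by simp)
  have h2 : ∀ j, ∃ C, ∀ z, ‖v j z‖ ≤ C := fun j =>
    (hcs j).exists_bound_of_continuous (hv j).continuous
  choose K hK using h1
  choose L hL using h2
  refine ⟨r / 4, ∑ j, |L j|, ∑ j, K j, v, by positivity,
    Finset.sum_nonneg fun j _ => abs_nonneg _, ?_, hv, ?_, ?_, ?_⟩
  · exact (Metric.ball_subset_ball (by linarith)).trans hrΩ
  · exact fun j => (hK j).weaken (Finset.single_le_sum (fun _ _ => zero_le) (Finset.mem_univ j))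
  · exact fun j z => (hL j z).trans ((le_abs_self _).trans
      (Finset.single_le_sum (f := fun j => |L j|) (fun _ _ => abs_nonneg _) (Finset.mem_univ j)))
  · intro j z hz
    have : χ z = 1 := χ.one_of_mem_closedBall (Metric.ball_subset_closedBall hz)
    simp [v, this]

variable {ι P E : Type*} [NormedAddCommGroup P] [NormedSpace ℝ P] [NormedAddCommGroup E]
  [NormedSpace ℝ E]

lemma IsSmoothFlow.fst_eq {v : P × E → E} {T : ℝ} {F : ℝ → P × E → P × E}
    (hF : IsSmoothFlow (fun ζ => (0, v ζ)) T F) {t : ℝ} (ht : t ∈ Ioo (-T) T) (ζ : P × E) :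
    (F t ζ).1 = ζ.1 := by
  have := (convex_Ioo (-T) T).norm_image_sub_le_of_norm_hasDerivWithin_le (C := 0)
    (f := fun s => (F s ζ).1) (f' := fun _ => 0)
    (fun s hs => ((ContinuousLinearMap.fst ℝ P E).hasFDerivAt.comp_hasDerivAt s
      (hF.hasDerivAt s hs ζ)).hasDerivWithinAt)
    (fun s _ => by simp) hF.zero_mem ht
  simpa [hF.zero, sub_eq_zero] using this

/-- A flow with a parameter, at a fixed value of the parameter. -/
lemma IsSmoothFlow.restrict {v : P × E → E} {T : ℝ} {F : ℝ → P × E → P × E}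
    (hF : IsSmoothFlow (fun ζ => (0, v ζ)) T F) (α : P) :
    IsSmoothFlow (fun y => v (α, y)) T (fun t y => (F t (α, y)).2) := by
  have hpair : ∀ t ∈ Ioo (-T) T, ∀ y, (α, (F t (α, y)).2) = F t (α, y) := fun t ht y =>
    Prod.ext (hF.fst_eq ht (α, y)).symm rfl
  refine ⟨hF.pos, ?_, fun y => by simp [hF.zero], fun t ht y => ?_, fun t ht y => ?_⟩
  · have h1 : ContDiff ℝ 2 (fun p : ℝ × E => (p.1, ((α, p.2) : P × E))) := by fun_prop
    exact contDiff_snd.comp_contDiffOn (hF.contDiffOn.comp h1.contDiffOn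
      (fun p hp => ⟨hp.1, mem_univ _⟩))
  · have := (ContinuousLinearMap.snd ℝ P E).hasFDerivAt.comp_hasDerivAt t
      (hF.hasDerivAt t ht (α, y))
    rw [← hpair t ht y] at this
    exact this
  · rw [hpair t ht y, hF.neg_apply t ht]

lemma flowWord_fst {v : ι → P × E → E} {T : ℝ} {F : ι → ℝ → P × E → P × E}
    (hF : ∀ j, IsSmoothFlow (fun ζ => (0, v j ζ)) T (F j)) (n : ℕ) (J : Fin n → ι)
    {s : Fin n → ℝ} (hs : ∀ i, s i ∈ Ioo (-T) T) (ζ : P × E) : (flowWord F n J s ζ).1 = ζ.1 := by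
  induction n with
  | zero => rfl
  | succ n ih => exact ((hF _).fst_eq (hs _) _).trans (ih _ fun i => hs _)

lemma flowWord_restrict {v : ι → P × E → E} {T : ℝ} {F : ι → ℝ → P × E → P × E}
    (hF : ∀ j, IsSmoothFlow (fun ζ => (0, v j ζ)) T (F j)) (α : P) (n : ℕ) (J : Fin n → ι)
    {s : Fin n → ℝ} (hs : ∀ i, s i ∈ Ioo (-T) T) (y : E) :
    flowWord (fun j t y => (F j t (α, y)).2) n J s y = (flowWord F n J s (α, y)).2 := by
  induction n with
  | zero => rfl
  | succ n ih =>
    simp only [flowWord]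
    rw [ih _ fun i => hs _]
    congr 2
    exact Prod.ext (flowWord_fst hF n _ (fun i => hs _) (α, y)).symm rfl

lemma norm_flowWord_sub_le {v : ι → E → E} {T : ℝ} {F : ι → ℝ → E → E}
    (hF : ∀ j, IsSmoothFlow (v j) T (F j)) {L : ℝ} (hL : ∀ j z, ‖v j z‖ ≤ L) (n : ℕ)
    (J : Fin n → ι) {s : Fin n → ℝ} (hs : ∀ i, s i ∈ Ioo (-T) T) (z : E) :
    ‖flowWord F n J s z - z‖ ≤ L * ∑ i, |s i| := by
  induction n with
  | zero => simp [flowWord]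
  | succ n ih =>
    have h1 := (hF (J (Fin.last n))).norm_sub_le (hL _) (hs (Fin.last n))
      (flowWord F n (fun i => J i.castSucc) (fun i => s i.castSucc) z)
    have h2 := ih (fun i => J i.castSucc) (s := fun i => s i.castSucc) fun i => hs _
    rw [Fin.sum_univ_castSucc, mul_add]
    exact ((norm_sub_le_norm_sub_add_norm_sub _ _ _).trans (add_le_add h1 h2)).trans
      (add_comm _ _).le

/-- If varying the switching times spans all directions, then concatenations of flows hit all points
near the endpoint, locally uniformly in the parameter and the initial point. -/
lemma map_nhds_flowWord [FiniteDimensional ℝ E] [FiniteDimensional ℝ P] {v : ι → P × E → E} {T : ℝ}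
    {F : ι → ℝ → P × E → P × E}
    (hF : ∀ j, IsSmoothFlow (fun ζ => (0, v j ζ)) T (F j)) {α : P} {n : ℕ} {J : Fin n → ι}
    {s : Fin n → ℝ} (hs : ∀ i, s i ∈ Ioo (-T) T) {y : E}
    (htop : wordTangent (fun j t y => (F j t (α, y)).2) n J s y = ⊤) :
    map (fun p : (Fin n → ℝ) × (P × E) => (p.2, (flowWord F n J p.1 p.2).2)) (𝓝 (s, (α, y))) =
      𝓝 ((α, y), (flowWord F n J s (α, y)).2) := by
  have : CompleteSpace E := FiniteDimensional.complete ℝ E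
  have : CompleteSpace P := FiniteDimensional.complete ℝ P
  have hG := contDiffAt_flowWord hF n J hs (α, y)
  have hG2 : ContDiffAt ℝ 2 (fun p : (Fin n → ℝ) × (P × E) =>
      (p.2, (flowWord F n J p.1 p.2).2)) (s, (α, y)) := contDiffAt_snd.prodMk hG.snd
  have hst := hG2.hasStrictFDerivAt (by norm_num)
  refine hst.map_nhds_eq_of_surj ?_
  rw [LinearMap.range_eq_top]
  rintro ⟨b, c⟩
  have hD : HasFDerivAt (fun p : (Fin n → ℝ) × (P × E) => (p.2, (flowWord F n J p.1 p.2).2))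
      ((ContinuousLinearMap.snd ℝ _ _).prod
        (fderiv ℝ (fun p : (Fin n → ℝ) × (P × E) => (flowWord F n J p.1 p.2).2) (s, (α, y))))
      (s, (α, y)) :=
    hasFDerivAt_snd.prodMk (hG.snd.differentiableAt (by norm_num)).hasFDerivAt
  rw [hst.hasFDerivAt.unique hD]
  set D := fderiv ℝ (fun p : (Fin n → ℝ) × (P × E) => (flowWord F n J p.1 p.2).2) (s, (α, y))
  have hpart : HasFDerivAt (fun s => flowWord (fun j t y => (F j t (α, y)).2) n J s y)
      (D ∘L .inl ℝ _ _) s := by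
    have h1 := HasFDerivAt.comp (f := fun s : Fin n → ℝ => (s, (α, y))) s
      (hG.snd.differentiableAt (by norm_num)).hasFDerivAt (hasFDerivAt_prodMk_left s (α, y))
    refine h1.congr_of_eventuallyEq ?_
    filter_upwards [(isOpen_times n T).mem_nhds hs] with s' hs'
    exact flowWord_restrict hF α n J hs' y
  have hsurj : c - D (0, b) ∈ wordTangent (fun j t y => (F j t (α, y)).2) n J s y := by
    rw [htop]; trivial
  obtain ⟨h, hh⟩ := hsurj
  rw [hpart.fderiv] at hh
  refine ⟨(h, b), Prod.ext rfl ?_⟩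
  have h2 : ((h, b) : (Fin n → ℝ) × (P × E)) = (h, 0) + (0, b) := by simp
  change D (h, b) = c
  rw [h2, map_add]
  have : D (h, 0) = c - D (0, b) := hh
  rw [this, sub_add_cancel]

end CutOff

end ControlAffine

namespace ControlAffine
/-! ### Regular switching times -/

section RegularTimes

variable {d m k : ℕ} {M : Type*} [TopologicalSpace M] [ChartedSpace (EuclideanSpace ℝ (Fin d)) M]
  [IsManifold (𝓡 d) ∞ M]

lemma smoothField_of_contMDiffOn {f : EuclideanSpace ℝ (Fin k) → (x : M) → TangentSpace (𝓡 d) x}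
    {A : Set (EuclideanSpace ℝ (Fin k))}
    (hf : ContMDiffOn ((𝓡 k).prod (𝓡 d)) (𝓡 d).tangent ∞
      (fun p : EuclideanSpace ℝ (Fin k) × M => (⟨p.2, f p.1 p.2⟩ : TangentBundle (𝓡 d) M))
      (A ×ˢ univ)) {α : EuclideanSpace ℝ (Fin k)} (hα : α ∈ A) : SmoothField (f α) := by
  have h1 : ContMDiff (𝓡 d) ((𝓡 k).prod (𝓡 d)) ∞
      (fun x : M => ((α, x) : EuclideanSpace ℝ (Fin k) × M)) := contMDiff_const.prodMk contMDiff_id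
  rw [SmoothField, ← contMDiffOn_univ]
  exact hf.comp h1.contMDiffOn (fun x _ => ⟨hα, mem_univ _⟩)

/-- Under the Lie algebra rank condition near `p`, there are a concatenation of flows with control
values `cornerControl ε j` and positive switching times at which the derivative of the endpoint with
respect to the switching times is onto; hence the endpoint covers a neighborhood, locally uniformly
in the parameter and the initial point. The flows are those of cut-off vector fields `v j` in the
chart at `p`, which agree with the system on a ball that the trajectory does not leave. -/
theorem exists_regular_times
    {f : EuclideanSpace ℝ (Fin k) → Fin (m + 1) → (x : M) → TangentSpace (𝓡 d) x}
    {A : Set (EuclideanSpace ℝ (Fin k))}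
    (hf : ∀ i : Fin (m + 1), ContMDiffOn ((𝓡 k).prod (𝓡 d)) (𝓡 d).tangent ∞
      (fun p : EuclideanSpace ℝ (Fin k) × M => (⟨p.2, f p.1 i p.2⟩ : TangentBundle (𝓡 d) M))
      (A ×ˢ univ))
    {α₀ : EuclideanSpace ℝ (Fin k)} (hα₀ : α₀ ∈ interior A) {ε : ℝ} (hε : ε ≠ 0) {p : M} {O : Set M}
    (hO : IsOpen O) (hp : p ∈ O) (hlarc : ∀ x ∈ O, LieRankCondition (f α₀) x) :
    ∃ (T L ρ : ℝ)
      (v : Fin (m + 1) → EuclideanSpace ℝ (Fin k) × EuclideanSpace ℝ (Fin d) →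
        EuclideanSpace ℝ (Fin d))
      (F : Fin (m + 1) → ℝ → EuclideanSpace ℝ (Fin k) × EuclideanSpace ℝ (Fin d) →
        EuclideanSpace ℝ (Fin k) × EuclideanSpace ℝ (Fin d))
      (n : ℕ) (J : Fin n → Fin (m + 1)) (s : Fin n → ℝ),
      Metric.ball (α₀, extChartAt (𝓡 d) p p) ρ ⊆ interior A ×ˢ (extChartAt (𝓡 d) p).target ∧
      (∀ j, IsSmoothFlow (fun ζ => (0, v j ζ)) T (F j)) ∧ (∀ j ζ, ‖v j ζ‖ ≤ L) ∧
      (∀ j, ∀ ζ ∈ Metric.ball (α₀, extChartAt (𝓡 d) p p) ρ,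
        v j ζ = chartRep p (controlField (f ζ.1) (cornerControl ε j)) ζ.2) ∧
      0 < n ∧ (∀ i, 0 < s i) ∧ ∑ i, s i < T ∧ L * ∑ i, s i < ρ ∧
      (extChartAt (𝓡 d) p).symm (flowWord F n J s (α₀, extChartAt (𝓡 d) p p)).2 ∈ O ∧
      map (fun q : (Fin n → ℝ) × (EuclideanSpace ℝ (Fin k) × EuclideanSpace ℝ (Fin d)) =>
          (q.2, (flowWord F n J q.1 q.2).2)) (𝓝 (s, (α₀, extChartAt (𝓡 d) p p))) =
        𝓝 ((α₀, extChartAt (𝓡 d) p p), (flowWord F n J s (α₀, extChartAt (𝓡 d) p p)).2) := by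
  set z := extChartAt (𝓡 d) p p with hz
  have htO : IsOpen (extChartAt (𝓡 d) p).target := isOpen_extChartAt_target p
  have hX : ∀ j : Fin (m + 1), ContDiffOn ℝ ∞
      (fun ζ : EuclideanSpace ℝ (Fin k) × EuclideanSpace ℝ (Fin d) =>
        chartRep p (controlField (f ζ.1) (cornerControl ε j)) ζ.2)
      (interior A ×ˢ (extChartAt (𝓡 d) p).target) := by
    have h0 : ∀ i, ContDiffOn ℝ ∞ (fun ζ : EuclideanSpace ℝ (Fin k) × EuclideanSpace ℝ (Fin d) =>
        chartRep p (f ζ.1 i) ζ.2) (interior A ×ˢ (extChartAt (𝓡 d) p).target) := fun i =>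
      (contDiffOn_chartRep (f := fun α => f α i) (hf i) p).mono (prod_mono interior_subset le_rfl)
    intro j
    refine Fin.cases ?_ (fun i => ?_) j
    · simp only [controlField_cornerControl_zero]; exact h0 0
    · simp only [controlField_cornerControl_succ, chartRep_add, chartRep_smul]
      exact (h0 0).add ((h0 i.succ).const_smul ε)
  obtain ⟨ρ, L, K, v, hρ, hL0, hρΩ, hv, hvK, hvL, hvX⟩ :=
    exists_cutOff (isOpen_interior.prod htO) (ζ₀ := (α₀, z))
      (mk_mem_prod hα₀ (mem_extChartAt_target p)) hX
  let w : Fin (m + 1) → EuclideanSpace ℝ (Fin k) × EuclideanSpace ℝ (Fin d) →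
    EuclideanSpace ℝ (Fin k) × EuclideanSpace ℝ (Fin d) := fun j ζ => (0, v j ζ)
  have hw : ∀ j, ContDiff ℝ ∞ (w j) := fun j => contDiff_const.prodMk (hv j)
  have hwK : ∀ j, LipschitzWith K (w j) := fun j => by
    refine LipschitzWith.of_dist_le_mul fun a b => ?_
    rw [Prod.dist_eq]
    simpa [w] using (hvK j).dist_le_mul a b
  have hT0 : (0 : ℝ) < 1 / (K + 1) := by positivity
  have hTK : (1 / (K + 1) : ℝ) * K < 1 := by
    rw [div_mul_eq_mul_div, one_mul, div_lt_one (by positivity)]; linarith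
  set T : ℝ := 1 / (K + 1) with hT
  have hflow : ∀ j, ∃ F, IsSmoothFlow (w j) T F := fun j => by
    obtain ⟨F, h1, h2, h3, h4⟩ := exists_smooth_flow 2 (by norm_num)
      ((hw j).of_le ENat.LEInfty.out) (hwK j) hT0 hTK
    exact ⟨F, hT0, h1, h2, h3, h4⟩
  choose F hF using hflow
  -- a smaller ball that stays in `O`
  obtain ⟨r, hr0, hrρ, hrO⟩ : ∃ r > 0, r ≤ ρ ∧ ∀ y ∈ Metric.ball z r,
      y ∈ (extChartAt (𝓡 d) p).target ∧ (extChartAt (𝓡 d) p).symm y ∈ O := by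
    have h1 : ∀ᶠ y in 𝓝 z, y ∈ (extChartAt (𝓡 d) p).target ∧ (extChartAt (𝓡 d) p).symm y ∈ O := by
      refine (htO.eventually_mem (mem_extChartAt_target p)).and ?_
      refine (continuousAt_extChartAt_symm p).eventually ?_
      rw [extChartAt_to_inv]
      exact hO.eventually_mem hp
    obtain ⟨r, hr, h⟩ := Metric.eventually_nhds_iff_ball.1 h1
    exact ⟨min r ρ, lt_min hr hρ, min_le_right _ _, fun y hy =>
      h y (Metric.ball_subset_ball (min_le_left _ _) hy)⟩
  set σ : ℝ := min T (r / (L + 1)) with hσ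
  have hσ0 : 0 < σ := lt_min hT0 (by positivity)
  have hσT : σ ≤ T := min_le_left _ _
  have hLσ : L * σ < r := by
    have h1 : σ ≤ r / (L + 1) := min_le_right _ _
    rw [le_div_iff₀ (by positivity)] at h1
    nlinarith
  let F' : Fin (m + 1) → ℝ → EuclideanSpace ℝ (Fin d) → EuclideanSpace ℝ (Fin d) :=
    fun j t y => (F j t (α₀, y)).2
  have hF' : ∀ j, IsSmoothFlow (fun y => v j (α₀, y)) T (F' j) := fun j => (hF j).restrict α₀
  have hv'L : ∀ j y, ‖v j (α₀, y)‖ ≤ L := fun j y => hvL j _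
  obtain ⟨n, J, s, hn, hs0, hsσ, β, hβ, hsβ, hchain⟩ := exists_word_forall_chain_mem hF' z hσ0 hσT
  have hle : ∀ i, s i ≤ ∑ i, s i := fun i =>
    Finset.single_le_sum (fun i _ => hs0 i) (Finset.mem_univ i)
  have hsT : ∀ i, s i ∈ Ioo (-T) T := fun i =>
    ⟨by linarith [hs0 i], by linarith [hle i]⟩
  set q := flowWord F' n J s z with hq
  have hqz : ‖q - z‖ ≤ L * ∑ i, s i := by
    have := norm_flowWord_sub_le hF' hv'L n J hsT z
    simpa only [abs_of_nonneg (hs0 _)] using this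
  have hcB : ∀ τ q' A, FlowChain F' q τ q' A → τ < β → q' ∈ Metric.ball z r := by
    intro τ q' A' hc hτ
    have hsum : 0 ≤ ∑ i, s i := Finset.sum_nonneg fun i _ => hs0 i
    have h1 := hc.norm_sub_le hF' hv'L (by linarith)
    have h2 := norm_sub_le_norm_sub_add_norm_sub q' q z
    have h3 : L * (∑ i, s i + τ) ≤ L * σ := mul_le_mul_of_nonneg_left (by linarith) hL0
    rw [mem_ball_iff_norm]
    linarith
  have hα₀A : α₀ ∈ A := interior_subset hα₀
  have hqB : q ∈ Metric.ball z r := hcB 0 q _ FlowChain.refl hβ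
  have htop : wordTangent F' n J s z = ⊤ := by
    rw [Submodule.eq_top_iff']
    intro c
    have hxs : (extChartAt (𝓡 d) p).symm q ∈ (extChartAt (𝓡 d) p).source :=
      (extChartAt (𝓡 d) p).map_target (hrO q hqB).1
    obtain ⟨b, hb⟩ := (isInvertible_mfderiv_extChartAt (I := 𝓡 d) hxs).bijective.surjective c
    have hmem : b ∈ {u : TangentSpace (𝓡 d) ((extChartAt (𝓡 d) p).symm q) |
        ∃ V : (y : M) → TangentSpace (𝓡 d) y,
          LieGenerated (f α₀) V ∧ V ((extChartAt (𝓡 d) p).symm q) = u} := by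
      rw [hlarc _ (hrO q hqB).2]; trivial
    obtain ⟨V, hV, hVb⟩ := hmem
    have h1 := chartRep_mem_of_lieGenerated (p := p) (f := f α₀)
      (fun i => smoothField_of_contMDiffOn (f := fun α => f α i) (hf i) hα₀A) hε hF'
      (fun j => ((hv j).differentiable (by simp)).comp
        ((differentiable_const α₀).prodMk differentiable_id)) Metric.isOpen_ball
      (fun y hy => (hrO y hy).1) (fun j y hy => hvX j (x := (α₀, y)) (by
        rw [Metric.mem_ball, Prod.dist_eq]
        simpa [hρ] using lt_of_lt_of_le hy hrρ)) hβ hcB hchain hV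
    rw [chartRep, hVb, hb] at h1
    exact h1
  -- perturb the switching times to make them positive
  have hpert : Tendsto (fun δ : ℝ => fun i => s i + δ) (𝓝[>] 0) (𝓝 s) := by
    have : Continuous fun δ : ℝ => fun i => s i + δ := by fun_prop
    have h := (this.tendsto 0).mono_left (nhdsWithin_le_nhds (s := Ioi 0))
    simpa using h
  have hC2 : ContDiffAt ℝ 2 (fun s : Fin n → ℝ => flowWord F' n J s z) s :=
    contDiffAt_flowWord_left hF' n J hsT z
  have hevtop : ∀ᶠ s' in 𝓝 s, wordTangent F' n J s' z = ⊤ := by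
    have hc := hC2.continuousAt_fderiv (by norm_num)
    exact hc.eventually (eventually_range_eq_top htop)
  have hsumc : Continuous fun s' : Fin n → ℝ => ∑ i, s' i := by fun_prop
  have hevσ : ∀ᶠ s' in 𝓝 s, ∑ i, s' i < σ := hsumc.continuousAt.eventually_lt_const hsσ
  have hevO : ∀ᶠ s' in 𝓝 s, flowWord F' n J s' z ∈ Metric.ball z r :=
    hC2.continuousAt.eventually (Metric.isOpen_ball.eventually_mem hqB)
  obtain ⟨δ, ⟨h1, h2, h3⟩, hδ⟩ := ((hpert.eventually (hevtop.and (hevσ.and hevO))).and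
    self_mem_nhdsWithin).exists
  have hpos : ∀ i, 0 < s i + δ := fun i => add_pos_of_nonneg_of_pos (hs0 i) hδ
  have hsT' : ∀ i, s i + δ ∈ Ioo (-T) T := fun i => by
    have := Finset.single_le_sum (fun i _ => (hpos i).le) (Finset.mem_univ i)
    exact ⟨by linarith [hpos i], by linarith⟩
  refine ⟨T, L, ρ, v, F, n, J, fun i => s i + δ, hρΩ, hF, hvL, fun j ζ hζ => hvX j hζ, hn, hpos,
    by linarith, ?_, ?_, map_nhds_flowWord hF hsT' h1⟩
  · have := mul_le_mul_of_nonneg_left h2.le hL0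
    linarith
  · rw [← flowWord_restrict hF α₀ n J hsT']
    exact (hrO _ h3).2

end RegularTimes

end ControlAffine

namespace ControlAffine
/-! ### Control functions and the weak-* topology -/

namespace Control

variable {m : ℕ} {U : Set (EuclideanSpace ℝ (Fin m))}

lemma ext_ae {u v : Control U} (h : u.val =ᵐ[volume] v.val) : u = v := Subtype.ext (Lp.ext h)

lemma measurable_val (u : Control U) : Measurable u.val := (Lp.stronglyMeasurable u.1).measurable

lemma ae_val_mem (u : Control U) : ∀ᵐ t, u.val t ∈ U := u.2

lemma memLp_of_mem (hU : IsCompact U) {g : ℝ → EuclideanSpace ℝ (Fin m)} (hg : Measurable g)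
    (h : ∀ t, g t ∈ U) : MemLp g ∞ volume := by
  obtain ⟨C, hC⟩ := hU.isBounded.exists_norm_le
  exact memLp_top_of_bound hg.aestronglyMeasurable C (Eventually.of_forall fun t => hC _ (h t))

/-- The control given by a measurable function with values in a compact set. -/
noncomputable def ofFun (hU : IsCompact U) (g : ℝ → EuclideanSpace ℝ (Fin m)) (hg : Measurable g)
    (h : ∀ t, g t ∈ U) : Control U :=
  ⟨(memLp_of_mem hU hg h).toLp g, by
    filter_upwards [(memLp_of_mem hU hg h).coeFn_toLp] with t ht; rw [ht]; exact h t⟩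

lemma ofFun_val (hU : IsCompact U) (g : ℝ → EuclideanSpace ℝ (Fin m)) (hg : Measurable g)
    (h : ∀ t, g t ∈ U) : (ofFun hU g hg h).val =ᵐ[volume] g :=
  (memLp_of_mem hU hg h).coeFn_toLp

lemma shift_val (t : ℝ) (u : Control U) :
    (u.shift t).val =ᵐ[volume] fun s => u.val (t + s) :=
  Lp.coeFn_compMeasurePreserving u.1 (measurePreserving_add_left (volume : Measure ℝ) t)

lemma ae_add_left {p : ℝ → Prop} (h : ∀ᵐ s, p s) (t : ℝ) : ∀ᵐ s : ℝ, p (t + s) :=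
  (measurePreserving_add_left (volume : Measure ℝ) t).quasiMeasurePreserving.ae h

lemma shift_shift (s t : ℝ) (u : Control U) : (u.shift t).shift s = u.shift (t + s) := by
  apply ext_ae
  filter_upwards [shift_val s (u.shift t), ae_add_left (shift_val t u) s, shift_val (t + s) u]
    with r h1 h2 h3
  rw [h1, h2, h3, add_assoc]

lemma shift_zero (u : Control U) : u.shift 0 = u := by
  apply ext_ae
  filter_upwards [shift_val 0 u] with r h1
  rw [h1, zero_add]

open Classical in
/-- A representative of a control with all its values in `U`, if `0 ∈ U`. -/
noncomputable def rep (u : Control U) (t : ℝ) : EuclideanSpace ℝ (Fin m) :=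
  if u.val t ∈ U then u.val t else 0

lemma rep_mem (hU0 : (0 : EuclideanSpace ℝ (Fin m)) ∈ U) (u : Control U) (t : ℝ) : u.rep t ∈ U := by
  unfold rep
  split_ifs with h
  exacts [h, hU0]

lemma rep_ae (u : Control U) : u.rep =ᵐ[volume] u.val := by
  filter_upwards [u.ae_val_mem] with t ht
  simp [rep, ht]

lemma measurable_rep (hU : IsCompact U) (u : Control U) : Measurable u.rep :=
  Measurable.ite (u.measurable_val hU.isClosed.measurableSet) u.measurable_val measurable_const

/-- The constant control. -/
noncomputable def const (hU : IsCompact U) (w : EuclideanSpace ℝ (Fin m)) (hw : w ∈ U) :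
    Control U :=
  ofFun hU (fun _ => w) measurable_const fun _ => hw

/-- The control that equals `u` before time `T` and `v`, started at time `T`, afterwards. -/
noncomputable def cat (hU : IsCompact U) (hU0 : (0 : EuclideanSpace ℝ (Fin m)) ∈ U) (T : ℝ)
    (u v : Control U) : Control U :=
  ofFun hU (fun t => if t < T then u.rep t else v.rep (t - T))
    (Measurable.ite measurableSet_Iio (u.measurable_rep hU)
      ((v.measurable_rep hU).comp (measurable_id.sub_const T)))
    fun t => by split_ifs; exacts [u.rep_mem hU0 t, v.rep_mem hU0 _]

/-- The periodic continuation of the restriction of `u` to `[0, S)`. -/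
noncomputable def periodize (hU : IsCompact U) (hU0 : (0 : EuclideanSpace ℝ (Fin m)) ∈ U) (S : ℝ)
    (u : Control U) : Control U :=
  ofFun hU (fun t => u.rep (S * Int.fract (t / S)))
    ((u.measurable_rep hU).comp ((measurable_fract.comp (measurable_id.div_const S)).const_mul S))
    fun _ => u.rep_mem hU0 _

lemma cat_val (hU : IsCompact U) (hU0 : (0 : EuclideanSpace ℝ (Fin m)) ∈ U) (T : ℝ)
    (u v : Control U) : (cat hU hU0 T u v).val =ᵐ[volume]
    fun t => if t < T then u.val t else v.val (t - T) := by
  have h := ae_add_left v.rep_ae (-T)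
  filter_upwards [ofFun_val hU _ _ _ , u.rep_ae, h] with t h1 h2 h3
  rw [cat, h1]
  rw [neg_add_eq_sub] at h3
  rw [h2, h3]

lemma cat_val_of_lt (hU : IsCompact U) (hU0 : (0 : EuclideanSpace ℝ (Fin m)) ∈ U) (T : ℝ)
    (u v : Control U) :
    ∀ᵐ t : ℝ, t < T → (cat hU hU0 T u v).val t = u.val t := by
  filter_upwards [cat_val hU hU0 T u v] with t h ht
  rw [h, if_pos ht]

lemma shift_cat_val (hU : IsCompact U) (hU0 : (0 : EuclideanSpace ℝ (Fin m)) ∈ U) (T : ℝ)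
    (u v : Control U) :
    ∀ᵐ t : ℝ, 0 ≤ t → ((cat hU hU0 T u v).shift T).val t = v.val t := by
  filter_upwards [shift_val T (cat hU hU0 T u v),
    ae_add_left (cat_val hU hU0 T u v) T] with t h h' ht
  rw [h, h', if_neg (by linarith), add_sub_cancel_left]

/-- Reduces the continuity of `cat` in the switching time to that of the shift. -/
lemma cat_eq (hU : IsCompact U) (hU0 : (0 : EuclideanSpace ℝ (Fin m)) ∈ U) (T : ℝ)
    (u v : Control U) :
    cat hU hU0 T u v = (cat hU hU0 0 (u.shift T) v).shift (-T) := by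
  apply ext_ae
  filter_upwards [shift_val (-T) (cat hU hU0 0 (u.shift T) v), cat_val hU hU0 T u v,
    ae_add_left (cat_val hU hU0 0 (u.shift T) v) (-T), ae_add_left (shift_val T u) (-T)]
    with t h1 h2 h3 h4
  rw [h1, h2, h3, h4]
  rcases lt_or_ge t T with h | h
  · rw [if_pos h, if_pos (by linarith)]; congr 1; ring
  · rw [if_neg (not_lt.2 h), if_neg (by linarith)]; congr 1; ring

lemma shift_periodize (hU : IsCompact U) (hU0 : (0 : EuclideanSpace ℝ (Fin m)) ∈ U) {S : ℝ}
    (hS : S ≠ 0) (u : Control U) :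
    (periodize hU hU0 S u).shift S = periodize hU hU0 S u := by
  apply ext_ae
  have h0 := ofFun_val hU (fun t => u.rep (S * Int.fract (t / S)))
    ((u.measurable_rep hU).comp ((measurable_fract.comp (measurable_id.div_const S)).const_mul S))
    fun _ => u.rep_mem hU0 _
  filter_upwards [shift_val S (periodize hU hU0 S u), h0, ae_add_left h0 S] with t h1 h2 h3
  rw [h1]
  refine h3.trans (Eq.trans ?_ h2.symm)
  rw [add_div, div_self hS, add_comm, Int.fract_add_one]

lemma periodize_val (hU : IsCompact U) (hU0 : (0 : EuclideanSpace ℝ (Fin m)) ∈ U) {S : ℝ}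
    (hS : 0 < S) (u : Control U) :
    ∀ᵐ t : ℝ, 0 ≤ t → t < S → (periodize hU hU0 S u).val t = u.val t := by
  filter_upwards [ofFun_val hU (fun t => u.rep (S * Int.fract (t / S)))
    ((u.measurable_rep hU).comp ((measurable_fract.comp (measurable_id.div_const S)).const_mul S))
    fun _ => u.rep_mem hU0 _, u.rep_ae] with t h1 h2 h3 h4
  refine h1.trans ?_
  rw [Int.fract_eq_self.2 ⟨by positivity, by rwa [div_lt_one hS]⟩, mul_div_cancel₀ _ hS.ne', h2]

/-- The pairing of `L^1` with the space of controls which defines the weak-* topology. -/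
noncomputable def pairing (g : Lp (EuclideanSpace ℝ (Fin m)) 1 (volume : Measure ℝ))
    (u : Control U) : ℝ := ∫ t : ℝ, inner ℝ (g t) (u.val t)

lemma tendsto_iff {ι : Type*} {l : Filter ι} {u : ι → Control U} {u₀ : Control U} :
    Tendsto u l (𝓝 u₀) ↔ ∀ g, Tendsto (fun i => pairing g (u i)) l (𝓝 (pairing g u₀)) := by
  have : IsInducing (fun (u : Control U) (g : Lp (EuclideanSpace ℝ (Fin m)) 1
      (volume : Measure ℝ)) => ∫ t : ℝ, inner ℝ (g t) (u.val t)) := ⟨rfl⟩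
  rw [this.tendsto_nhds_iff, tendsto_pi_nhds]
  rfl

lemma exists_bound (hU : IsCompact U) : ∃ C > 0, ∀ w ∈ U, ‖w‖ ≤ C := by
  obtain ⟨C, hC⟩ := hU.isBounded.exists_norm_le
  exact ⟨max C 1, by positivity, fun w hw => (hC w hw).trans (le_max_left _ _)⟩

lemma integrable_inner {C : ℝ} (hC : ∀ w ∈ U, ‖w‖ ≤ C) {g : ℝ → EuclideanSpace ℝ (Fin m)}
    (hg : Integrable g) (u : Control U) :
    Integrable (fun t => inner ℝ (g t) (u.val t)) := by
  refine (hg.norm.mul_const C).mono'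
    (hg.aestronglyMeasurable.inner (𝕜 := ℝ) u.measurable_val.aestronglyMeasurable) ?_
  filter_upwards [u.ae_val_mem] with t ht
  exact (norm_inner_le_norm (𝕜 := ℝ) _ _).trans
    (mul_le_mul_of_nonneg_left (hC _ ht) (norm_nonneg _))

lemma abs_pairing_sub_le {C : ℝ} (hC : ∀ w ∈ U, ‖w‖ ≤ C)
    (g g' : Lp (EuclideanSpace ℝ (Fin m)) 1 (volume : Measure ℝ))
    (u : Control U) : |pairing g u - pairing g' u| ≤ ‖g - g'‖ * C := by
  rw [pairing, pairing, ← integral_sub (integrable_inner hC (L1.integrable_coeFn g) u)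
    (integrable_inner hC (L1.integrable_coeFn g') u), L1.norm_eq_integral_norm,
    ← integral_mul_const, ← Real.norm_eq_abs]
  refine norm_integral_le_of_norm_le ((L1.integrable_coeFn (g - g')).norm.mul_const C) ?_
  filter_upwards [u.ae_val_mem, Lp.coeFn_sub g g'] with t ht h2
  rw [← inner_sub_left, h2]
  exact (norm_inner_le_norm (𝕜 := ℝ) _ _).trans
    (mul_le_mul_of_nonneg_left (hC _ ht) (norm_nonneg _))

/-- Controls that agree on a large interval differ weakly only by the tails of the test function. -/
lemma abs_pairing_sub_le_of_eq_on {C : ℝ} (hC : ∀ w ∈ U, ‖w‖ ≤ C) {R : ℝ} (hR : 0 ≤ R)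
    (g : Lp (EuclideanSpace ℝ (Fin m)) 1 (volume : Measure ℝ))
    {u v : Control U} (huv : ∀ᵐ t : ℝ, -R < t → t < R → u.val t = v.val t) :
    |pairing g u - pairing g v| ≤ 2 * C * ((∫ t, ‖g t‖) - ∫ t in (-R)..R, ‖g t‖) := by
  have hg := (L1.integrable_coeFn g)
  rw [pairing, pairing, ← integral_sub (integrable_inner hC hg u) (integrable_inner hC hg v)]
  have h1 : (∫ t, ‖g t‖) - ∫ t in (-R)..R, ‖g t‖ =
      ∫ t, (‖g t‖ - (Ioc (-R) R).indicator (fun t => ‖g t‖) t) := by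
    rw [integral_sub hg.norm (hg.norm.indicator measurableSet_Ioc),
      integral_indicator measurableSet_Ioc, intervalIntegral.integral_of_le (by linarith)]
  rw [h1, ← integral_const_mul, ← Real.norm_eq_abs]
  refine norm_integral_le_of_norm_le
    ((hg.norm.sub (hg.norm.indicator measurableSet_Ioc)).const_mul _) ?_
  filter_upwards [u.ae_val_mem, v.ae_val_mem, huv, (volume : Measure ℝ).ae_ne R]
    with t h1 h2 h3 h4
  by_cases ht : t ∈ Ioc (-R) R
  · rw [h3 ht.1 (lt_of_le_of_ne ht.2 h4), indicator_of_mem ht]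
    simp
  · rw [indicator_of_notMem ht, sub_zero, ← inner_sub_right]
    refine (norm_inner_le_norm (𝕜 := ℝ) _ _).trans ?_
    have := (norm_sub_le (u.val t) (v.val t)).trans (add_le_add (hC _ h1) (hC _ h2))
    nlinarith [norm_nonneg (g t)]

lemma continuous_shift (hU : IsCompact U) : Continuous fun p : ℝ × Control U => p.2.shift p.1 := by
  obtain ⟨C, hC0, hC⟩ := exists_bound hU
  rw [continuous_iff_continuousAt]
  rintro ⟨t₀, u₀⟩
  refine tendsto_iff.2 fun g => ?_
  -- move the shift to the test function
  let τ : ℝ → Lp (EuclideanSpace ℝ (Fin m)) 1 (volume : Measure ℝ) := fun t =>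
    Lp.compMeasurePreserving (fun s : ℝ => -t + s) (measurePreserving_add_left volume (-t)) g
  have hτ : ∀ t (u : Control U), pairing g (u.shift t) = pairing (τ t) u := by
    intro t u
    have h1 : pairing (τ t) u = ∫ s, inner ℝ (g (-t + s)) (u.val s) := by
      refine integral_congr_ae ?_
      filter_upwards [Lp.coeFn_compMeasurePreserving g
        (measurePreserving_add_left (volume : Measure ℝ) (-t))] with s hs
      change inner ℝ (τ t s) _ = _
      rw [show τ t s = _ from hs]; rfl
    have h2 : pairing g (u.shift t) = ∫ s, inner ℝ (g s) (u.val (t + s)) := by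
      refine integral_congr_ae ?_
      filter_upwards [shift_val t u] with s hs
      rw [hs]
    rw [h1, h2, ← integral_add_left_eq_self (fun s => inner ℝ (g (-t + s)) (u.val s)) t]
    simp
  have hτc : Tendsto τ (𝓝 t₀) (𝓝 (τ t₀)) := by
    let T : ℝ → C(ℝ, ℝ) := fun t => ⟨fun s => -t + s, by fun_prop⟩
    have hT : Continuous T := ContinuousMap.continuous_of_continuous_uncurry _ (by
      change Continuous fun p : ℝ × ℝ => -p.1 + p.2
      fun_prop)
    exact Filter.Tendsto.compMeasurePreservingLp (f := fun _ => g) (g := T) (g₀ := T t₀)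
      tendsto_const_nhds (hT.tendsto t₀) (fun t => measurePreserving_add_left volume (-t))
      (measurePreserving_add_left volume (-t₀)) (by norm_num)
  have hfst : Tendsto (fun p : ℝ × Control U => p.1) (𝓝 (t₀, u₀)) (𝓝 t₀) := continuous_fst.tendsto _
  have hsnd : Tendsto (fun p : ℝ × Control U => p.2) (𝓝 (t₀, u₀)) (𝓝 u₀) := continuous_snd.tendsto _
  simp only [hτ]
  have h1 := tendsto_iff.1 hsnd (τ t₀)
  have h2 : Tendsto (fun p : ℝ × Control U => pairing (τ p.1) p.2 - pairing (τ t₀) p.2)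
      (𝓝 (t₀, u₀)) (𝓝 0) := by
    refine squeeze_zero_norm (fun p => abs_pairing_sub_le hC _ _ p.2) ?_
    have := ((hτc.comp hfst).sub_const (τ t₀)).norm.mul_const C
    simpa using this
  simpa using h2.add h1

lemma tendsto_shift (hU : IsCompact U) {ι : Type*} {l : Filter ι} {u : ι → Control U}
    {u₀ : Control U} {t : ι → ℝ} {t₀ : ℝ} (ht : Tendsto t l (𝓝 t₀)) (hu : Tendsto u l (𝓝 u₀)) :
    Tendsto (fun i => (u i).shift (t i)) l (𝓝 (u₀.shift t₀)) := by
  have h := ((continuous_shift hU).tendsto (t₀, u₀)).comp (ht.prodMk_nhds hu)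
  simp only [Function.comp_def] at h
  exact h

/-- Cutting the test function at `0` makes the pairing with a concatenation a sum of two pairings.
-/
lemma continuous_cat_zero (hU : IsCompact U) (hU0 : (0 : EuclideanSpace ℝ (Fin m)) ∈ U) :
    Continuous fun p : Control U × Control U => cat hU hU0 0 p.1 p.2 := by
  obtain ⟨C, hC0, hC⟩ := exists_bound hU
  rw [continuous_iff_continuousAt]
  rintro ⟨u₀, v₀⟩
  refine tendsto_iff.2 fun g => ?_
  have hm : ∀ s : Set ℝ, MeasurableSet s → MemLp (s.indicator g) 1 volume := fun s hs =>
    (Lp.memLp g).indicator hs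
  have key : ∀ u v : Control U, pairing g (cat hU hU0 0 u v) =
      pairing ((hm (Iio 0) measurableSet_Iio).toLp _) u +
      pairing ((hm (Ici 0) measurableSet_Ici).toLp _) v := by
    intro u v
    rw [pairing, pairing, pairing, ← integral_add (integrable_inner hC (L1.integrable_coeFn _) u)
      (integrable_inner hC (L1.integrable_coeFn _) v)]
    refine integral_congr_ae ?_
    filter_upwards [cat_val hU hU0 0 u v, (hm (Iio 0) measurableSet_Iio).coeFn_toLp,
      (hm (Ici 0) measurableSet_Ici).coeFn_toLp] with t h1 h2 h3
    rw [h1, h2, h3]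
    rcases lt_or_ge t 0 with h | h
    · simp [h]
    · simp [h, not_lt.2 h]
  simp only [key]
  exact (tendsto_iff.1 (continuous_fst.tendsto (u₀, v₀)) _).add
    (tendsto_iff.1 (continuous_snd.tendsto (u₀, v₀)) _)

lemma continuous_cat (hU : IsCompact U) (hU0 : (0 : EuclideanSpace ℝ (Fin m)) ∈ U) :
    Continuous fun p : ℝ × Control U × Control U => cat hU hU0 p.1 p.2.1 p.2.2 := by
  have h0 : (fun p : ℝ × Control U × Control U => cat hU hU0 p.1 p.2.1 p.2.2) = fun p =>
      (cat hU hU0 0 (p.2.1.shift p.1) p.2.2).shift (-p.1) := funext fun p => cat_eq hU hU0 _ _ _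
  rw [h0]
  have h1 : Continuous fun p : ℝ × Control U × Control U => p.2.1.shift p.1 :=
    (continuous_shift hU).comp (continuous_fst.prodMk (continuous_fst.comp continuous_snd))
  exact (continuous_shift hU).comp (continuous_fst.neg.prodMk
    ((continuous_cat_zero hU hU0).comp (h1.prodMk (continuous_snd.comp continuous_snd))))

/-- Weak-* convergence of bounded controls can be checked on bounded time intervals. -/
lemma tendsto_of_forall_eq_on (hU : IsCompact U) {ι : Type*} {l : Filter ι} {u : ι → Control U}
    {u₀ : Control U}
    (h : ∀ N : ℕ, ∃ (w : ι → Control U) (w₀ : Control U), Tendsto w l (𝓝 w₀) ∧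
      (∀ᶠ i in l, ∀ᵐ t : ℝ, -(N : ℝ) < t → t < N → (u i).val t = (w i).val t) ∧
      ∀ᵐ t : ℝ, -(N : ℝ) < t → t < N → u₀.val t = w₀.val t) : Tendsto u l (𝓝 u₀) := by
  obtain ⟨C, hC0, hC⟩ := exists_bound hU
  refine tendsto_iff.2 fun g => ?_
  rw [Metric.tendsto_nhds]
  intro ε hε
  have h1 : Tendsto (fun N : ℕ => 2 * C * ((∫ t, ‖g t‖) - ∫ t in (-(N : ℝ))..N, ‖g t‖)) atTop
      (𝓝 0) := by
    have := intervalIntegral_tendsto_integral (L1.integrable_coeFn g).norm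
      (tendsto_neg_atTop_atBot.comp (tendsto_natCast_atTop_atTop (R := ℝ)))
      (tendsto_natCast_atTop_atTop (R := ℝ))
    have h2 := (this.const_sub (∫ t, ‖g t‖)).const_mul (2 * C)
    simpa using h2
  obtain ⟨N, hN⟩ := (h1.eventually_lt_const (show 0 < ε / 3 by positivity)).exists
  obtain ⟨w, w₀, hw, hi, h0⟩ := h N
  filter_upwards [hi, Metric.tendsto_nhds.1 (tendsto_iff.1 hw g) (ε / 3) (by positivity)]
    with i h3 h4
  have h5 := abs_pairing_sub_le_of_eq_on hC (Nat.cast_nonneg N) g h3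
  have h6 := abs_pairing_sub_le_of_eq_on hC (Nat.cast_nonneg N) g h0
  rw [Real.dist_eq] at h4 ⊢
  rw [abs_le] at h5 h6
  rw [abs_lt] at h4 ⊢
  constructor <;> linarith [h5.1, h5.2, h6.1, h6.2, h4.1, h4.2]

lemma tendsto_cat (hU : IsCompact U) (hU0 : (0 : EuclideanSpace ℝ (Fin m)) ∈ U) {ι : Type*}
    {l : Filter ι} {u v : ι → Control U} {u₀ v₀ : Control U} {t : ι → ℝ} {t₀ : ℝ}
    (ht : Tendsto t l (𝓝 t₀)) (hu : Tendsto u l (𝓝 u₀)) (hv : Tendsto v l (𝓝 v₀)) :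
    Tendsto (fun i => cat hU hU0 (t i) (u i) (v i)) l (𝓝 (cat hU hU0 t₀ u₀ v₀)) := by
  have h := ((continuous_cat hU hU0).tendsto (t₀, u₀, v₀)).comp
    (ht.prodMk_nhds (hu.prodMk_nhds hv))
  simp only [Function.comp_def] at h
  exact h

/-- Finite repetition: `u` on `[0, S)`, repeated `n` times, and then `u` again. -/
noncomputable def iterCat (hU : IsCompact U) (hU0 : (0 : EuclideanSpace ℝ (Fin m)) ∈ U) (S : ℝ)
    (u : Control U) : ℕ → Control U
  | 0 => u
  | n + 1 => cat hU hU0 S u (iterCat hU hU0 S u n)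

lemma continuous_iterCat (hU : IsCompact U) (hU0 : (0 : EuclideanSpace ℝ (Fin m)) ∈ U) (n : ℕ) :
    Continuous fun p : ℝ × Control U => iterCat hU hU0 p.1 p.2 n := by
  induction n with
  | zero => exact continuous_snd
  | succ n ih =>
    exact (continuous_cat hU hU0).comp (continuous_fst.prodMk (continuous_snd.prodMk ih))

lemma iterCat_val (hU : IsCompact U) (hU0 : (0 : EuclideanSpace ℝ (Fin m)) ∈ U) {S : ℝ} (hS : 0 < S)
    (u : Control U) (n : ℕ) :
    ∀ᵐ t : ℝ, 0 ≤ t → t < (n + 1) * S →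
      (iterCat hU hU0 S u n).val t = (periodize hU hU0 S u).val t := by
  induction n with
  | zero =>
    filter_upwards [periodize_val hU hU0 hS u] with t h1 h2 h3
    rw [h1 h2 (by simpa using h3)]; rfl
  | succ n ih =>
    filter_upwards [cat_val hU hU0 S u (iterCat hU hU0 S u n), ae_add_left ih (-S),
      periodize_val hU hU0 hS u, ae_add_left (shift_val S (periodize hU hU0 S u)) (-S)]
      with t h1 h2 h3 h4 h5 h6
    rw [shift_periodize hU hU0 hS.ne', add_neg_cancel_left] at h4
    rw [iterCat, h1]
    split_ifs with h
    · exact (h3 h5 h).symm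
    · rw [← h4, ← h2 (by linarith) (by push_cast at h6; linarith), neg_add_eq_sub]

/-- On `[-n S, n S)`, the periodic continuation is a shift of a finite repetition. -/
lemma periodize_val_eq_shift_iterCat (hU : IsCompact U)
    (hU0 : (0 : EuclideanSpace ℝ (Fin m)) ∈ U) {S : ℝ} (hS : 0 < S) (u : Control U) (n k : ℕ)
    (hk : k = 2 * n) : ∀ᵐ t : ℝ, -(n * S) < t → t < n * S →
      (periodize hU hU0 S u).val t = ((iterCat hU hU0 S u k).shift (n * S)).val t := by
  have hshift : ∀ n : ℕ, (periodize hU hU0 S u).shift (n * S) = periodize hU hU0 S u := by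
    intro n
    induction n with
    | zero => simp [shift_zero]
    | succ n ih =>
      have : ((n + 1 : ℕ) : ℝ) * S = n * S + S := by push_cast; ring
      rw [this, ← shift_shift, ih, shift_periodize hU hU0 hS.ne']
  have h1 := shift_val (n * S) (periodize hU hU0 S u)
  rw [hshift] at h1
  filter_upwards [h1, shift_val (n * S) (iterCat hU hU0 S u k),
    ae_add_left (iterCat_val hU hU0 hS u k) (n * S)] with t h1 h2 h3 h4 h5
  rw [h1, h2, h3 (by linarith) (by rw [hk]; push_cast; linarith)]

/-- On a bounded interval, periodic continuations with periods near `S₀` are shifts of repetitions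
of a fixed length, which depend continuously on the period. -/
lemma tendsto_periodize (hU : IsCompact U) (hU0 : (0 : EuclideanSpace ℝ (Fin m)) ∈ U) {ι : Type*}
    {l : Filter ι} {u : ι → Control U} {u₀ : Control U} {S : ι → ℝ} {S₀ : ℝ} (hS₀ : 0 < S₀)
    (hS : Tendsto S l (𝓝 S₀)) (hu : Tendsto u l (𝓝 u₀)) :
    Tendsto (fun i => periodize hU hU0 (S i) (u i)) l (𝓝 (periodize hU hU0 S₀ u₀)) := by
  refine tendsto_of_forall_eq_on hU fun N => ?_
  obtain ⟨n, hn⟩ := exists_nat_gt (N / (S₀ / 2))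
  rw [div_lt_iff₀ (by positivity)] at hn
  obtain ⟨k, hk⟩ : ∃ k, k = 2 * n := ⟨_, rfl⟩
  have key : ∀ (S : ℝ) (u : Control U), S₀ / 2 < S → ∀ᵐ t : ℝ, -(N : ℝ) < t → t < N →
      (periodize hU hU0 S u).val t = ((iterCat hU hU0 S u k).shift (n * S)).val t := by
    intro S u hS
    have hnS : (N : ℝ) < n * S :=
      hn.trans_le (mul_le_mul_of_nonneg_left hS.le (Nat.cast_nonneg n))
    filter_upwards [periodize_val_eq_shift_iterCat hU hU0 (by linarith) u n k hk] with t h h1 h2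
      using h (by linarith) (by linarith)
  have hit : Tendsto (fun i => iterCat hU hU0 (S i) (u i) k) l
      (𝓝 (iterCat hU hU0 S₀ u₀ k)) :=
    ((continuous_iterCat hU hU0 k).tendsto (S₀, u₀)).comp (hS.prodMk_nhds hu)
  have hsh : Tendsto (fun i => (iterCat hU hU0 (S i) (u i) k).shift (n * S i)) l
      (𝓝 ((iterCat hU hU0 S₀ u₀ k).shift (n * S₀))) :=
    tendsto_shift hU (hS.const_mul (n : ℝ)) hit
  refine ⟨_, _, hsh, ?_, key S₀ u₀ (by linarith)⟩
  have hev : ∀ᶠ i in l, S₀ / 2 < S i := hS.eventually_const_lt (by linarith)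
  exact hev.mono fun i hi => key (S i) (u i) hi

/-- The piecewise constant control with the values `w (J 0)`, `w (J 1)`, …, held for the times
`s 0`, `s 1`, …; the last value is kept forever. -/
noncomputable def word {ι : Type*} (w : ι → Control U) (hU : IsCompact U)
    (hU0 : (0 : EuclideanSpace ℝ (Fin m)) ∈ U) :
    (n : ℕ) → (Fin n → ι) → (Fin n → ℝ) → Control U
  | 0, _, _ => const hU 0 hU0
  | n + 1, J, s => cat hU hU0 (∑ i : Fin n, s i.castSucc)
      (word w hU hU0 n (fun i => J i.castSucc) (fun i => s i.castSucc)) (w (J (Fin.last n)))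

lemma continuous_word (hU : IsCompact U) (hU0 : (0 : EuclideanSpace ℝ (Fin m)) ∈ U) {ι : Type*}
    (w : ι → Control U) (n : ℕ) (J : Fin n → ι) : Continuous (word w hU hU0 n J) := by
  induction n with
  | zero => exact continuous_const
  | succ n ih =>
    have h1 : Continuous fun s : Fin (n + 1) → ℝ => ∑ i : Fin n, s i.castSucc :=
      continuous_finsetSum _ fun i _ => continuous_apply i.castSucc
    have h2 : Continuous fun s : Fin (n + 1) → ℝ =>
        word w hU hU0 n (fun i => J i.castSucc) (fun i => s i.castSucc) :=
      (ih fun i => J i.castSucc).comp (continuous_pi fun i => continuous_apply i.castSucc)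
    have h3 : Continuous fun _ : Fin (n + 1) → ℝ => w (J (Fin.last n)) := continuous_const
    exact (continuous_cat hU hU0).comp (h1.prodMk (h2.prodMk h3))

end Control

end ControlAffine

namespace ControlAffine
/-! ### Trajectories as driven curves in Euclidean space -/

section Driven

variable {m : ℕ} {M E : Type*} [NormedAddCommGroup E] [NormedSpace ℝ E]

/-- The first order increment at `x`, over the time interval from `t₀` to `t`, of a control-affine
system with the fields `F` and the control function `h`. -/
noncomputable def increment (F : Fin (m + 1) → M → E) (h : ℝ → EuclideanSpace ℝ (Fin m)) (x : M)
    (t₀ t : ℝ) : E :=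
  (t - t₀) • F 0 x + ∑ i : Fin m, (∫ s in t₀..t, h s i) • F i.succ x

/-- The image under `e` of the curve `γ` follows the control-affine system with the fields `F` and
the control function `h` to first order at the time `t₀`, along the filter `l`. In contrast to
differentiability, this makes sense at every time, also for a control function that is only
measurable. -/
def DrivenAt (e : M → E) (F : Fin (m + 1) → M → E) (h : ℝ → EuclideanSpace ℝ (Fin m)) (γ : ℝ → M)
    (t₀ : ℝ) (l : Filter ℝ) : Prop :=
  (fun t => e (γ t) - e (γ t₀) - increment F h (γ t₀) t₀ t) =o[l] fun t => t - t₀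

lemma abs_integral_apply_le {h : ℝ → EuclideanSpace ℝ (Fin m)} {C : ℝ} (hh : ∀ᵐ s, ‖h s‖ ≤ C)
    (i : Fin m) (t₀ t : ℝ) : |∫ s in t₀..t, h s i| ≤ C * |t - t₀| := by
  rw [← Real.norm_eq_abs]
  refine intervalIntegral.norm_integral_le_of_norm_le_const_ae ?_
  filter_upwards [hh] with s hs _
  exact (PiLp.norm_apply_le _ i).trans hs

lemma norm_increment_sub_le {F F' : Fin (m + 1) → M → E} {h : ℝ → EuclideanSpace ℝ (Fin m)} {C : ℝ}
    (hh : ∀ᵐ s, ‖h s‖ ≤ C) {x x' : M} {D : ℝ}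
    (hF : ∀ j, ‖F j x - F' j x'‖ ≤ D) (t₀ t : ℝ) :
    ‖increment F h x t₀ t - increment F' h x' t₀ t‖ ≤ D * (1 + m * C) * |t - t₀| := by
  have h1 : increment F h x t₀ t - increment F' h x' t₀ t = (t - t₀) • (F 0 x - F' 0 x') +
      ∑ i : Fin m, (∫ s in t₀..t, h s i) • (F i.succ x - F' i.succ x') := by
    simp only [increment, smul_sub, Finset.sum_sub_distrib]
    abel
  have h2 : ‖∑ i : Fin m, (∫ s in t₀..t, h s i) • (F i.succ x - F' i.succ x')‖ ≤
      ∑ _i : Fin m, C * |t - t₀| * D := norm_sum_le_of_le _ fun i _ => by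
    rw [norm_smul, Real.norm_eq_abs]
    have h3 := abs_integral_apply_le hh i t₀ t
    exact mul_le_mul h3 (hF _) (norm_nonneg _) ((abs_nonneg _).trans h3)
  rw [Finset.sum_const, Finset.card_univ, Fintype.card_fin, nsmul_eq_mul] at h2
  have h3 : ‖(t - t₀) • (F 0 x - F' 0 x')‖ ≤ |t - t₀| * D := by
    rw [norm_smul, Real.norm_eq_abs]
    exact mul_le_mul_of_nonneg_left (hF 0) (abs_nonneg _)
  rw [h1]
  refine (norm_add_le _ _).trans ((add_le_add h3 h2).trans (le_of_eq ?_))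
  ring

lemma DrivenAt.congr_control {e : M → E} {F : Fin (m + 1) → M → E}
    {h h' : ℝ → EuclideanSpace ℝ (Fin m)} {γ : ℝ → M} {t₀ : ℝ} {l : Filter ℝ}
    (hγ : DrivenAt e F h γ t₀ l)
    (hh : ∀ᶠ t in l, ∀ᵐ s, s ∈ uIoc t₀ t → h s = h' s) : DrivenAt e F h' γ t₀ l := by
  refine Asymptotics.IsLittleO.congr' hγ ?_ EventuallyEq.rfl
  filter_upwards [hh] with t ht
  have : ∀ i, ∫ s in t₀..t, h s i = ∫ s in t₀..t, h' s i := fun i =>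
    intervalIntegral.integral_congr_ae (ht.mono fun s hs hst => by rw [hs hst])
  simp only [increment, this]

lemma DrivenAt.comp_neg {e : M → E} {F : Fin (m + 1) → M → E} {h : ℝ → EuclideanSpace ℝ (Fin m)}
    {γ : ℝ → M} {t₀ : ℝ} (hγ : DrivenAt e F h γ (-t₀) (𝓝 (-t₀))) :
    DrivenAt e (fun j x => -F j x) (fun s => h (-s)) (fun t => γ (-t)) t₀ (𝓝 t₀) := by
  have h1 : Tendsto (fun t : ℝ => -t) (𝓝 t₀) (𝓝 (-t₀)) := tendsto_neg t₀
  have h2 := (Asymptotics.IsLittleO.comp_tendsto hγ h1).neg_right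
  refine h2.congr (fun t => ?_) (fun t => ?_)
  · simp only [Function.comp_apply, increment]
    congr 2
    · rw [smul_neg, ← neg_smul]; congr 1; ring
    · refine Finset.sum_congr rfl fun i _ => ?_
      rw [intervalIntegral.integral_comp_neg (fun s => h s i), smul_neg, ← neg_smul,
        intervalIntegral.integral_symm]
  · simp only [Function.comp_apply]; ring

/-- Grönwall's inequality for two driven curves with the same control function. -/
lemma norm_sub_le_gronwallBound {e : M → E} {F F' : Fin (m + 1) → M → E}
    {h : ℝ → EuclideanSpace ℝ (Fin m)} {γ γ' : ℝ → M} {a b C K η : ℝ}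
    (hγc : ContinuousOn (fun t => e (γ t)) (Icc a b))
    (hγc' : ContinuousOn (fun t => e (γ' t)) (Icc a b))
    (hγ : ∀ t₀ ∈ Ico a b, DrivenAt e F h γ t₀ (𝓝[>] t₀))
    (hγ' : ∀ t₀ ∈ Ico a b, DrivenAt e F' h γ' t₀ (𝓝[>] t₀))
    (hh : ∀ᵐ s, ‖h s‖ ≤ C) (hF : ∀ j x x', ‖F j x - F' j x'‖ ≤ η + K * ‖e x - e x'‖) :
    ∀ t ∈ Icc a b, ‖e (γ t) - e (γ' t)‖ ≤ gronwallBound ‖e (γ a) - e (γ' a)‖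
      (K * (1 + m * C)) (η * (1 + m * C)) (t - a) := by
  refine le_gronwallBound_of_liminf_deriv_right_le
    (f' := fun t => (η + K * ‖e (γ t) - e (γ' t)‖) * (1 + m * C)) (hγc.sub hγc').norm ?_ le_rfl
    (fun t _ => by apply le_of_eq; ring)
  intro t₀ ht₀ r hr
  refine Eventually.frequently ?_
  have hd := Asymptotics.IsLittleO.sub (hγ t₀ ht₀) (hγ' t₀ ht₀)
  set q := (η + K * ‖e (γ t₀) - e (γ' t₀)‖) * (1 + m * C) with hq
  have hpos : 0 < (r - q) / 2 := by linarith
  filter_upwards [hd.def hpos, self_mem_nhdsWithin] with t ht htt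
  have htt' : 0 < t - t₀ := sub_pos.2 htt
  have h1 := norm_increment_sub_le hh (fun j => hF j (γ t₀) (γ' t₀)) t₀ t
  rw [Real.norm_eq_abs, abs_of_pos htt'] at ht
  rw [abs_of_pos htt', ← hq] at h1
  have h2 : ‖e (γ t) - e (γ' t)‖ ≤ ‖e (γ t₀) - e (γ' t₀)‖ +
      (q * (t - t₀) + (r - q) / 2 * (t - t₀)) := by
    have h3 : e (γ t) - e (γ' t) = (e (γ t₀) - e (γ' t₀)) +
      ((increment F h (γ t₀) t₀ t - increment F' h (γ' t₀) t₀ t) +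
      (e (γ t) - e (γ t₀) - increment F h (γ t₀) t₀ t -
        (e (γ' t) - e (γ' t₀) - increment F' h (γ' t₀) t₀ t))) := by abel
    rw [h3]
    exact (norm_add_le _ _).trans (add_le_add le_rfl ((norm_add_le _ _).trans (add_le_add h1 ht)))
  rw [inv_mul_lt_iff₀ htt']
  nlinarith

/-- Grönwall's inequality for driven curves that are defined for all times. -/
lemma norm_sub_le_gronwallBound_abs {e : M → E} {F F' : Fin (m + 1) → M → E}
    {h : ℝ → EuclideanSpace ℝ (Fin m)} {γ γ' : ℝ → M} {C K η : ℝ}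
    (hγc : Continuous fun t => e (γ t)) (hγc' : Continuous fun t => e (γ' t))
    (hγ : ∀ t₀, DrivenAt e F h γ t₀ (𝓝 t₀)) (hγ' : ∀ t₀, DrivenAt e F' h γ' t₀ (𝓝 t₀))
    (hh : ∀ᵐ s, ‖h s‖ ≤ C) (hF : ∀ j x x', ‖F j x - F' j x'‖ ≤ η + K * ‖e x - e x'‖) (t : ℝ) :
    ‖e (γ t) - e (γ' t)‖ ≤ gronwallBound ‖e (γ 0) - e (γ' 0)‖
      (K * (1 + m * C)) (η * (1 + m * C)) |t| := by
  rcases le_total 0 t with ht | ht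
  · rw [abs_of_nonneg ht]
    have := norm_sub_le_gronwallBound (a := 0) (b := t) hγc.continuousOn hγc'.continuousOn
      (fun t₀ _ => (hγ t₀).mono nhdsWithin_le_nhds) (fun t₀ _ => (hγ' t₀).mono nhdsWithin_le_nhds)
      hh hF t ⟨ht, le_rfl⟩
    rwa [sub_zero] at this
  · rw [abs_of_nonpos ht]
    have := norm_sub_le_gronwallBound (a := 0) (b := -t) (γ := fun t => γ (-t))
      (γ' := fun t => γ' (-t)) (F := fun j x => -F j x) (F' := fun j x => -F' j x)
      (h := fun s => h (-s)) (hγc.comp continuous_neg).continuousOn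
      (hγc'.comp continuous_neg).continuousOn
      (fun t₀ _ => (hγ (-t₀)).comp_neg.mono nhdsWithin_le_nhds)
      (fun t₀ _ => (hγ' (-t₀)).comp_neg.mono nhdsWithin_le_nhds)
      ((Measure.measurePreserving_neg (volume : Measure ℝ)).quasiMeasurePreserving.ae hh)
      (fun j x x' => by rw [neg_sub_neg, norm_sub_rev]; exact hF j x x') (-t)
      ⟨by linarith, le_rfl⟩
    simpa only [sub_zero, neg_neg, neg_zero] using this

end Driven

section Manifold

variable {d m : ℕ} {M : Type*} [TopologicalSpace M] [ChartedSpace (EuclideanSpace ℝ (Fin d)) M]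
  {E : Type*} [NormedAddCommGroup E] [NormedSpace ℝ E]

/-- The image `de(V)` of a vector field on `M` under the derivative of a map into a vector space. -/
noncomputable def pushField (e : M → E) (V : (x : M) → TangentSpace (𝓡 d) x) (x : M) : E :=
  (mfderiv (𝓡 d) 𝓘(ℝ, E) e x (V x) : E)

lemma pushField_controlField (e : M → E) (f : Fin (m + 1) → (x : M) → TangentSpace (𝓡 d) x)
    (w : EuclideanSpace ℝ (Fin m)) (x : M) :
    pushField e (controlField f w) x =
      pushField e (f 0) x + ∑ i : Fin m, w i • pushField e (f i.succ) x := by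
  have h := map_add (mfderiv (𝓡 d) 𝓘(ℝ, E) e x) (f 0 x) (∑ i : Fin m, w i • f i.succ x)
  refine h.trans ?_
  rw [map_sum]
  congr 1
  exact Finset.sum_congr rfl fun i _ => map_smul (mfderiv (𝓡 d) 𝓘(ℝ, E) e x) _ _

variable [IsManifold (𝓡 d) ∞ M]

/-- The derivative of `e` in a chart maps chart representations of vector fields to their images
under `de`. -/
lemma exists_hasFDerivAt_comp_symm {e : M → E} (he : ContMDiff (𝓡 d) 𝓘(ℝ, E) ∞ e) {p : M}
    {y : EuclideanSpace ℝ (Fin d)} (hy : y ∈ (extChartAt (𝓡 d) p).target) :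
    ∃ D : EuclideanSpace ℝ (Fin d) →L[ℝ] E,
      HasFDerivAt (fun z => e ((extChartAt (𝓡 d) p).symm z)) D y ∧
      ∀ V : (x : M) → TangentSpace (𝓡 d) x,
        D (chartRep p V y) = pushField e V ((extChartAt (𝓡 d) p).symm y) := by
  set x := (extChartAt (𝓡 d) p).symm y with hx
  have hxs : x ∈ (chartAt (EuclideanSpace ℝ (Fin d)) p).source := symm_mem_chart_source hy
  have hxs' : x ∈ (extChartAt (𝓡 d) p).source := by rwa [extChartAt_source]
  have hxy : extChartAt (𝓡 d) p x = y := (extChartAt (𝓡 d) p).right_inv hy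
  have h1 : ContMDiffAt 𝓘(ℝ, EuclideanSpace ℝ (Fin d)) 𝓘(ℝ, E) ∞
      (fun z => e ((extChartAt (𝓡 d) p).symm z)) y :=
    he.contMDiffAt.comp y ((contMDiffOn_extChartAt_symm p).contMDiffAt
      ((isOpen_extChartAt_target p).mem_nhds hy))
  have h2 : DifferentiableAt ℝ (fun z => e ((extChartAt (𝓡 d) p).symm z)) y :=
    h1.contDiffAt.differentiableAt (by simp)
  refine ⟨_, h2.hasFDerivAt, fun V => ?_⟩
  have h3 : (fun z => e ((extChartAt (𝓡 d) p).symm z)) ∘ extChartAt (𝓡 d) p =ᶠ[𝓝 x] e := by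
    filter_upwards [(isOpen_extChartAt_source p).mem_nhds hxs'] with z hz
    exact congrArg e ((extChartAt (𝓡 d) p).left_inv hz)
  have h4 := mfderiv_comp_of_eq (I := 𝓡 d) (I' := 𝓘(ℝ, EuclideanSpace ℝ (Fin d)))
    (I'' := 𝓘(ℝ, E)) (x := x) (y := y) (f := extChartAt (𝓡 d) p)
    (g := fun z => e ((extChartAt (𝓡 d) p).symm z)) h2.mdifferentiableAt
    (mdifferentiableAt_extChartAt hxs) hxy
  rw [h3.mfderiv_eq] at h4
  rw [pushField, h4, mfderiv_eq_fderiv, hxy]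
  rfl

/-- A smooth curve in a chart that follows a constant control is a driven curve. -/
lemma drivenAt_of_hasDerivAt {e : M → E} (he : ContMDiff (𝓡 d) 𝓘(ℝ, E) ∞ e)
    (f : Fin (m + 1) → (x : M) → TangentSpace (𝓡 d) x) {p : M} {w : EuclideanSpace ℝ (Fin m)}
    {h : ℝ → EuclideanSpace ℝ (Fin m)} (hh : ∀ᵐ s, h s = w) {y : ℝ → EuclideanSpace ℝ (Fin d)}
    {t₀ : ℝ} (hyt : y t₀ ∈ (extChartAt (𝓡 d) p).target)
    (hy : HasDerivAt y (chartRep p (controlField f w) (y t₀)) t₀) :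
    DrivenAt e (fun j => pushField e (f j)) h (fun t => (extChartAt (𝓡 d) p).symm (y t)) t₀
      (𝓝 t₀) := by
  obtain ⟨D, hD, hDV⟩ := exists_hasFDerivAt_comp_symm he hyt
  have h1 := hD.comp_hasDerivAt t₀ hy
  rw [hDV, hasDerivAt_iff_isLittleO] at h1
  refine h1.congr_left fun t => ?_
  simp only [Function.comp_apply]
  congr 1
  rw [pushField_controlField, increment, smul_add, Finset.smul_sum]
  congr 1
  refine Finset.sum_congr rfl fun i _ => ?_
  have : ∫ s in t₀..t, h s i = (t - t₀) * w i := by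
    rw [intervalIntegral.integral_congr_ae (g := fun _ => w i)
      (hh.mono fun s hs _ => by rw [hs]), intervalIntegral.integral_const, smul_eq_mul]
  rw [this, smul_smul]

/-- In the chart at `γ t₀`, the integral equation of a solution gives the first order increment at
`t₀`. -/
lemma IsSolution.drivenAt_chart {f : Fin (m + 1) → (x : M) → TangentSpace (𝓡 d) x}
    (hf : ∀ j, SmoothField (f j)) {U : Set (EuclideanSpace ℝ (Fin m))} {C : ℝ}
    (hC : ∀ w ∈ U, ‖w‖ ≤ C) {u : Control U} {x : M} {γ : ℝ → M} (hγ : IsSolution f u x γ) (t₀ : ℝ) :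
    DrivenAt (extChartAt (𝓡 d) (γ t₀)) (fun j => pushField (extChartAt (𝓡 d) (γ t₀)) (f j)) u.val γ
      t₀ (𝓝 t₀) := by
  set φ := extChartAt (𝓡 d) (γ t₀) with hφ
  set c : Fin (m + 1) → ℝ → EuclideanSpace ℝ (Fin d) := fun j s => pushField φ (f j) (γ s) with hc
  have hub : ∀ᵐ s, ‖u.val s‖ ≤ C := u.ae_val_mem.mono fun s hs => hC _ hs
  have hsrc : ∀ᶠ s in 𝓝 t₀, γ s ∈ φ.source :=
    hγ.continuous.continuousAt.eventually
      ((isOpen_extChartAt_source (γ t₀)).eventually_mem (mem_extChartAt_source (γ t₀)))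
  -- the coefficients are continuous near `t₀`
  have hccont : ∀ j s, γ s ∈ φ.source → ContinuousAt (c j) s := by
    intro j s hs
    have h1 : ContinuousAt (chartRep (γ t₀) (f j)) (φ (γ s)) :=
      (contDiffOn_chartRep_of_contMDiff (hf j) (γ t₀)).continuousOn.continuousAt
        ((isOpen_extChartAt_target (γ t₀)).mem_nhds (φ.map_source hs))
    have h2 : ContinuousAt (fun s => φ (γ s)) s :=
      (continuousAt_extChartAt' hs).comp hγ.continuous.continuousAt
    have h3 : ContinuousAt (fun s => chartRep (γ t₀) (f j) (φ (γ s))) s :=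
      ContinuousAt.comp (f := fun s => φ (γ s)) h1 h2
    refine h3.congr ?_
    filter_upwards [hγ.continuous.continuousAt.preimage_mem_nhds
      ((isOpen_extChartAt_source (γ t₀)).mem_nhds hs)] with r hr
    rw [chartRep, φ.left_inv hr]
    rfl
  have huint : ∀ (i : Fin m) (a b : ℝ), IntervalIntegrable (fun s => u.val s i) volume a b := by
    intro i a b
    have hcst : IntervalIntegrable (fun _ : ℝ => C) volume a b := intervalIntegrable_const
    refine hcst.mono_fun ?_ ?_
    · exact ((EuclideanSpace.proj (𝕜 := ℝ) i).continuous.measurable.comp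
        u.measurable_val).aestronglyMeasurable
    · refine ae_restrict_of_ae (hub.mono fun s hs => ?_)
      exact ((PiLp.norm_apply_le _ i).trans hs).trans (le_abs_self C)
  rw [DrivenAt, Asymptotics.isLittleO_iff]
  intro ε hε
  have hmC : 0 < 1 + m * |C| := by positivity
  have hclose : ∀ᶠ s in 𝓝 t₀, ∀ j, ‖c j s - c j t₀‖ ≤ ε / (1 + m * |C|) := by
    rw [eventually_all]
    intro j
    have h1 := (hccont j t₀ (mem_extChartAt_source (γ t₀))).sub_const (c j t₀) |>.norm
    have h2 : ‖c j t₀ - c j t₀‖ < ε / (1 + m * |C|) := by rw [sub_self, norm_zero]; positivity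
    exact (h1.eventually_lt_const h2).mono fun s hs => hs.le
  obtain ⟨δ, hδ, hball⟩ := Metric.eventually_nhds_iff_ball.1 (hsrc.and hclose)
  filter_upwards [hγ.integral_eq t₀, Metric.ball_mem_nhds t₀ hδ] with t ht htδ
  have hI : uIcc t₀ t ⊆ Metric.ball t₀ δ :=
    (convex_ball t₀ δ).ordConnected.uIcc_subset (Metric.mem_ball_self hδ) htδ
  have hcI : ∀ j, ContinuousOn (c j) (uIcc t₀ t) := fun j s hs =>
    (hccont j s (hball s (hI hs)).1).continuousWithinAt
  have hint : ∀ g : Fin (m + 1) → ℝ → EuclideanSpace ℝ (Fin d),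
      (∀ j, ContinuousOn (g j) (uIcc t₀ t)) →
      IntervalIntegrable (fun s => g 0 s + ∑ i : Fin m, u.val s i • g i.succ s) volume t₀ t := by
    intro g hg
    refine (hg 0).intervalIntegrable.add ?_
    have := IntervalIntegrable.sum (μ := volume) (a := t₀) (b := t) Finset.univ
      (f := fun (i : Fin m) s => u.val s i • g i.succ s)
      fun i _ => (huint i t₀ t).smul_continuousOn (hg i.succ)
    simpa only [Finset.sum_fn] using this
  have hincr : increment (fun j => pushField φ (f j)) u.val (γ t₀) t₀ t =
      ∫ s in t₀..t, (c 0 t₀ + ∑ i : Fin m, u.val s i • c i.succ t₀) := by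
    rw [intervalIntegral.integral_add intervalIntegrable_const
      (by
        have := IntervalIntegrable.sum (μ := volume) (a := t₀) (b := t) Finset.univ
          (f := fun (i : Fin m) s => u.val s i • c i.succ t₀)
          fun i _ => (huint i t₀ t).smul_continuousOn continuousOn_const
        simpa only [Finset.sum_fn] using this),
      intervalIntegral.integral_finsetSum
        (fun i _ => (huint i t₀ t).smul_continuousOn continuousOn_const),
      intervalIntegral.integral_const]
    simp only [intervalIntegral.integral_smul_const]
    rfl
  have hsol : φ (γ t) - φ (γ t₀) = ∫ s in t₀..t, (c 0 s + ∑ i : Fin m, u.val s i • c i.succ s) := by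
    rw [ht, add_sub_cancel_left]
    exact intervalIntegral.integral_congr fun s _ => pushField_controlField φ f (u.val s) (γ s)
  rw [hincr, hsol, ← intervalIntegral.integral_sub (hint c hcI)
    (hint (fun j _ => c j t₀) fun j => continuousOn_const)]
  have hbd : ∀ᵐ s : ℝ, s ∈ uIoc t₀ t →
      ‖c 0 s + ∑ i : Fin m, u.val s i • c i.succ s -
        (c 0 t₀ + ∑ i : Fin m, u.val s i • c i.succ t₀)‖ ≤ ε := by
    filter_upwards [hub] with s hs hst
    have hb := (hball s (hI (uIoc_subset_uIcc hst))).2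
    have h1 : c 0 s + ∑ i : Fin m, u.val s i • c i.succ s -
        (c 0 t₀ + ∑ i : Fin m, u.val s i • c i.succ t₀) =
        (c 0 s - c 0 t₀) + ∑ i : Fin m, u.val s i • (c i.succ s - c i.succ t₀) := by
      simp only [smul_sub, Finset.sum_sub_distrib]
      abel
    have h2 : ‖∑ i : Fin m, u.val s i • (c i.succ s - c i.succ t₀)‖ ≤
        ∑ _i : Fin m, |C| * (ε / (1 + m * |C|)) := norm_sum_le_of_le _ fun i _ => by
      rw [norm_smul]
      exact mul_le_mul (((PiLp.norm_apply_le _ i).trans hs).trans (le_abs_self C)) (hb _)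
        (norm_nonneg _) (abs_nonneg C)
    rw [Finset.sum_const, Finset.card_univ, Fintype.card_fin, nsmul_eq_mul] at h2
    rw [h1]
    refine (norm_add_le _ _).trans ((add_le_add (hb 0) h2).trans (le_of_eq ?_))
    field_simp
  exact intervalIntegral.norm_integral_le_of_norm_le_const_ae hbd

/-- Solutions are driven curves. -/
lemma IsSolution.drivenAt {e : M → E} (he : ContMDiff (𝓡 d) 𝓘(ℝ, E) ∞ e)
    {f : Fin (m + 1) → (x : M) → TangentSpace (𝓡 d) x}
    (hf : ∀ j, SmoothField (f j)) {U : Set (EuclideanSpace ℝ (Fin m))} {C : ℝ}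
    (hC : ∀ w ∈ U, ‖w‖ ≤ C) {u : Control U} {x : M} {γ : ℝ → M} (hγ : IsSolution f u x γ) (t₀ : ℝ) :
    DrivenAt e (fun j => pushField e (f j)) u.val γ t₀ (𝓝 t₀) := by
  have h0 := hγ.drivenAt_chart hf hC t₀
  set φ := extChartAt (𝓡 d) (γ t₀) with hφ
  have hy : φ (γ t₀) ∈ φ.target := mem_extChartAt_target (γ t₀)
  obtain ⟨D, hD, hDV⟩ := exists_hasFDerivAt_comp_symm he hy
  have hub : ∀ᵐ s, ‖u.val s‖ ≤ C := u.ae_val_mem.mono fun s hs => hC _ hs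
  have hleft : φ.symm (φ (γ t₀)) = γ t₀ := extChartAt_to_inv (γ t₀)
  -- `D` carries the increment in the chart to the increment in `E`
  have hDi : ∀ t, D (increment (fun j => pushField φ (f j)) u.val (γ t₀) t₀ t) =
      increment (fun j => pushField e (f j)) u.val (γ t₀) t₀ t := by
    have hDj : ∀ j, D (pushField φ (f j) (γ t₀)) = pushField e (f j) (γ t₀) := by
      intro j
      have := hDV (f j)
      rw [chartRep, hleft] at this
      exact this
    intro t
    simp only [increment, map_add, map_sum, map_smul, hDj]
  have hO : (fun t => φ (γ t) - φ (γ t₀)) =O[𝓝 t₀] fun t => t - t₀ := by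
    obtain ⟨B, hB⟩ : ∃ B, ∀ j : Fin (m + 1), ‖pushField φ (f j) (γ t₀)‖ ≤ B := by
      obtain ⟨B, hB⟩ := Finite.bddAbove_range fun j : Fin (m + 1) => ‖pushField φ (f j) (γ t₀)‖
      exact ⟨B, fun j => hB ⟨j, rfl⟩⟩
    have h1 : (fun t => increment (fun j => pushField φ (f j)) u.val (γ t₀) t₀ t) =O[𝓝 t₀]
        fun t => t - t₀ := by
      refine Asymptotics.IsBigO.of_bound (B * (1 + m * C)) (Eventually.of_forall fun t => ?_)
      have h2 := norm_increment_sub_le (F := fun j => pushField φ (f j)) (F' := fun _ _ => 0)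
        (x := γ t₀) (x' := γ t₀) hub (fun j => by rw [sub_zero]; exact hB j) t₀ t
      have h3 : increment (fun _ _ => 0 : Fin (m + 1) → M → EuclideanSpace ℝ (Fin d)) u.val (γ t₀)
          t₀ t = 0 := by simp [increment]
      rwa [h3, sub_zero] at h2
    simpa using h0.isBigO.add h1
  have hcont : Tendsto (fun t => φ (γ t)) (𝓝 t₀) (𝓝 (φ (γ t₀))) :=
    (continuousAt_extChartAt (γ t₀)).tendsto.comp hγ.continuous.continuousAt
  have h1 := (hD.isLittleO.comp_tendsto hcont).trans_isBigO hO
  have h2 := h1.add ((D.isBigO_comp _ _).trans_isLittleO h0)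
  refine Asymptotics.IsLittleO.congr' h2 ?_ EventuallyEq.rfl
  filter_upwards [hγ.continuous.continuousAt.eventually
    ((isOpen_extChartAt_source (I := 𝓡 d) (γ t₀)).eventually_mem
      (mem_extChartAt_source (γ t₀)))] with t ht
  have h3 : (extChartAt (𝓡 d) (γ t₀)).symm (φ (γ t)) = γ t := φ.left_inv ht
  have h4 : (extChartAt (𝓡 d) (γ t₀)).symm (φ (γ t₀)) = γ t₀ := hleft
  simp only [Function.comp_apply, map_sub, hDi, h3, h4]
  abel

end Manifold

end ControlAffine

namespace ControlAffine
/-! ### Lipschitz estimates on an embedded compact manifold -/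

section Lipschitz

variable {d m k : ℕ} {M : Type*} [TopologicalSpace M] [ChartedSpace (EuclideanSpace ℝ (Fin d)) M]
  [IsManifold (𝓡 d) ∞ M] {E : Type*} [NormedAddCommGroup E] [NormedSpace ℝ E]

/-- In a chart, a map with injective derivative is locally bounded below. -/
lemma exists_norm_chart_sub_le {e : M → E} (he : ContMDiff (𝓡 d) 𝓘(ℝ, E) ∞ e) {p : M}
    (hinj : Function.Injective (mfderiv (𝓡 d) 𝓘(ℝ, E) e p)) :
    ∃ c : ℝ, 0 ≤ c ∧ ∀ᶠ q in 𝓝 (p, p),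
      ‖extChartAt (𝓡 d) p q.1 - extChartAt (𝓡 d) p q.2‖ ≤ c * ‖e q.1 - e q.2‖ := by
  set φ := extChartAt (𝓡 d) p with hφ
  obtain ⟨D, hD, hDV⟩ := exists_hasFDerivAt_comp_symm he (mem_extChartAt_target (I := 𝓡 d) p)
  have hleft : φ.symm (φ p) = p := extChartAt_to_inv p
  have hDinj : Function.Injective D := by
    rw [injective_iff_map_eq_zero]
    intro v hv
    obtain ⟨b, hb⟩ := (isInvertible_mfderiv_extChartAt (I := 𝓡 d)
      (mem_extChartAt_source p)).bijective.surjective v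
    have h1 := hDV fun _ => b
    change D (mfderiv (𝓡 d) 𝓘(ℝ, EuclideanSpace ℝ (Fin d)) φ (φ.symm (φ p)) b) =
      mfderiv (𝓡 d) 𝓘(ℝ, E) e (φ.symm (φ p)) b at h1
    rw [hleft] at h1
    have h2 : mfderiv (𝓡 d) 𝓘(ℝ, E) e p b = 0 := by
      rw [← h1]
      exact (congrArg D hb).trans hv
    have h3 : b = 0 := hinj (h2.trans (map_zero _).symm)
    rw [← hb, h3]
    exact map_zero _
  obtain ⟨K, hK, hanti⟩ := (D : EuclideanSpace ℝ (Fin d) →ₗ[ℝ] E).exists_antilipschitzWith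
    (LinearMap.ker_eq_bot.2 hDinj)
  have hC1 : ContDiffAt ℝ ∞ (fun z => e (φ.symm z)) (φ p) :=
    ((he.contMDiffAt.comp (φ p) ((contMDiffOn_extChartAt_symm p).contMDiffAt
      ((isOpen_extChartAt_target p).mem_nhds (mem_extChartAt_target p))))).contDiffAt
  have hs : HasStrictFDerivAt (fun z => e (φ.symm z)) D (φ p) := by
    have := hC1.hasStrictFDerivAt (by simp)
    rwa [hD.fderiv] at this
  have hK' : (0 : ℝ) < K := hK
  have hlo := hs.isLittleO.def (show (0 : ℝ) < 1 / (2 * K) by positivity)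
  have hφc : Tendsto (fun q : M × M => (φ q.1, φ q.2)) (𝓝 (p, p)) (𝓝 (φ p, φ p)) := by
    have h1 : Tendsto φ (𝓝 p) (𝓝 (φ p)) := continuousAt_extChartAt p
    exact (h1.comp (continuous_fst.tendsto (p, p))).prodMk_nhds
      (h1.comp (continuous_snd.tendsto (p, p)))
  have hsrc : ∀ᶠ q : M × M in 𝓝 (p, p), q.1 ∈ φ.source ∧ q.2 ∈ φ.source := by
    have h1 := (isOpen_extChartAt_source (I := 𝓡 d) p).eventually_mem (mem_extChartAt_source p)
    exact ((continuous_fst.tendsto (p, p)).eventually h1).and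
      ((continuous_snd.tendsto (p, p)).eventually h1)
  refine ⟨2 * K, by positivity, ?_⟩
  filter_upwards [hφc.eventually hlo, hsrc] with q h1 h2
  rw [φ.left_inv h2.1, φ.left_inv h2.2] at h1
  have h3 := hanti.le_mul_dist (φ q.1) (φ q.2)
  rw [dist_eq_norm, dist_eq_norm] at h3
  have h4 : ‖D (φ q.1 - φ q.2)‖ ≤ ‖e q.1 - e q.2‖ + 1 / (2 * K) * ‖φ q.1 - φ q.2‖ := by
    have := norm_sub_le (e q.1 - e q.2) (e q.1 - e q.2 - D (φ q.1 - φ q.2))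
    rw [sub_sub_cancel] at this
    linarith
  rw [map_sub] at h4
  have h5 : ‖φ q.1 - φ q.2‖ ≤ K * (‖e q.1 - e q.2‖ + 1 / (2 * K) * ‖φ q.1 - φ q.2‖) :=
    h3.trans (mul_le_mul_of_nonneg_left h4 K.2)
  have h6 : (K : ℝ) * (1 / (2 * K) * ‖φ q.1 - φ q.2‖) = ‖φ q.1 - φ q.2‖ / 2 := by field_simp
  rw [mul_add, h6] at h5
  linarith

/-- In a chart, the image of a smooth parametrized vector field under `e` is smooth. -/
lemma contDiffOn_pushField_symm {e : M → E} (he : ContMDiff (𝓡 d) 𝓘(ℝ, E) ∞ e)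
    {f : EuclideanSpace ℝ (Fin k) → (x : M) → TangentSpace (𝓡 d) x}
    {A : Set (EuclideanSpace ℝ (Fin k))}
    (hf : ContMDiffOn ((𝓡 k).prod (𝓡 d)) (𝓡 d).tangent ∞
      (fun p : EuclideanSpace ℝ (Fin k) × M => (⟨p.2, f p.1 p.2⟩ : TangentBundle (𝓡 d) M))
      (A ×ˢ univ)) (p : M) :
    ContDiffOn ℝ 1 (fun q : EuclideanSpace ℝ (Fin k) × EuclideanSpace ℝ (Fin d) =>
      pushField e (f q.1) ((extChartAt (𝓡 d) p).symm q.2)) (A ×ˢ (extChartAt (𝓡 d) p).target) := by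
  have hto := isOpen_extChartAt_target (I := 𝓡 d) p
  have h1 : ContDiffOn ℝ ∞ (fun z => e ((extChartAt (𝓡 d) p).symm z)) (extChartAt (𝓡 d) p).target :=
    (he.comp_contMDiffOn (contMDiffOn_extChartAt_symm p)).contDiffOn
  have h2 : ContDiffOn ℝ 1 (fderiv ℝ fun z => e ((extChartAt (𝓡 d) p).symm z))
      (extChartAt (𝓡 d) p).target := h1.fderiv_of_isOpen hto (by
        rw [one_add_one_eq_two]; exact ENat.LEInfty.out)
  have h3 : ContDiffOn ℝ 1 (fun q : EuclideanSpace ℝ (Fin k) × EuclideanSpace ℝ (Fin d) =>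
      fderiv ℝ (fun z => e ((extChartAt (𝓡 d) p).symm z)) q.2)
      (A ×ˢ (extChartAt (𝓡 d) p).target) := h2.comp contDiffOn_snd fun q hq => hq.2
  refine (h3.clm_apply ((contDiffOn_chartRep hf p).of_le ENat.LEInfty.out)).congr fun q hq => ?_
  obtain ⟨D, hD, hDV⟩ := exists_hasFDerivAt_comp_symm he hq.2
  rw [hD.fderiv, hDV]

lemma continuousAt_pushField {e : M → E} (he : ContMDiff (𝓡 d) 𝓘(ℝ, E) ∞ e)
    {f : EuclideanSpace ℝ (Fin k) → (x : M) → TangentSpace (𝓡 d) x}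
    {A : Set (EuclideanSpace ℝ (Fin k))}
    (hf : ContMDiffOn ((𝓡 k).prod (𝓡 d)) (𝓡 d).tangent ∞
      (fun p : EuclideanSpace ℝ (Fin k) × M => (⟨p.2, f p.1 p.2⟩ : TangentBundle (𝓡 d) M))
      (A ×ˢ univ)) {α : EuclideanSpace ℝ (Fin k)} (hα : α ∈ interior A) (p : M) :
    ContinuousAt (fun q : EuclideanSpace ℝ (Fin k) × M => pushField e (f q.1) q.2) (α, p) := by
  have h1 := (contDiffOn_pushField_symm he hf p).continuousOn.continuousAt
      (x := (α, extChartAt (𝓡 d) p p))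
    (prod_mem_nhds (mem_interior_iff_mem_nhds.1 hα)
      ((isOpen_extChartAt_target p).mem_nhds (mem_extChartAt_target p)))
  have h2 : ContinuousAt (fun q : EuclideanSpace ℝ (Fin k) × M => (q.1, extChartAt (𝓡 d) p q.2))
      (α, p) := by
    have h3 : ContinuousAt (extChartAt (𝓡 d) p) p := continuousAt_extChartAt p
    exact continuousAt_fst.prodMk (ContinuousAt.comp (x := (α, p)) (g := extChartAt (𝓡 d) p)
      (f := fun q : EuclideanSpace ℝ (Fin k) × M => q.2) h3 continuousAt_snd)
  have h4 := ContinuousAt.comp (x := (α, p)) (f := fun q : EuclideanSpace ℝ (Fin k) × M =>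
    (q.1, extChartAt (𝓡 d) p q.2)) h1 h2
  refine h4.congr ?_
  filter_upwards [continuousAt_snd.eventually
      ((isOpen_extChartAt_source (I := 𝓡 d) p).eventually_mem (mem_extChartAt_source p))] with q hq
  simp only [Function.comp_apply]
  rw [(extChartAt (𝓡 d) p).left_inv hq]

/-- With respect to the distance induced by an embedding `e`, a smooth parametrized vector field on
a compact manifold is bounded and Lipschitz, uniformly on compact sets of parameters. -/
lemma exists_lipschitz_pushField [CompactSpace M] {e : M → E} (he : ContMDiff (𝓡 d) 𝓘(ℝ, E) ∞ e)
    (hei : Function.Injective e)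
    (hinj : ∀ p, Function.Injective (mfderiv (𝓡 d) 𝓘(ℝ, E) e p))
    {f : EuclideanSpace ℝ (Fin k) → (x : M) → TangentSpace (𝓡 d) x}
    {A B : Set (EuclideanSpace ℝ (Fin k))}
    (hf : ContMDiffOn ((𝓡 k).prod (𝓡 d)) (𝓡 d).tangent ∞
      (fun p : EuclideanSpace ℝ (Fin k) × M => (⟨p.2, f p.1 p.2⟩ : TangentBundle (𝓡 d) M))
      (A ×ˢ univ)) (hB : IsCompact B) (hBA : B ⊆ interior A) :
    ∃ K L : ℝ, 0 ≤ K ∧ 0 ≤ L ∧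
      (∀ α ∈ B, ∀ α' ∈ B, ∀ x x',
        ‖pushField e (f α) x - pushField e (f α') x'‖ ≤ K * (‖α - α'‖ + ‖e x - e x'‖)) ∧
      ∀ α ∈ B, ∀ x, ‖pushField e (f α) x‖ ≤ L := by
  set G : EuclideanSpace ℝ (Fin k) × M → E := fun q => pushField e (f q.1) q.2 with hG
  have hGc : ∀ q ∈ B ×ˢ (univ : Set M), ContinuousAt G q := fun q hq =>
    continuousAt_pushField he hf (hBA hq.1) q.2
  have hBM : IsCompact (B ×ˢ (univ : Set M)) := hB.prod isCompact_univ
  obtain ⟨L, hL⟩ := hBM.exists_bound_of_continuousOn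
    (f := G) fun q hq => (hGc q hq).continuousWithinAt
  let r : (EuclideanSpace ℝ (Fin k) × M) × (EuclideanSpace ℝ (Fin k) × M) → ℝ := fun q =>
    ‖q.1.1 - q.2.1‖ + ‖e q.1.2 - e q.2.2‖
  have hr0 : ∀ q, 0 ≤ r q := fun q => by positivity
  have hec : Continuous e := he.continuous
  have hrc : Continuous r := by fun_prop
  have key : ∃ K : ℝ, ∀ q ∈ (B ×ˢ (univ : Set M)) ×ˢ (B ×ˢ (univ : Set M)),
      ‖G q.1 - G q.2‖ ≤ K * r q := by
    refine (hBM.prod hBM).induction_on (p := fun S => ∃ K : ℝ, ∀ q ∈ S, ‖G q.1 - G q.2‖ ≤ K * r q)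
      ⟨0, by simp⟩ (fun S S' hS ⟨K, hK⟩ => ⟨K, fun q hq => hK q (hS hq)⟩) ?_ ?_
    · rintro S S' ⟨K, hK⟩ ⟨K', hK'⟩
      refine ⟨max K K', fun q hq => ?_⟩
      rcases hq with hq | hq
      · exact (hK q hq).trans (mul_le_mul_of_nonneg_right (le_max_left _ _) (hr0 q))
      · exact (hK' q hq).trans (mul_le_mul_of_nonneg_right (le_max_right _ _) (hr0 q))
    · rintro ⟨⟨α, x⟩, ⟨α', x'⟩⟩ ⟨hα, hα'⟩
      by_cases hne : r ((α, x), (α', x')) = 0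
      · -- near the diagonal, use charts
        have h1 : α = α' ∧ x = x' := by
          have h2 : ‖α - α'‖ = 0 ∧ ‖e x - e x'‖ = 0 :=
            (add_eq_zero_iff_of_nonneg (norm_nonneg _) (norm_nonneg _)).1 hne
          exact ⟨sub_eq_zero.1 (norm_eq_zero.1 h2.1), hei (sub_eq_zero.1 (norm_eq_zero.1 h2.2))⟩
        obtain ⟨rfl, rfl⟩ := h1
        obtain ⟨c, hc, hcx⟩ := exists_norm_chart_sub_le he (hinj x)
        have hto := isOpen_extChartAt_target (I := 𝓡 d) x
        have hC1 := (contDiffOn_pushField_symm he hf x).contDiffAt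
          (x := (α, extChartAt (𝓡 d) x x)) (prod_mem_nhds
            (mem_interior_iff_mem_nhds.1 (hBA hα.1)) (hto.mem_nhds (mem_extChartAt_target x)))
        obtain ⟨K, t, ht, hK⟩ := hC1.exists_lipschitzOnWith
        have hφ : ∀ᶠ q in 𝓝 (α, x), q.2 ∈ (extChartAt (𝓡 d) x).source ∧
            (q.1, extChartAt (𝓡 d) x q.2) ∈ t := by
          have h3 : ContinuousAt (extChartAt (𝓡 d) x) x := continuousAt_extChartAt x
          have h4 : ContinuousAt (fun q : EuclideanSpace ℝ (Fin k) × M =>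
              (q.1, extChartAt (𝓡 d) x q.2)) (α, x) :=
            continuousAt_fst.prodMk (ContinuousAt.comp (x := (α, x)) (g := extChartAt (𝓡 d) x)
              (f := fun q : EuclideanSpace ℝ (Fin k) × M => q.2) h3 continuousAt_snd)
          exact (continuousAt_snd.eventually ((isOpen_extChartAt_source (I := 𝓡 d) x).eventually_mem
            (mem_extChartAt_source x))).and (h4.eventually ht)
        have hcx' : ∀ᶠ q : (EuclideanSpace ℝ (Fin k) × M) × (EuclideanSpace ℝ (Fin k) × M) in
            𝓝 ((α, x), (α, x)), ‖extChartAt (𝓡 d) x q.1.2 - extChartAt (𝓡 d) x q.2.2‖ ≤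
              c * ‖e q.1.2 - e q.2.2‖ := by
          have h5 : Continuous fun q : (EuclideanSpace ℝ (Fin k) × M) ×
              (EuclideanSpace ℝ (Fin k) × M) => (q.1.2, q.2.2) := by fun_prop
          exact (h5.tendsto ((α, x), (α, x))).eventually hcx
        refine ⟨_, mem_nhdsWithin_of_mem_nhds (((continuous_fst.tendsto ((α, x), (α, x))).eventually
          hφ).and (((continuous_snd.tendsto ((α, x), (α, x))).eventually hφ).and hcx')),
          K * (1 + c), ?_⟩
        rintro q ⟨⟨hs1, ht1⟩, ⟨hs2, ht2⟩, hq⟩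
        have h6 := hK.dist_le_mul _ ht1 _ ht2
        simp only [(extChartAt (𝓡 d) x).left_inv hs1, (extChartAt (𝓡 d) x).left_inv hs2] at h6
        rw [dist_eq_norm, Prod.dist_eq, dist_eq_norm, dist_eq_norm] at h6
        refine h6.trans ?_
        rw [mul_assoc]
        refine mul_le_mul_of_nonneg_left (max_le ?_ (hq.trans ?_)) K.2
        · have h7 := norm_nonneg (e q.1.2 - e q.2.2)
          have h8 := norm_nonneg (q.1.1 - q.2.1)
          change _ ≤ (1 + c) * (‖q.1.1 - q.2.1‖ + ‖e q.1.2 - e q.2.2‖)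
          nlinarith [mul_nonneg hc h7, mul_nonneg hc h8]
        · have h7 := norm_nonneg (e q.1.2 - e q.2.2)
          have h8 := norm_nonneg (q.1.1 - q.2.1)
          change _ ≤ (1 + c) * (‖q.1.1 - q.2.1‖ + ‖e q.1.2 - e q.2.2‖)
          nlinarith [mul_nonneg hc h7, mul_nonneg hc h8]
      · -- away from the diagonal, the distance is bounded below
        have hpos : 0 < r ((α, x), (α', x')) := lt_of_le_of_ne (hr0 _) (Ne.symm hne)
        have hdc : ContinuousAt (fun q : (EuclideanSpace ℝ (Fin k) × M) ×
            (EuclideanSpace ℝ (Fin k) × M) => ‖G q.1 - G q.2‖ / r q) ((α, x), (α', x')) := by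
          refine ContinuousAt.div (ContinuousAt.norm (ContinuousAt.sub ?_ ?_)) hrc.continuousAt hne
          · exact ContinuousAt.comp (g := G) (hGc _ hα) continuousAt_fst
          · exact ContinuousAt.comp (g := G) (hGc _ hα') continuousAt_snd
        set K := ‖G (α, x) - G (α', x')‖ / r ((α, x), (α', x')) + 1 with hK
        have h1 : ∀ᶠ q in 𝓝 ((α, x), (α', x')), ‖G q.1 - G q.2‖ / r q < K :=
          hdc.eventually_lt_const (by simp [hK])
        have h2 : ∀ᶠ q in 𝓝 ((α, x), (α', x')), 0 < r q := hrc.continuousAt.eventually_const_lt hpos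
        refine ⟨_, mem_nhdsWithin_of_mem_nhds (h1.and h2), K, ?_⟩
        rintro q ⟨hq1, hq2⟩
        rw [div_lt_iff₀ hq2] at hq1
        exact hq1.le
  obtain ⟨K, hK⟩ := key
  refine ⟨|K|, |L|, abs_nonneg K, abs_nonneg L, fun α hα α' hα' x x' => ?_, fun α hα x => ?_⟩
  · exact (hK ((α, x), (α', x')) ⟨⟨hα, trivial⟩, ⟨hα', trivial⟩⟩).trans
      (mul_le_mul_of_nonneg_right (le_abs_self K) (hr0 _))
  · exact (hL (α, x) ⟨hα, trivial⟩).trans (le_abs_self L)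

end Lipschitz

end ControlAffine

namespace ControlAffine
/-! ### Properties of the transition map -/

section Driven

variable {m : ℕ} {M E : Type*} [NormedAddCommGroup E] [NormedSpace ℝ E]

lemma DrivenAt.comp_add_left {e : M → E} {F : Fin (m + 1) → M → E}
    {h : ℝ → EuclideanSpace ℝ (Fin m)} {γ : ℝ → M} {t s₀ : ℝ}
    (hγ : DrivenAt e F h γ (t + s₀) (𝓝 (t + s₀))) :
    DrivenAt e F (fun s => h (t + s)) (fun s => γ (t + s)) s₀ (𝓝 s₀) := by
  have h1 : Tendsto (fun s : ℝ => t + s) (𝓝 s₀) (𝓝 (t + s₀)) :=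
    (continuous_const.add continuous_id).tendsto s₀
  refine (Asymptotics.IsLittleO.comp_tendsto hγ h1).congr (fun s => ?_) (fun s => ?_)
  · simp only [Function.comp_apply, increment, add_sub_add_left_eq_sub]
    congr 2
    refine Finset.sum_congr rfl fun i _ => ?_
    rw [intervalIntegral.integral_comp_add_left (fun s => h s i)]
  · simp

lemma drivenAt_const (e : M → E) (h : ℝ → EuclideanSpace ℝ (Fin m)) (x : M) (t₀ : ℝ)
    (l : Filter ℝ) : DrivenAt e (fun _ _ => 0) h (fun _ => x) t₀ l := by
  refine (Asymptotics.isLittleO_zero _ _).congr_left fun t => ?_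
  simp [increment]

end Driven

/-- The Grönwall bound is linear in the initial value and the inhomogeneity. -/
lemma exists_gronwallBound_eq (K x : ℝ) :
    ∃ a b : ℝ, ∀ δ ε, gronwallBound δ K ε x = δ * a + ε * b := by
  by_cases hK : K = 0
  · exact ⟨1, x, fun δ ε => by rw [hK, gronwallBound_K0, mul_one]⟩
  · exact ⟨Real.exp (K * x), (Real.exp (K * x) - 1) / K, fun δ ε => by
      rw [gronwallBound_of_K_ne_0 hK]; ring⟩

section System

variable {d m : ℕ} {M : Type*} [TopologicalSpace M] [ChartedSpace (EuclideanSpace ℝ (Fin d)) M]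

lemma Complete.isSolution_transition {f : Fin (m + 1) → (x : M) → TangentSpace (𝓡 d) x}
    {U : Set (EuclideanSpace ℝ (Fin m))} (hc : Complete f U) (u : Control U) (x : M) :
    IsSolution f u x (fun t => transition f t x u) := by
  have h := hc u x
  have h2 : (fun t => transition f t x u) = h.choose := by
    funext t
    rw [transition, dif_pos h]
  rw [h2]
  exact h.choose_spec

/-- The properties of the transition map of a complete control system that the theory of control
sets rests on. In `causal`, the values of the controls outside `[0, t)` do not matter; in
`small_time`, the bound on the time is uniform in the control. -/
structure TransitionLaws (f : Fin (m + 1) → (x : M) → TangentSpace (𝓡 d) x)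
    (U : Set (EuclideanSpace ℝ (Fin m))) : Prop where
  zero : ∀ (x : M) (u : Control U), transition f 0 x u = x
  add : ∀ (t s : ℝ) (x : M) (u : Control U),
    transition f (t + s) x u = transition f s (transition f t x u) (u.shift t)
  causal : ∀ {t : ℝ} (x : M) {u v : Control U}, 0 ≤ t →
    (∀ᵐ s : ℝ, 0 ≤ s → s < t → u.val s = v.val s) → transition f t x u = transition f t x v
  continuous_time : ∀ (x : M) (u : Control U), Continuous fun t => transition f t x u
  continuous_space : ∀ (t : ℝ) (u : Control U), Continuous fun x => transition f t x u
  small_time : ∀ (x : M), ∀ O ∈ 𝓝 x, ∃ T > 0, ∀ (u : Control U) (t : ℝ), |t| ≤ T →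
    transition f t x u ∈ O

variable {k : ℕ} [IsManifold (𝓡 d) ∞ M] [T2Space M] [CompactSpace M]
  {U : Set (EuclideanSpace ℝ (Fin m))}
  {A : Set (EuclideanSpace ℝ (Fin k))}
  {f : EuclideanSpace ℝ (Fin k) → Fin (m + 1) → (x : M) → TangentSpace (𝓡 d) x}

/-- An embedding of `M` into a Euclidean space, with Lipschitz and boundedness constants for the
image of the system. -/
lemma exists_embedding_lipschitz
    (hf : ∀ i : Fin (m + 1), ContMDiffOn ((𝓡 k).prod (𝓡 d)) (𝓡 d).tangent ∞
      (fun p : EuclideanSpace ℝ (Fin k) × M => (⟨p.2, f p.1 i p.2⟩ : TangentBundle (𝓡 d) M))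
      (A ×ˢ univ)) {B : Set (EuclideanSpace ℝ (Fin k))} (hB : IsCompact B) (hBA : B ⊆ interior A) :
    ∃ (N : ℕ) (e : M → EuclideanSpace ℝ (Fin N)) (K L : ℝ),
      ContMDiff (𝓡 d) 𝓘(ℝ, EuclideanSpace ℝ (Fin N)) ∞ e ∧ IsClosedEmbedding e ∧
      (∀ α ∈ B, ∀ α' ∈ B, ∀ j x x', ‖pushField e (f α j) x - pushField e (f α' j) x'‖ ≤
        K * ‖α - α'‖ + K * ‖e x - e x'‖) ∧
      ∀ α ∈ B, ∀ j x, ‖pushField e (f α j) x‖ ≤ L := by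
  obtain ⟨N, e, he, hemb, hinj⟩ := exists_embedding_euclidean_of_compact (I := 𝓡 d) (M := M)
  have h1 := fun j => exists_lipschitz_pushField he hemb.injective hinj (f := fun α => f α j)
    (hf j) hB hBA
  choose K L hK hL hKj hLj using h1
  have hKs : ∀ j, K j ≤ ∑ j, K j :=
    fun j => Finset.single_le_sum (fun j _ => hK j) (Finset.mem_univ j)
  have hLs : ∀ j, L j ≤ ∑ j, L j :=
    fun j => Finset.single_le_sum (fun j _ => hL j) (Finset.mem_univ j)
  refine ⟨N, e, ∑ j, K j, ∑ j, L j, he, hemb, fun α hα α' hα' j x x' => ?_,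
    fun α hα j x => (hLj j α hα x).trans (hLs j)⟩
  rw [← mul_add]
  exact (hKj j α hα α' hα' x x').trans (mul_le_mul_of_nonneg_right (hKs j) (by positivity))

/-- All of these laws follow from Grönwall estimates for the images of trajectories in a Euclidean
space in which `M` is embedded. -/
lemma transitionLaws (hU : IsCompact U)
    (hf : ∀ i : Fin (m + 1), ContMDiffOn ((𝓡 k).prod (𝓡 d)) (𝓡 d).tangent ∞
      (fun p : EuclideanSpace ℝ (Fin k) × M => (⟨p.2, f p.1 i p.2⟩ : TangentBundle (𝓡 d) M))
      (A ×ˢ univ)) {α : EuclideanSpace ℝ (Fin k)} (hα : α ∈ interior A) (hc : Complete (f α) U) :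
    TransitionLaws (f α) U := by
  obtain ⟨N, e, K, L, he, hemb, hK, hL⟩ := exists_embedding_lipschitz hf
    (isCompact_singleton (x := α)) (singleton_subset_iff.2 hα)
  obtain ⟨C, hC0, hC⟩ := Control.exists_bound hU
  have hs : ∀ j, SmoothField (f α j) := fun j =>
    smoothField_of_contMDiffOn (f := fun α => f α j) (hf j) (interior_subset hα)
  have hsol := hc.isSolution_transition
  have hdr : ∀ (u : Control U) (x : M) t₀, DrivenAt e (fun j => pushField e (f α j)) u.val
      (fun t => transition (f α) t x u) t₀ (𝓝 t₀) := fun u x t₀ => (hsol u x).drivenAt he hs hC t₀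
  have hub : ∀ u : Control U, ∀ᵐ s, ‖u.val s‖ ≤ C := fun u => u.ae_val_mem.mono fun s hs => hC _ hs
  have hlip : ∀ j x x', ‖pushField e (f α j) x - pushField e (f α j) x'‖ ≤
      0 + K * ‖e x - e x'‖ := fun j x x' => by
    simpa using hK α rfl α rfl j x x'
  have hec := he.continuous
  have hecont : ∀ (u : Control U) (x : M), Continuous fun t => e (transition (f α) t x u) :=
    fun u x => hec.comp (hsol u x).continuous
  have hdist : ∀ (u : Control U) (x x' : M) (t : ℝ),
      ‖e (transition (f α) t x u) - e (transition (f α) t x' u)‖ ≤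
        gronwallBound ‖e x - e x'‖ (K * (1 + m * C)) 0 |t| := by
    intro u x x' t
    have := norm_sub_le_gronwallBound_abs (γ := fun t => transition (f α) t x u)
      (γ' := fun t => transition (f α) t x' u) (hecont u x) (hecont u x') (hdr u x) (hdr u x')
      (hub u) hlip t
    rwa [(hsol u x).initial, (hsol u x').initial, zero_mul] at this
  refine ⟨fun x u => (hsol u x).initial, fun t s x u => ?_, fun {t} x u v ht huv => ?_,
    fun x u => (hsol u x).continuous, fun t u => ?_, fun x O hO => ?_⟩
  · have h1 : ∀ s₀, DrivenAt e (fun j => pushField e (f α j)) (u.shift t).val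
        (fun s => transition (f α) (t + s) x u) s₀ (𝓝 s₀) := fun s₀ =>
      (hdr u x (t + s₀)).comp_add_left.congr_control (Eventually.of_forall fun s' => by
        filter_upwards [Control.shift_val t u] with r hr _ using hr.symm)
    have h2 := norm_sub_le_gronwallBound_abs (γ := fun s => transition (f α) (t + s) x u)
      (γ' := fun s => transition (f α) s (transition (f α) t x u) (u.shift t))
      ((hecont u x).comp (continuous_const.add continuous_id)) (hecont _ _) h1 (hdr _ _)
      (hub _) hlip s
    simp only [add_zero] at h2
    rw [(hsol (u.shift t) (transition (f α) t x u)).initial, sub_self, norm_zero, zero_mul,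
      gronwallBound_ε0_δ0] at h2
    exact hemb.injective (sub_eq_zero.1 (norm_le_zero_iff.1 h2))
  · have h1 : ∀ t₀ ∈ Ico 0 t, DrivenAt e (fun j => pushField e (f α j)) v.val
        (fun s => transition (f α) s x u) t₀ (𝓝[>] t₀) := by
      intro t₀ ht₀
      refine DrivenAt.congr_control (h := u.val) ((hdr u x t₀).mono nhdsWithin_le_nhds) ?_
      filter_upwards [Ioo_mem_nhdsGT ht₀.2] with r hr
      filter_upwards [huv] with s hs hsr
      rw [uIoc_of_le hr.1.le] at hsr
      exact hs (ht₀.1.trans hsr.1.le) (hsr.2.trans_lt hr.2)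
    have h2 := norm_sub_le_gronwallBound (γ := fun t => transition (f α) t x u)
      (γ' := fun t => transition (f α) t x v) (hecont u x).continuousOn (hecont v x).continuousOn h1
      (fun t₀ _ => (hdr v x t₀).mono nhdsWithin_le_nhds) (hub v) hlip t ⟨ht, le_rfl⟩
    rw [(hsol u x).initial, (hsol v x).initial, sub_self, norm_zero, zero_mul,
      gronwallBound_ε0_δ0] at h2
    exact hemb.injective (sub_eq_zero.1 (norm_le_zero_iff.1 h2))
  · rw [hemb.isInducing.continuous_iff, continuous_iff_continuousAt]
    intro x
    obtain ⟨a, b, hab⟩ := exists_gronwallBound_eq (K * (1 + m * C)) |t|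
    refine tendsto_iff_norm_sub_tendsto_zero.2 (squeeze_zero (fun _ => norm_nonneg _)
      (fun x' => (hdist u x' x t).trans_eq (hab _ _)) ?_)
    have h1 : Tendsto (fun x' => ‖e x' - e x‖ * a + 0 * b) (𝓝 x)
        (𝓝 (‖e x - e x‖ * a + 0 * b)) :=
      (((hec.sub continuous_const).norm.mul continuous_const).add continuous_const).tendsto x
    simpa using h1
  · obtain ⟨ε, hε, hball⟩ : ∃ ε > 0, e ⁻¹' Metric.ball (e x) ε ⊆ O := by
      rw [hemb.isInducing.nhds_eq_comap] at hO
      obtain ⟨V, hV, hVO⟩ := hO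
      obtain ⟨ε, hε, h⟩ := Metric.mem_nhds_iff.1 hV
      exact ⟨ε, hε, (preimage_mono h).trans hVO⟩
    have hb0 : 0 ≤ L * (1 + m * C) := by
      have : 0 ≤ L := (norm_nonneg _).trans (hL α rfl 0 x)
      positivity
    refine ⟨ε / (2 * (L * (1 + m * C) + 1)), by positivity, fun u t ht => hball ?_⟩
    have h1 := norm_sub_le_gronwallBound_abs (γ := fun t => transition (f α) t x u)
      (γ' := fun _ => x) (hecont u x) continuous_const
      (hdr u x) (drivenAt_const e u.val x · _) (hub u)
      (K := 0) (η := L) (fun j y y' => by simpa using hL α rfl j y) t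
    rw [(hsol u x).initial, sub_self, norm_zero, zero_mul, gronwallBound_K0] at h1
    simp only [zero_add] at h1
    rw [mem_preimage, mem_ball_iff_norm]
    rw [le_div_iff₀ (by positivity)] at ht
    nlinarith [abs_nonneg t]

/-- The transition map depends continuously on the parameter and the initial point. -/
lemma continuousAt_transition (hU : IsCompact U)
    (hf : ∀ i : Fin (m + 1), ContMDiffOn ((𝓡 k).prod (𝓡 d)) (𝓡 d).tangent ∞
      (fun p : EuclideanSpace ℝ (Fin k) × M => (⟨p.2, f p.1 i p.2⟩ : TangentBundle (𝓡 d) M))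
      (A ×ˢ univ)) (hc : ∀ α ∈ A, Complete (f α) U) {α₀ : EuclideanSpace ℝ (Fin k)}
    (hα₀ : α₀ ∈ interior A) (t : ℝ) (x₀ : M) (u : Control U) :
    ContinuousAt (fun q : EuclideanSpace ℝ (Fin k) × M => transition (f q.1) t q.2 u) (α₀, x₀) := by
  obtain ⟨r, hr, hrA⟩ := Metric.nhds_basis_closedBall.mem_iff.1 (isOpen_interior.mem_nhds hα₀)
  obtain ⟨N, e, K, L, he, hemb, hK, hL⟩ := exists_embedding_lipschitz hf
    (isCompact_closedBall α₀ r) hrA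
  obtain ⟨C, hC0, hC⟩ := Control.exists_bound hU
  have hA : ∀ α ∈ Metric.closedBall α₀ r, α ∈ A := fun α hα => interior_subset (hrA hα)
  have hs : ∀ α ∈ Metric.closedBall α₀ r, ∀ j, SmoothField (f α j) := fun α hα j =>
    smoothField_of_contMDiffOn (f := fun α => f α j) (hf j) (hA α hα)
  have hsol := fun α hα => (hc α (hA α hα)).isSolution_transition
  have hub : ∀ᵐ s, ‖u.val s‖ ≤ C := u.ae_val_mem.mono fun s hs => hC _ hs
  have hec := he.continuous
  have h0 : α₀ ∈ Metric.closedBall α₀ r := Metric.mem_closedBall_self hr.le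
  obtain ⟨a, b, hab⟩ := exists_gronwallBound_eq (K * (1 + m * C)) |t|
  have hdist : ∀ α ∈ Metric.closedBall α₀ r, ∀ x,
      ‖e (transition (f α) t x u) - e (transition (f α₀) t x₀ u)‖ ≤
        ‖e x - e x₀‖ * a + K * ‖α - α₀‖ * (1 + m * C) * b := by
    intro α hα x
    have := norm_sub_le_gronwallBound_abs (γ := fun t => transition (f α) t x u)
      (γ' := fun t => transition (f α₀) t x₀ u) (hec.comp (hsol α hα u x).continuous)
      (hec.comp (hsol α₀ h0 u x₀).continuous) ((hsol α hα u x).drivenAt he (hs α hα) hC)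
      ((hsol α₀ h0 u x₀).drivenAt he (hs α₀ h0) hC) hub (hK α hα α₀ h0) t
    rwa [(hsol α hα u x).initial, (hsol α₀ h0 u x₀).initial, hab] at this
  rw [ContinuousAt, hemb.isInducing.tendsto_nhds_iff]
  refine tendsto_iff_norm_sub_tendsto_zero.2 (squeeze_zero' (Eventually.of_forall fun _ =>
    norm_nonneg _) (g := fun q : EuclideanSpace ℝ (Fin k) × M =>
      ‖e q.2 - e x₀‖ * a + K * ‖q.1 - α₀‖ * (1 + m * C) * b) ?_ ?_)
  · filter_upwards [continuousAt_fst.eventually (Metric.closedBall_mem_nhds α₀ hr)] with q hq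
    exact hdist q.1 hq q.2
  · have h1 : Continuous fun q : EuclideanSpace ℝ (Fin k) × M =>
        ‖e q.2 - e x₀‖ * a + K * ‖q.1 - α₀‖ * (1 + m * C) * b := by fun_prop
    have h2 := h1.tendsto (α₀, x₀)
    simpa using h2

/-- A curve in a chart that follows the constant control `w` is a trajectory. -/
lemma transition_const_eq (hU : IsCompact U)
    (hf : ∀ i : Fin (m + 1), ContMDiffOn ((𝓡 k).prod (𝓡 d)) (𝓡 d).tangent ∞
      (fun p : EuclideanSpace ℝ (Fin k) × M => (⟨p.2, f p.1 i p.2⟩ : TangentBundle (𝓡 d) M))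
      (A ×ˢ univ)) {α : EuclideanSpace ℝ (Fin k)} (hα : α ∈ interior A) (hc : Complete (f α) U)
    {w : EuclideanSpace ℝ (Fin m)} (hw : w ∈ U) {p : M} {y : ℝ → EuclideanSpace ℝ (Fin d)} {τ : ℝ}
    (hτ : 0 ≤ τ) (hyt : ∀ t ∈ Icc 0 τ, y t ∈ (extChartAt (𝓡 d) p).target)
    (hy : ∀ t ∈ Icc 0 τ, HasDerivAt y (chartRep p (controlField (f α) w) (y t)) t) :
    transition (f α) τ ((extChartAt (𝓡 d) p).symm (y 0)) (Control.const hU w hw) =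
      (extChartAt (𝓡 d) p).symm (y τ) := by
  obtain ⟨N, e, K, L, he, hemb, hK, hL⟩ := exists_embedding_lipschitz hf
    (isCompact_singleton (x := α)) (singleton_subset_iff.2 hα)
  obtain ⟨C, hC0, hC⟩ := Control.exists_bound hU
  have hs : ∀ j, SmoothField (f α j) := fun j =>
    smoothField_of_contMDiffOn (f := fun α => f α j) (hf j) (interior_subset hα)
  set u := Control.const hU w hw
  set x := (extChartAt (𝓡 d) p).symm (y 0)
  have hsol := hc.isSolution_transition u x
  have hub : ∀ᵐ s, ‖u.val s‖ ≤ C := u.ae_val_mem.mono fun s hs => hC _ hs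
  have hlip : ∀ j x x', ‖pushField e (f α j) x - pushField e (f α j) x'‖ ≤
      0 + K * ‖e x - e x'‖ := fun j x x' => by
    simpa using hK α rfl α rfl j x x'
  have hcont : ContinuousOn (fun t => e ((extChartAt (𝓡 d) p).symm (y t))) (Icc 0 τ) := fun t ht =>
    (he.continuous.continuousAt.comp (ContinuousAt.comp (f := y)
      (g := (extChartAt (𝓡 d) p).symm) (continuousAt_extChartAt_symm'' (hyt t ht))
      (hy t ht).continuousAt)).continuousWithinAt
  have h1 := norm_sub_le_gronwallBound (γ := fun t => transition (f α) t x u)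
    (γ' := fun t => (extChartAt (𝓡 d) p).symm (y t))
    (he.continuous.comp hsol.continuous).continuousOn hcont
    (fun t₀ _ => (hsol.drivenAt he hs hC t₀).mono nhdsWithin_le_nhds)
    (fun t₀ ht₀ => (drivenAt_of_hasDerivAt he (f α) (h := u.val)
      (Control.ofFun_val hU _ _ _) (hyt t₀ ⟨ht₀.1, ht₀.2.le⟩)
      (hy t₀ ⟨ht₀.1, ht₀.2.le⟩)).mono nhdsWithin_le_nhds) hub hlip τ ⟨hτ, le_rfl⟩
  rw [hsol.initial, sub_self, norm_zero, zero_mul, gronwallBound_ε0_δ0] at h1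
  exact hemb.injective (sub_eq_zero.1 (norm_le_zero_iff.1 h1))

end System

end ControlAffine

namespace ControlAffine
/-! ### Control sets -/

section ControlSets

variable {d m : ℕ} {M : Type*} [TopologicalSpace M] [ChartedSpace (EuclideanSpace ℝ (Fin d)) M]
  {f : Fin (m + 1) → (x : M) → TangentSpace (𝓡 d) x} {U : Set (EuclideanSpace ℝ (Fin m))}

lemma mem_posOrbit {x y : M} :
    y ∈ posOrbit f U x ↔ ∃ (u : Control U) (t : ℝ), 0 ≤ t ∧ transition f t x u = y := by
  simp only [posOrbit, reachUpTo, mem_iUnion, mem_ofPred_eq]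
  constructor
  · rintro ⟨T, hT, u, t, ht, rfl⟩
    exact ⟨u, t, ht.1, rfl⟩
  · rintro ⟨u, t, ht, rfl⟩
    exact ⟨t + 1, by linarith, u, t, ⟨ht, by linarith⟩, rfl⟩

namespace TransitionLaws

lemma transition_neg (hL : TransitionLaws f U) (t : ℝ) (x : M) (u : Control U) :
    transition f t (transition f (-t) x u) (u.shift (-t)) = x := by
  rw [← hL.add, neg_add_cancel, hL.zero]

lemma neg_transition (hL : TransitionLaws f U) (t : ℝ) (x : M) (u : Control U) :
    transition f (-t) (transition f t x u) (u.shift t) = x := by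
  rw [← hL.add, add_neg_cancel, hL.zero]

lemma cat_of_le (hL : TransitionLaws f U) (hU : IsCompact U)
    (hU0 : (0 : EuclideanSpace ℝ (Fin m)) ∈ U) {t T : ℝ} (ht : 0 ≤ t) (htT : t ≤ T) (x : M)
    (u v : Control U) :
    transition f t x (Control.cat hU hU0 T u v) = transition f t x u := by
  refine hL.causal x ht ?_
  filter_upwards [Control.cat_val_of_lt hU hU0 T u v] with s hs _ hst using hs (hst.trans_le htT)

lemma cat_add (hL : TransitionLaws f U) (hU : IsCompact U)
    (hU0 : (0 : EuclideanSpace ℝ (Fin m)) ∈ U) {s T : ℝ} (hs : 0 ≤ s) (hT : 0 ≤ T) (x : M)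
    (u v : Control U) :
    transition f (T + s) x (Control.cat hU hU0 T u v) = transition f s (transition f T x u) v := by
  rw [hL.add, hL.cat_of_le hU hU0 hT le_rfl]
  refine hL.causal _ hs ?_
  filter_upwards [Control.shift_cat_val hU hU0 T u v] with r hr h0 _ using hr h0

lemma periodize_of_le (hL : TransitionLaws f U) (hU : IsCompact U)
    (hU0 : (0 : EuclideanSpace ℝ (Fin m)) ∈ U) {t S : ℝ} (hS : 0 < S) (ht : 0 ≤ t) (htS : t ≤ S)
    (x : M) (u : Control U) :
    transition f t x (Control.periodize hU hU0 S u) = transition f t x u := by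
  refine hL.causal x ht ?_
  filter_upwards [Control.periodize_val hU hU0 hS u] with s hs h0 hst
    using hs h0 (hst.trans_le htS)

lemma mem_posOrbit_trans (hL : TransitionLaws f U) (hU : IsCompact U)
    (hU0 : (0 : EuclideanSpace ℝ (Fin m)) ∈ U) {x y z : M} (hy : y ∈ posOrbit f U x)
    (hz : z ∈ posOrbit f U y) :
    z ∈ posOrbit f U x := by
  rw [mem_posOrbit] at *
  obtain ⟨u, t, ht, rfl⟩ := hy
  obtain ⟨v, s, hs, rfl⟩ := hz
  exact ⟨Control.cat hU hU0 t u v, t + s, add_nonneg ht hs, hL.cat_add hU hU0 hs ht x u v⟩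

lemma closure_posOrbit_subset (hL : TransitionLaws f U) (hU : IsCompact U)
    (hU0 : (0 : EuclideanSpace ℝ (Fin m)) ∈ U) {x y : M} (hy : y ∈ posOrbit f U x) :
    closure (posOrbit f U y) ⊆ closure (posOrbit f U x) :=
  closure_mono fun _ hz => hL.mem_posOrbit_trans hU hU0 hy hz

/-- Points of a trajectory are reached from earlier ones. -/
lemma mem_posOrbit_transition (hL : TransitionLaws f U) {s t : ℝ} (hst : s ≤ t) (x : M)
    (u : Control U) :
    transition f t x u ∈ posOrbit f U (transition f s x u) := by
  refine mem_posOrbit.2 ⟨u.shift s, t - s, sub_nonneg.2 hst, ?_⟩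
  rw [← hL.add, add_sub_cancel]

/-- Exact controllability in the interior of a control set: for small times, the points that can be
steered to `z` form a set with nonempty interior contained in `D`, which is met by the orbit of `y`.
-/
lemma mem_posOrbit_of_mem_interior (hL : TransitionLaws f U) (hU : IsCompact U)
    (hU0 : (0 : EuclideanSpace ℝ (Fin m)) ∈ U) (hacc : LocallyAccessible f U) {D : Set M}
    (hD : IsControlSet f U D) {y z : M} (hy : y ∈ D)
    (hz : z ∈ interior D) : z ∈ posOrbit f U y := by
  obtain ⟨T, hT, hsmall⟩ := hL.small_time z _ (isOpen_interior.mem_nhds hz)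
  have hsub : coreachUpTo f U T z ⊆ interior D := by
    rintro _ ⟨u, t, ht, rfl⟩
    exact hsmall u (-t) (by rw [abs_neg, abs_of_nonneg ht.1]; exact ht.2)
  obtain ⟨w₀, hw₀⟩ := (hacc z T hT).2
  obtain ⟨w, hw, hwy⟩ := mem_closure_iff.1
    (hD.prop.2 y hy (interior_subset (hsub (interior_subset hw₀)))) _ isOpen_interior hw₀
  obtain ⟨u, t, ht, rfl⟩ := interior_subset hw
  exact hL.mem_posOrbit_trans hU hU0 hwy
    (mem_posOrbit.2 ⟨u.shift (-t), t, ht.1, hL.transition_neg t z u⟩)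

/-- A point that is reached from, and steered to, a point of the interior of a control set belongs
to this control set. -/
lemma mem_of_communicates (hL : TransitionLaws f U) (hU : IsCompact U)
    (hU0 : (0 : EuclideanSpace ℝ (Fin m)) ∈ U) (hacc : LocallyAccessible f U) {D : Set M}
    (hD : IsControlSet f U D)
    {x z : M} (hx : x ∈ interior D) (hxz : z ∈ posOrbit f U x) (hzx : x ∈ posOrbit f U z) :
    z ∈ D := by
  have hxD := interior_subset hx
  refine hD.le_of_ge (y := D ∪ {z | z ∈ posOrbit f U x ∧ x ∈ posOrbit f U z}) ⟨?_, ?_⟩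
    subset_union_left (Or.inr ⟨hxz, hzx⟩)
  · rintro y (hy | ⟨hxy, hyx⟩)
    · obtain ⟨u, hu⟩ := hD.prop.1 y hy
      exact ⟨u, fun t ht => Or.inl (hu t ht)⟩
    · obtain ⟨u, hu⟩ := hD.prop.1 x hxD
      obtain ⟨v, s, hs, hvs⟩ := mem_posOrbit.1 hyx
      refine ⟨Control.cat hU hU0 s v u, fun t ht => ?_⟩
      rcases le_total t s with hts | hts
      · rw [hL.cat_of_le hU hU0 ht hts]
        refine Or.inr ⟨hL.mem_posOrbit_trans hU hU0 hxy (mem_posOrbit.2 ⟨v, t, ht, rfl⟩), ?_⟩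
        rw [← hvs]
        exact hL.mem_posOrbit_transition hts y v
      · obtain ⟨r, rfl⟩ : ∃ r, t = s + r := ⟨t - s, by ring⟩
        have hr : 0 ≤ r := by linarith
        rw [hL.cat_add hU hU0 hr hs, hvs]
        exact Or.inl (hu r hr)
  · have hfrom : ∀ y ∈ D ∪ {z | z ∈ posOrbit f U x ∧ x ∈ posOrbit f U z}, x ∈ posOrbit f U y := by
      rintro y (hy | hy)
      exacts [hL.mem_posOrbit_of_mem_interior hU hU0 hacc hD hy hx, hy.2]
    intro y hy w hw
    refine hL.closure_posOrbit_subset hU hU0 (hfrom y hy) ?_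
    rcases hw with hw | hw
    exacts [hD.prop.2 x hxD hw, subset_closure hw.1]

lemma mem_interior_of_communicates (hL : TransitionLaws f U) (hU : IsCompact U)
    (hU0 : (0 : EuclideanSpace ℝ (Fin m)) ∈ U) (hacc : LocallyAccessible f U) {D : Set M}
    (hD : IsControlSet f U D) {x z : M} (hx : x ∈ interior D) (hxz : z ∈ posOrbit f U x)
    (hzx : x ∈ posOrbit f U z) : z ∈ interior D := by
  obtain ⟨u, s, hs, hus⟩ := mem_posOrbit.1 hxz
  obtain ⟨v, t, ht, hvt⟩ := mem_posOrbit.1 hzx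
  rw [mem_interior_iff_mem_nhds]
  have h1 : ∀ᶠ y in 𝓝 z, transition f t y v ∈ interior D :=
    (hL.continuous_space t v).continuousAt.eventually
      (isOpen_interior.eventually_mem (by simpa only [hvt] using hx))
  have h2 : ∀ᶠ y in 𝓝 z, transition f (-s) y (u.shift s) ∈ interior D := by
    refine (hL.continuous_space (-s) (u.shift s)).continuousAt.eventually
      (isOpen_interior.eventually_mem ?_)
    simpa only [← hus, hL.neg_transition] using hx
  filter_upwards [h1, h2] with y hy1 hy2
  refine hL.mem_of_communicates hU hU0 hacc hD hx ?_ ?_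
  · refine hL.mem_posOrbit_trans hU hU0
      (hL.mem_posOrbit_of_mem_interior hU hU0 hacc hD (interior_subset hx) hy2) ?_
    refine mem_posOrbit.2 ⟨u, s, hs, ?_⟩
    have := hL.transition_neg s y (u.shift s)
    rwa [Control.shift_shift, add_neg_cancel, Control.shift_zero] at this
  · exact hL.mem_posOrbit_trans hU hU0 (mem_posOrbit.2 ⟨v, t, ht, rfl⟩)
      (hL.mem_posOrbit_of_mem_interior hU hU0 hacc hD (interior_subset hy1) hx)

/-- Trajectories of periodic points are periodic. -/
lemma transition_nat_mul_add (hL : TransitionLaws f U) {T : ℝ} {p : Control U × M}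
    (hp : controlFlow f T p = p) (n : ℕ)
    (t : ℝ) : transition f (n * T + t) p.2 p.1 = transition f t p.2 p.1 ∧
      p.1.shift (n * T) = p.1 := by
  have h1 : p.1.shift T = p.1 := congrArg Prod.fst hp
  have h2 : transition f T p.2 p.1 = p.2 := congrArg Prod.snd hp
  induction n generalizing t with
  | zero => simp [Control.shift_zero]
  | succ n ih =>
    have h3 : ((n + 1 : ℕ) : ℝ) * T = n * T + T := by push_cast; ring
    refine ⟨?_, ?_⟩
    · rw [h3, add_assoc, (ih (T + t)).1, hL.add, h1, h2]
    · rw [h3, ← Control.shift_shift, (ih t).2, h1]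

lemma transition_mem_interior_of_periodic (hL : TransitionLaws f U) (hU : IsCompact U)
    (hU0 : (0 : EuclideanSpace ℝ (Fin m)) ∈ U) (hacc : LocallyAccessible f U) {D : Set M}
    (hD : IsControlSet f U D) {p : Control U × M} (hp : IsPeriodic f p) (hpD : p.2 ∈ interior D)
    (t : ℝ) : transition f t p.2 p.1 ∈ interior D := by
  obtain ⟨T, hT, hpT⟩ := hp
  obtain ⟨n, hn⟩ := exists_nat_ge (|t| / T)
  rw [div_le_iff₀ hT] at hn
  have h1 := abs_le.1 hn
  rw [← (hL.transition_nat_mul_add hpT n t).1]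
  have h0 : transition f (((n + n : ℕ) : ℝ) * T) p.2 p.1 = p.2 := by
    have := (hL.transition_nat_mul_add hpT (n + n) 0).1
    rwa [add_zero, hL.zero] at this
  refine hL.mem_interior_of_communicates hU hU0 hacc hD hpD
    (mem_posOrbit.2 ⟨p.1, n * T + t, by linarith, rfl⟩) ?_
  have h2 := hL.mem_posOrbit_transition (s := n * T + t) (t := ((n + n : ℕ) : ℝ) * T)
    (by push_cast; linarith) p.2 p.1
  rwa [h0] at h2

lemma mem_lift_of_periodic (hL : TransitionLaws f U) (hU : IsCompact U)
    (hU0 : (0 : EuclideanSpace ℝ (Fin m)) ∈ U) (hacc : LocallyAccessible f U) {D : Set M}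
    (hD : IsControlSet f U D) {p : Control U × M} (hp : IsPeriodic f p) (hpD : p.2 ∈ interior D) :
    p ∈ lift f U D :=
  subset_closure (hL.transition_mem_interior_of_periodic hU hU0 hacc hD hp hpD)

lemma controlFlow_periodize (hL : TransitionLaws f U) (hU : IsCompact U)
    (hU0 : (0 : EuclideanSpace ℝ (Fin m)) ∈ U) {S : ℝ} (hS : 0 < S) {x : M} {u : Control U}
    (hu : transition f S x u = x) :
    controlFlow f S (Control.periodize hU hU0 S u, x) = (Control.periodize hU hU0 S u, x) :=
  Prod.ext (Control.shift_periodize hU hU0 hS.ne' u)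
    ((hL.periodize_of_le hU hU0 hS hS.le le_rfl x u).trans hu)

/-- A point on a closed trajectory lies in a control set, which contains all points that communicate
with it. -/
lemma exists_isControlSet_of_loop (hL : TransitionLaws f U) (hU : IsCompact U)
    (hU0 : (0 : EuclideanSpace ℝ (Fin m)) ∈ U) {S : ℝ} (hS : 0 < S) {x : M} {u : Control U}
    (hu : transition f S x u = x) :
    ∃ C, IsControlSet f U C ∧ ∀ z, z ∈ posOrbit f U x → x ∈ posOrbit f U z → z ∈ C := by
  let C₀ : Set M := {z | z ∈ posOrbit f U x ∧ x ∈ posOrbit f U z}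
  have hC₀ : (∀ y ∈ C₀, ∃ u : Control U, ∀ t : ℝ, 0 ≤ t → transition f t y u ∈ C₀) ∧
      (∀ y ∈ C₀, C₀ ⊆ closure (posOrbit f U y)) := by
    refine ⟨?_, fun y hy z hz => subset_closure (hL.mem_posOrbit_trans hU hU0 hy.2 hz.1)⟩
    rintro y ⟨hxy, hyx⟩
    obtain ⟨v, s, hs, hvs⟩ := mem_posOrbit.1 hyx
    -- steer `y` to `x` and then follow the closed trajectory forever
    refine ⟨Control.cat hU hU0 s v (Control.periodize hU hU0 S u), fun t ht => ?_⟩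
    rcases le_total t s with hts | hts
    · rw [hL.cat_of_le hU hU0 ht hts]
      refine ⟨hL.mem_posOrbit_trans hU hU0 hxy (mem_posOrbit.2 ⟨v, t, ht, rfl⟩), ?_⟩
      rw [← hvs]
      exact hL.mem_posOrbit_transition hts y v
    · obtain ⟨r, rfl⟩ : ∃ r, t = s + r := ⟨t - s, by ring⟩
      have hr : 0 ≤ r := by linarith
      rw [hL.cat_add hU hU0 hr hs, hvs]
      have hper := hL.controlFlow_periodize hU hU0 hS hu
      refine ⟨mem_posOrbit.2 ⟨_, r, hr, rfl⟩, ?_⟩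
      obtain ⟨n, hn⟩ := exists_nat_ge (r / S)
      rw [div_le_iff₀ hS] at hn
      have h0 := (hL.transition_nat_mul_add hper n 0).1
      rw [add_zero, hL.zero] at h0
      have := hL.mem_posOrbit_transition hn x (Control.periodize hU hU0 S u)
      rwa [h0] at this
  obtain ⟨C, hC₀C, hC⟩ := zorn_subset_nonempty
    {C : Set M | (∀ y ∈ C, ∃ u : Control U, ∀ t : ℝ, 0 ≤ t → transition f t y u ∈ C) ∧
      (∀ y ∈ C, C ⊆ closure (posOrbit f U y))} (fun c hc hchain _ => by
        refine ⟨⋃₀ c, ⟨?_, ?_⟩, fun s hs => subset_sUnion_of_mem hs⟩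
        · rintro y ⟨s, hs, hy⟩
          obtain ⟨u, hu⟩ := (hc hs).1 y hy
          exact ⟨u, fun t ht => ⟨s, hs, hu t ht⟩⟩
        · rintro y ⟨s, hs, hy⟩ z ⟨s', hs', hz⟩
          rcases hchain.total hs hs' with h | h
          · exact (hc hs').2 y (h hy) hz
          · exact (hc hs).2 y hy (h hz)) C₀ hC₀
  exact ⟨C, hC, fun z h1 h2 => hC₀C ⟨h1, h2⟩⟩

end TransitionLaws

end ControlSets

end ControlAffine

namespace ControlAffine
/-! ### Subadditive cocycles over periodic points -/

section Cocycle

variable {d m : ℕ} {M : Type*} [TopologicalSpace M] [ChartedSpace (EuclideanSpace ℝ (Fin d)) M]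
  {f : Fin (m + 1) → (x : M) → TangentSpace (𝓡 d) x} {U : Set (EuclideanSpace ℝ (Fin m))}

lemma TransitionLaws.controlFlow_add (hL : TransitionLaws f U) (t s : ℝ) (p : Control U × M) :
    controlFlow f (t + s) p = controlFlow f s (controlFlow f t p) :=
  Prod.ext (Control.shift_shift s t p.1).symm (hL.add t s p.2 p.1)

lemma TransitionLaws.controlFlow_nat_mul (hL : TransitionLaws f U) {S : ℝ} {p : Control U × M}
    (hp : controlFlow f S p = p) (n : ℕ) : controlFlow f (n * S) p = p := by
  have h := hL.transition_nat_mul_add hp n 0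
  rw [add_zero, hL.zero] at h
  exact Prod.ext h.2 h.1

/-- Fekete's lemma along a periodic point of the control flow. -/
lemma exists_tendsto_of_periodic (hL : TransitionLaws f U) (hU : IsCompact U)
    {κ : ℝ → Control U × M → ℝ} (hsub : IsSubadditive f κ) (hnn : ∀ t p, 0 ≤ κ t p)
    (hc : Continuous fun q : ℝ × (Control U × M) => κ q.1 q.2) {p : Control U × M} {S : ℝ}
    (hS : 0 < S) (hp : controlFlow f S p = p) :
    ∃ l, Tendsto (fun t : ℝ => (1 / t) * κ t p) atTop (𝓝 l) ∧ l ≤ κ S p / S := by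
  have ha : Subadditive fun n : ℕ => κ (n * S) p := by
    intro a b
    have := hsub (a * S) (b * S) p
    rw [hL.controlFlow_nat_mul hp] at this
    push_cast
    rwa [add_mul]
  have hbdd : BddBelow (range fun n : ℕ => κ (n * S) p / n) :=
    ⟨0, by rintro _ ⟨n, rfl⟩; exact div_nonneg (hnn _ _) (Nat.cast_nonneg n)⟩
  have hlim := ha.tendsto_lim hbdd
  have hle := ha.lim_le_div hbdd one_ne_zero
  simp only [Nat.cast_one, one_mul, div_one] at hle
  refine ⟨ha.lim / S, ?_, div_le_div_of_nonneg_right hle hS.le⟩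
  -- bounds for the times that are not multiples of the period
  have hΦ : Continuous fun r : ℝ => controlFlow f r p := by
    have h1 : Continuous fun r : ℝ => p.1.shift r :=
      (Control.continuous_shift hU).comp (continuous_id.prodMk continuous_const)
    exact h1.prodMk (hL.continuous_time p.2 p.1)
  obtain ⟨C, hC⟩ := isCompact_Icc.exists_bound_of_continuousOn (s := Icc 0 S)
    (f := fun r => κ r p) (hc.comp (continuous_id.prodMk continuous_const)).continuousOn
  obtain ⟨C', hC'⟩ := isCompact_Icc.exists_bound_of_continuousOn (s := Icc 0 S)
    (f := fun r => κ (S - r) (controlFlow f r p))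
    (hc.comp ((continuous_const.sub continuous_id).prodMk hΦ)).continuousOn
  let N : ℝ → ℕ := fun t => ⌊t / S⌋₊
  have hNt : Tendsto N atTop atTop :=
    tendsto_nat_floor_atTop.comp (tendsto_id.atTop_div_const hS)
  have hN : ∀ t : ℝ, 0 ≤ t → 0 ≤ t - N t * S ∧ t - N t * S ≤ S := by
    intro t ht
    have h1 := Nat.floor_le (div_nonneg ht hS.le)
    have h2 := (Nat.lt_floor_add_one (t / S)).le
    rw [le_div_iff₀ hS] at h1
    rw [div_le_iff₀ hS, add_mul] at h2
    constructor <;> simp only [N] <;> linarith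
  have hup : ∀ t : ℝ, 0 ≤ t → κ t p ≤ κ (N t * S) p + C := by
    intro t ht
    have h1 := hsub (N t * S) (t - N t * S) p
    rw [hL.controlFlow_nat_mul hp, add_sub_cancel] at h1
    have h2 := (le_abs_self _).trans (hC _ (hN t ht))
    linarith
  have hlow : ∀ t : ℝ, 0 ≤ t → κ ((N t + 1 : ℕ) * S) p - C' ≤ κ t p := by
    intro t ht
    have h1 := hsub t (S - (t - N t * S)) p
    have h2 : t + (S - (t - N t * S)) = (N t + 1 : ℕ) * S := by push_cast; ring
    have h3 : controlFlow f t p = controlFlow f (t - N t * S) p := by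
      conv_lhs => rw [← add_sub_cancel (N t * S) t, hL.controlFlow_add,
        hL.controlFlow_nat_mul hp]
    rw [h2, h3] at h1
    have h4 := (le_abs_self _).trans (hC' _ (hN t ht))
    linarith
  have hratio : Tendsto (fun t : ℝ => (N t : ℝ) / t) atTop (𝓝 (1 / S)) := by
    have h1 := ((tendsto_nat_floor_div_atTop (R := ℝ)).comp
      (tendsto_id.atTop_div_const hS)).div_const S
    refine h1.congr fun t => ?_
    simp only [Function.comp_apply, id]
    rw [div_div, div_mul_cancel₀ _ hS.ne']
  have hconst : ∀ c : ℝ, Tendsto (fun t : ℝ => c / t) atTop (𝓝 0) := fun c =>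
    tendsto_const_nhds.div_atTop tendsto_id
  have hratio1 : Tendsto (fun t : ℝ => ((N t + 1 : ℕ) : ℝ) / t) atTop (𝓝 (1 / S)) := by
    have := hratio.add (hconst 1)
    rw [add_zero] at this
    refine this.congr fun t => ?_
    push_cast; ring
  have hu : Tendsto (fun t : ℝ => κ (N t * S) p / N t * (N t / t) + C / t) atTop
      (𝓝 (ha.lim / S)) := by
    have := ((hlim.comp hNt).mul hratio).add (hconst C)
    rwa [add_zero, mul_one_div] at this
  have hl : Tendsto (fun t : ℝ => κ ((N t + 1 : ℕ) * S) p / (N t + 1 : ℕ) *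
      ((N t + 1 : ℕ) / t) - C' / t) atTop (𝓝 (ha.lim / S)) := by
    have := ((hlim.comp ((tendsto_add_atTop_nat 1).comp hNt)).mul hratio1).sub (hconst C')
    rwa [sub_zero, mul_one_div] at this
  refine tendsto_of_tendsto_of_tendsto_of_le_of_le' hl hu ?_ ?_
  · filter_upwards [eventually_gt_atTop 0] with t ht
    have h1 := hlow t ht.le
    have h2 : ((N t + 1 : ℕ) : ℝ) ≠ 0 := Nat.cast_ne_zero.2 (Nat.succ_ne_zero _)
    rw [div_mul_div_cancel₀ h2, ← sub_div, one_div, inv_mul_eq_div]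
    exact div_le_div_of_nonneg_right h1 ht.le
  · filter_upwards [eventually_gt_atTop 0, hNt.eventually_gt_atTop 0] with t ht hn
    have h2 : (N t : ℝ) ≠ 0 := Nat.cast_ne_zero.2 hn.ne'
    rw [div_mul_div_cancel₀ h2, ← add_div, one_div, inv_mul_eq_div]
    exact div_le_div_of_nonneg_right (hup t ht.le) ht.le

end Cocycle

end ControlAffine

namespace ControlAffine
/-! ### Closing trajectories for nearby parameters -/

section Closing

variable {d m k : ℕ} {M : Type*} [TopologicalSpace M] [ChartedSpace (EuclideanSpace ℝ (Fin d)) M]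
  [IsManifold (𝓡 d) ∞ M] [T2Space M] [CompactSpace M] {U : Set (EuclideanSpace ℝ (Fin m))}
  {A : Set (EuclideanSpace ℝ (Fin k))}
  {f : EuclideanSpace ℝ (Fin k) → Fin (m + 1) → (x : M) → TangentSpace (𝓡 d) x}

/-- As long as it stays in the ball on which the fields `v j` represent the system, a concatenation
of flows is a trajectory with a piecewise constant control. -/
lemma transition_word_eq (hU : IsCompact U) (hU0 : (0 : EuclideanSpace ℝ (Fin m)) ∈ U)
    (hf : ∀ i : Fin (m + 1), ContMDiffOn ((𝓡 k).prod (𝓡 d)) (𝓡 d).tangent ∞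
      (fun p : EuclideanSpace ℝ (Fin k) × M => (⟨p.2, f p.1 i p.2⟩ : TangentBundle (𝓡 d) M))
      (A ×ˢ univ)) (hc : ∀ α ∈ A, Complete (f α) U) {ε : ℝ}
    (hε : ∀ j, cornerControl (m := m) ε j ∈ U)
    {α₀ : EuclideanSpace ℝ (Fin k)} {z₀ : EuclideanSpace ℝ (Fin d)} {p : M} {T L ρ : ℝ}
    {v : Fin (m + 1) → EuclideanSpace ℝ (Fin k) × EuclideanSpace ℝ (Fin d) →
      EuclideanSpace ℝ (Fin d)}
    {F : Fin (m + 1) → ℝ → EuclideanSpace ℝ (Fin k) × EuclideanSpace ℝ (Fin d) →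
      EuclideanSpace ℝ (Fin k) × EuclideanSpace ℝ (Fin d)}
    (hball : Metric.ball (α₀, z₀) ρ ⊆ interior A ×ˢ (extChartAt (𝓡 d) p).target)
    (hF : ∀ j, IsSmoothFlow (fun ζ => (0, v j ζ)) T (F j)) (hL : ∀ j ζ, ‖v j ζ‖ ≤ L)
    (hv : ∀ j, ∀ ζ ∈ Metric.ball (α₀, z₀) ρ,
      v j ζ = chartRep p (controlField (f ζ.1) (cornerControl ε j)) ζ.2)
    {α : EuclideanSpace ℝ (Fin k)} {y : EuclideanSpace ℝ (Fin d)} (n : ℕ)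
    (J : Fin n → Fin (m + 1)) {s : Fin n → ℝ} (hs : ∀ i, 0 ≤ s i) (hsT : ∑ i, s i < T)
    (hρ : dist (α, y) (α₀, z₀) + L * ∑ i, s i < ρ) :
    transition (f α) (∑ i, s i) ((extChartAt (𝓡 d) p).symm y)
        (Control.word (fun j => Control.const hU _ (hε j)) hU hU0 n J s) =
      (extChartAt (𝓡 d) p).symm (flowWord F n J s (α, y)).2 := by
  have hL0 : 0 ≤ L := (norm_nonneg _).trans (hL 0 (α₀, z₀))
  have hw : ∀ j ζ, ‖((0, v j ζ) : EuclideanSpace ℝ (Fin k) × EuclideanSpace ℝ (Fin d))‖ ≤ L :=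
    fun j ζ => by rw [Prod.norm_mk, norm_zero, max_eq_right (norm_nonneg _)]; exact hL j ζ
  have hαA : α ∈ interior A := by
    have h1 : 0 ≤ L * ∑ i, s i := mul_nonneg hL0 (Finset.sum_nonneg fun i _ => hs i)
    exact (hball (show (α, y) ∈ _ from Metric.mem_ball.2 (by linarith))).1
  have hlaws := transitionLaws hU hf hαA (hc α (interior_subset hαA))
  induction n with
  | zero => simp [hlaws.zero, flowWord]
  | succ n ih =>
    rw [Fin.sum_univ_castSucc] at hsT hρ ⊢
    set s' : Fin n → ℝ := fun i => s i.castSucc with hs'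
    have hs'0 : 0 ≤ ∑ i, s' i := Finset.sum_nonneg fun i _ => hs _
    have hτ : 0 ≤ s (Fin.last n) := hs _
    change ∑ i, s' i + s (Fin.last n) < T at hsT
    change dist (α, y) (α₀, z₀) + L * (∑ i, s' i + s (Fin.last n)) < ρ at hρ
    have hLτ := mul_nonneg hL0 hτ
    have hs'T : ∀ i, s' i ∈ Ioo (-T) T := fun i => by
      have := Finset.single_le_sum (f := s') (fun i _ => hs _) (Finset.mem_univ i)
      exact ⟨by linarith [hs i.castSucc, (hF 0).pos], by linarith⟩
    have ih' := ih (fun i => J i.castSucc) (s := s') (fun i => hs _) (by linarith) (by linarith)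
    have hζ1 := flowWord_fst hF n (fun i => J i.castSucc) hs'T (α, y)
    have hζ2 := norm_flowWord_sub_le hF hw n (fun i => J i.castSucc) hs'T (α, y)
    rw [show ∑ i, |s' i| = ∑ i, s' i from Finset.sum_congr rfl fun i _ => abs_of_nonneg (hs _)]
      at hζ2
    change transition (f α) (∑ i, s' i + s (Fin.last n)) _ (Control.cat hU hU0 (∑ i, s' i)
      (Control.word _ hU hU0 n (fun i => J i.castSucc) s')
      (Control.const hU _ (hε (J (Fin.last n))))) =
      (extChartAt (𝓡 d) p).symm (F (J (Fin.last n)) (s (Fin.last n))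
        (flowWord F n (fun i => J i.castSucc) s' (α, y))).2
    rw [hlaws.cat_add hU hU0 hτ hs'0, ih']
    set ζ := flowWord F n (fun i => J i.castSucc) s' (α, y)
    set j := J (Fin.last n)
    have htT : ∀ t ∈ Icc 0 (s (Fin.last n)), t ∈ Ioo (-T) T := fun t ht =>
      ⟨by linarith [ht.1, (hF 0).pos], by linarith [ht.2]⟩
    have hin : ∀ t ∈ Icc 0 (s (Fin.last n)), F j t ζ ∈ Metric.ball (α₀, z₀) ρ := by
      intro t ht
      have h1 := (hF j).norm_sub_le (hw j) (htT t ht) ζ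
      rw [abs_of_nonneg ht.1, ← dist_eq_norm] at h1
      rw [← dist_eq_norm] at hζ2
      have h2 := mul_le_mul_of_nonneg_left ht.2 hL0
      have h3 := dist_triangle4 (F j t ζ) ζ (α, y) (α₀, z₀)
      rw [Metric.mem_ball]
      linarith
    have hfst : ∀ t ∈ Icc 0 (s (Fin.last n)), (F j t ζ).1 = α := fun t ht =>
      ((hF j).fst_eq (htT t ht) ζ).trans hζ1
    have h0 : (F j 0 ζ).2 = ζ.2 := by rw [(hF j).zero]
    rw [← h0]
    refine transition_const_eq hU hf hαA (hc α (interior_subset hαA)) (hε j)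
      (y := fun t => (F j t ζ).2) hτ (fun t ht => (hball (hin t ht)).2) fun t ht => ?_
    have h1 := (ContinuousLinearMap.snd ℝ (EuclideanSpace ℝ (Fin k))
      (EuclideanSpace ℝ (Fin d))).hasFDerivAt.comp_hasDerivAt t ((hF j).hasDerivAt t (htT t ht) ζ)
    have h2 := hv j _ (hin t ht)
    rw [hfst t ht] at h2
    rw [← h2]
    exact h1

/-- Near a point where the Lie algebra rank condition holds, there are arcs, depending continuously
on finitely many switching times, whose endpoint takes all values near a given one, locally
uniformly in the parameter and the initial point. -/
theorem exists_regular_arcs (hU : IsCompact U) (hU0 : (0 : EuclideanSpace ℝ (Fin m)) ∈ interior U)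
    (hf : ∀ i : Fin (m + 1), ContMDiffOn ((𝓡 k).prod (𝓡 d)) (𝓡 d).tangent ∞
      (fun p : EuclideanSpace ℝ (Fin k) × M => (⟨p.2, f p.1 i p.2⟩ : TangentBundle (𝓡 d) M))
      (A ×ˢ univ)) (hc : ∀ α ∈ A, Complete (f α) U)
    {α₀ : EuclideanSpace ℝ (Fin k)} (hα₀ : α₀ ∈ interior A) {x₀ : M} {O : Set M}
    (hO : IsOpen O) (hx₀ : x₀ ∈ O) (hlarc : ∀ x ∈ O, LieRankCondition (f α₀) x) :
    ∃ (n : ℕ) (c : (Fin n → ℝ) → Control U) (s₀ : Fin n → ℝ), Continuous c ∧ 0 < ∑ i, s₀ i ∧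
      transition (f α₀) (∑ i, s₀ i) x₀ (c s₀) ∈ O ∧
      ∀ N ∈ 𝓝 s₀, ∀ᶠ q : (EuclideanSpace ℝ (Fin k) × M) × M in
        𝓝 ((α₀, x₀), transition (f α₀) (∑ i, s₀ i) x₀ (c s₀)), ∃ s ∈ N,
          0 < ∑ i, s i ∧ transition (f q.1.1) (∑ i, s i) q.1.2 (c s) = q.2 := by
  have hU0' := interior_subset hU0
  -- a control value `ε eᵢ` lies in `U` for small `ε`
  obtain ⟨ε, hε0, hε⟩ : ∃ ε : ℝ, ε ≠ 0 ∧ ∀ j, cornerControl (m := m) ε j ∈ U := by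
    obtain ⟨r, hr, hrU⟩ := Metric.isOpen_iff.1 isOpen_interior 0 hU0
    refine ⟨r / 2, by positivity, fun j => Fin.cases hU0' (fun i => ?_) j⟩
    refine interior_subset (hrU ?_)
    rw [mem_ball_zero_iff]
    simp only [cornerControl, Fin.cases_succ, PiLp.norm_single, Real.norm_eq_abs]
    rw [abs_of_pos (by positivity)]
    linarith
  obtain ⟨T, L, ρ, v, F, n, J, s₀, hball, hF, hvL, hv, hn, hs₀, hsT, hLρ, hend, hmap⟩ :=
    exists_regular_times hf hα₀ hε0 hO hx₀ hlarc
  set φ := extChartAt (𝓡 d) x₀ with hφ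
  set z₀ := φ x₀ with hz₀
  set z₁ := (flowWord F n J s₀ (α₀, z₀)).2 with hz₁
  let c : (Fin n → ℝ) → Control U :=
    Control.word (fun j => Control.const hU _ (hε j)) hU hU0' n J
  have hL0 : 0 ≤ L := (norm_nonneg _).trans (hvL 0 (α₀, z₀))
  have hsum0 : 0 < ∑ i, s₀ i := by
    have : Nonempty (Fin n) := ⟨⟨0, hn⟩⟩
    exact Finset.sum_pos (fun i _ => hs₀ i) Finset.univ_nonempty
  have htraj := fun (α : EuclideanSpace ℝ (Fin k)) (y : EuclideanSpace ℝ (Fin d))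
    (s : Fin n → ℝ) =>
    transition_word_eq hU hU0' hf hc hε hball hF hvL hv (α := α) (y := y) n J (s := s)
  have hx₀' : φ.symm z₀ = x₀ := extChartAt_to_inv x₀
  have hy : transition (f α₀) (∑ i, s₀ i) x₀ (c s₀) = φ.symm z₁ := by
    have := htraj α₀ z₀ s₀ (fun i => (hs₀ i).le) hsT (by rwa [dist_self, zero_add])
    rwa [hx₀'] at this
  -- the endpoint stays in the domain of the chart
  have hz₁t : z₁ ∈ φ.target := by
    have hw : ∀ j ζ, ‖((0, v j ζ) : EuclideanSpace ℝ (Fin k) × EuclideanSpace ℝ (Fin d))‖ ≤ L :=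
      fun j ζ => by rw [Prod.norm_mk, norm_zero, max_eq_right (norm_nonneg _)]; exact hvL j ζ
    have hsT' : ∀ i, s₀ i ∈ Ioo (-T) T := fun i => by
      have := Finset.single_le_sum (fun i _ => (hs₀ i).le) (Finset.mem_univ i)
      exact ⟨by linarith [hs₀ i, (hF 0).pos], by linarith⟩
    have h1 := norm_flowWord_sub_le hF hw n J hsT' (α₀, z₀)
    rw [show ∑ i, |s₀ i| = ∑ i, s₀ i from
      Finset.sum_congr rfl fun i _ => abs_of_nonneg (hs₀ i).le] at h1
    exact (hball (mem_ball_iff_norm.2 (h1.trans_lt hLρ))).2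
  refine ⟨n, c, s₀, Control.continuous_word hU hU0' _ n J, hsum0, by rw [hy]; exact hend, ?_⟩
  intro N hN
  rw [hy]
  have hsumc : Continuous fun s : Fin n → ℝ => ∑ i, s i :=
    continuous_finsetSum _ fun i _ => continuous_apply i
  -- the admissible switching times and initial data
  have hgood : ∀ᶠ q : (Fin n → ℝ) × (EuclideanSpace ℝ (Fin k) × EuclideanSpace ℝ (Fin d)) in
      𝓝 (s₀, (α₀, z₀)), q.1 ∈ N ∧ (∀ i, 0 < q.1 i) ∧ ∑ i, q.1 i < T ∧ 0 < ∑ i, q.1 i ∧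
        dist q.2 (α₀, z₀) + L * ∑ i, q.1 i < ρ := by
    have h1 : ∀ᶠ s in 𝓝 s₀, s ∈ N ∧ (∀ i, 0 < s i) ∧ ∑ i, s i < T ∧ 0 < ∑ i, s i := by
      refine Filter.Eventually.and hN (((eventually_all.2 fun i => ?_)).and
        ((hsumc.continuousAt.eventually_lt_const hsT).and
          (hsumc.continuousAt.eventually_const_lt hsum0)))
      exact (continuous_apply i).continuousAt.eventually_const_lt (hs₀ i)
    have h2 : Continuous fun q : (Fin n → ℝ) ×
        (EuclideanSpace ℝ (Fin k) × EuclideanSpace ℝ (Fin d)) =>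
        dist q.2 (α₀, z₀) + L * ∑ i, q.1 i :=
      (continuous_snd.dist continuous_const).add
        (continuous_const.mul (hsumc.comp continuous_fst))
    have h3 : ∀ᶠ q in 𝓝 (s₀, (α₀, z₀)), dist q.2 (α₀, z₀) + L * ∑ i, q.1 i < ρ :=
      h2.continuousAt.eventually_lt_const (by simpa using hLρ)
    filter_upwards [continuousAt_fst.eventually h1, h3] with q hq hq'
    exact ⟨hq.1, hq.2.1, hq.2.2.1, hq.2.2.2, hq'⟩
  have himg := image_mem_map (m := fun q : (Fin n → ℝ) ×
    (EuclideanSpace ℝ (Fin k) × EuclideanSpace ℝ (Fin d)) =>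
    (q.2, (flowWord F n J q.1 q.2).2)) hgood
  rw [hmap] at himg
  have hz₁s : φ.symm z₁ ∈ φ.source := φ.map_target hz₁t
  have hφ1 : ContinuousAt φ x₀ := continuousAt_extChartAt x₀
  have hφ2 : ContinuousAt φ (φ.symm z₁) := continuousAt_extChartAt' hz₁s
  have hpull : Tendsto (fun q : (EuclideanSpace ℝ (Fin k) × M) × M => ((q.1.1, φ q.1.2), φ q.2))
      (𝓝 ((α₀, x₀), φ.symm z₁)) (𝓝 ((α₀, z₀), z₁)) := by
    have h1 : Tendsto (fun q : (EuclideanSpace ℝ (Fin k) × M) × M => q.1.1)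
        (𝓝 ((α₀, x₀), φ.symm z₁)) (𝓝 α₀) := (continuous_fst.comp continuous_fst).tendsto _
    have h2 : Tendsto (fun q : (EuclideanSpace ℝ (Fin k) × M) × M => φ q.1.2)
        (𝓝 ((α₀, x₀), φ.symm z₁)) (𝓝 z₀) :=
      hφ1.tendsto.comp ((continuous_snd.comp continuous_fst).tendsto _)
    have h3 : Tendsto (fun q : (EuclideanSpace ℝ (Fin k) × M) × M => φ q.2)
        (𝓝 ((α₀, x₀), φ.symm z₁)) (𝓝 z₁) := by
      have h4 := hφ2.tendsto
      rw [φ.right_inv hz₁t] at h4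
      exact h4.comp (continuous_snd.tendsto _)
    exact (h1.prodMk_nhds h2).prodMk_nhds h3
  have hsrc : ∀ᶠ q : (EuclideanSpace ℝ (Fin k) × M) × M in 𝓝 ((α₀, x₀), φ.symm z₁),
      q.1.2 ∈ φ.source ∧ q.2 ∈ φ.source := by
    have h1 := (isOpen_extChartAt_source (I := 𝓡 d) x₀).eventually_mem (mem_extChartAt_source x₀)
    have h2 := (isOpen_extChartAt_source (I := 𝓡 d) x₀).eventually_mem hz₁s
    exact (((continuous_snd.comp continuous_fst).tendsto ((α₀, x₀), φ.symm z₁)).eventually h1).and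
      ((continuous_snd.tendsto ((α₀, x₀), φ.symm z₁)).eventually h2)
  filter_upwards [hpull.eventually himg, hsrc] with q hq hqs
  obtain ⟨⟨s, α, y⟩, ⟨hsN, hs0, hsT', hsum, hdist⟩, heq⟩ := hq
  obtain ⟨h1, h2⟩ := Prod.mk.inj heq
  obtain ⟨rfl, rfl⟩ := Prod.mk.inj h1
  refine ⟨s, hsN, hsum, ?_⟩
  have h3 := htraj _ _ s (fun i => (hs0 i).le) hsT' hdist
  simp only at h2
  rw [h2, φ.left_inv hqs.1, φ.left_inv hqs.2] at h3
  exact h3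

end Closing

end ControlAffine

namespace ControlAffine
/-! ### Loops with many inserted periods, and their persistence -/

section Estimate

variable {d m : ℕ} {M : Type*} [TopologicalSpace M] [ChartedSpace (EuclideanSpace ℝ (Fin d)) M]
  {f : Fin (m + 1) → (x : M) → TangentSpace (𝓡 d) x} {U : Set (EuclideanSpace ℝ (Fin m))}

/-- `v` until the time `τ`, then `u` for the time `b`, and then `w`. -/
noncomputable def loopControl (hU : IsCompact U) (hU0 : (0 : EuclideanSpace ℝ (Fin m)) ∈ U)
    (τ b : ℝ) (v u w : Control U) : Control U :=
  Control.cat hU hU0 τ v (Control.cat hU hU0 b u w)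

lemma TransitionLaws.transition_loopControl (hL : TransitionLaws f U) (hU : IsCompact U)
    (hU0 : (0 : EuclideanSpace ℝ (Fin m)) ∈ U) {τ b σ : ℝ} (hτ : 0 ≤ τ) (hb : 0 ≤ b) (hσ : 0 ≤ σ)
    (v u w : Control U) (y : M) :
    transition f (τ + (b + σ)) y (loopControl hU hU0 τ b v u w) =
      transition f σ (transition f b (transition f τ y v) u) w := by
  rw [loopControl, hL.cat_add hU hU0 (add_nonneg hb hσ) hτ, hL.cat_add hU hU0 hσ hb]

lemma ae_shift_eq {u v : Control U} {T : ℝ} (h : ∀ᵐ s : ℝ, 0 ≤ s → s < T → u.val s = v.val s)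
    {t : ℝ}
    (ht : 0 ≤ t) : ∀ᵐ s : ℝ, 0 ≤ s → s < T - t → (u.shift t).val s = (v.shift t).val s := by
  filter_upwards [Control.shift_val t u, Control.shift_val t v, Control.ae_add_left h t]
    with s h1 h2 h3 h4 h5
  rw [h1, h2, h3 (by linarith) (by linarith)]

/-- The three pieces of the periodic continuation of a loop control. -/
lemma ae_periodize_loopControl (hU : IsCompact U) (hU0 : (0 : EuclideanSpace ℝ (Fin m)) ∈ U)
    {τ b σ : ℝ} (hτ : 0 < τ) (hb : 0 ≤ b) (hσ : 0 ≤ σ) (v u w : Control U) :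
    let P := Control.periodize hU hU0 (τ + (b + σ)) (loopControl hU hU0 τ b v u w)
    (∀ᵐ s : ℝ, 0 ≤ s → s < τ → P.val s = v.val s) ∧
    (∀ᵐ s : ℝ, 0 ≤ s → s < b → (P.shift τ).val s = u.val s) ∧
    (∀ᵐ s : ℝ, 0 ≤ s → s < σ → (P.shift (τ + b)).val s = w.val s) := by
  intro P
  have hS : 0 < τ + (b + σ) := by linarith
  have hP := Control.periodize_val hU hU0 hS (loopControl hU hU0 τ b v u w)
  have h1 := Control.cat_val_of_lt hU hU0 τ v (Control.cat hU hU0 b u w)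
  have h2 := Control.shift_cat_val hU hU0 τ v (Control.cat hU hU0 b u w)
  have h3 := Control.cat_val_of_lt hU hU0 b u w
  have h4 := Control.shift_cat_val hU hU0 b u w
  have hP' : ∀ᵐ s : ℝ, 0 ≤ s → s < b + σ →
      (P.shift τ).val s = (Control.cat hU hU0 b u w).val s := by
    filter_upwards [ae_shift_eq hP hτ.le, h2] with s h5 h6 h7 h8
    exact (h5 h7 (by linarith)).trans (h6 h7)
  refine ⟨?_, ?_, ?_⟩
  · filter_upwards [hP, h1] with s h5 h6 h7 h8
    exact (h5 h7 (by linarith)).trans (h6 h8)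
  · filter_upwards [hP', h3] with s h5 h6 h7 h8
    exact (h5 h7 (by linarith)).trans (h6 h8)
  · filter_upwards [ae_shift_eq hP' hb, h4] with s h5 h6 h7 h8
    rw [Control.shift_shift] at h5
    exact (h5 h7 (by linarith)).trans (h6 h7)

/-- Insert many periods of a periodic trajectory into a loop through its initial point. By the
restriction property, the contributions of the remaining two arcs to the cocycle do not depend on
the number of periods, so that the growth rate along the loop is close to that of the periodic
trajectory. -/
lemma exists_cocycle_loop_lt (hL : TransitionLaws f U) (hU : IsCompact U)
    (hU0 : (0 : EuclideanSpace ℝ (Fin m)) ∈ U) (hacc : LocallyAccessible f U) {D : Set M}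
    (hD : IsControlSet f U D) {κ : ℝ → Control U × M → ℝ} (hsub : IsSubadditive f κ)
    (hrestr : RestrictionProperty f D κ) {x y : M} (hx : x ∈ interior D) (hy : y ∈ interior D)
    {τ σ T : ℝ} (hτ : 0 < τ) (hσ : 0 < σ) (hT : 0 < T) {u v w : Control U}
    (hv : transition f τ y v = x) (hw : transition f σ x w = y)
    (hu : controlFlow f T (u, x) = (u, x)) {l r : ℝ}
    (hl : Tendsto (fun t : ℝ => (1 / t) * κ t (u, x)) atTop (𝓝 l)) (hlr : l < r) :
    ∃ n : ℕ, κ (τ + (n * T + σ)) (Control.periodize hU hU0 (τ + (n * T + σ))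
      (loopControl hU hU0 τ (n * T) v u w), y) / (τ + (n * T + σ)) < r := by
  let P : ℕ → Control U := fun n => Control.periodize hU hU0 (τ + (n * T + σ))
      (loopControl hU hU0 τ (n * T) v u w)
  have hnT : ∀ n : ℕ, 0 ≤ (n : ℝ) * T := fun n => by positivity
  have hun : ∀ n : ℕ, transition f (n * T) x u = x := fun n =>
    congrArg Prod.snd (hL.controlFlow_nat_mul hu n)
  have hloop : ∀ n : ℕ,
      transition f (τ + (n * T + σ)) y (loopControl hU hU0 τ (n * T) v u w) = y := by
    intro n
    rw [hL.transition_loopControl hU hU0 hτ.le (hnT n) hσ.le, hv, hun, hw]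
  have hP : ∀ n : ℕ, controlFlow f (τ + (n * T + σ)) (P n, y) = (P n, y) := fun n =>
    hL.controlFlow_periodize hU hU0 (by have := hnT n; linarith) (hloop n)
  have hae := fun n : ℕ => ae_periodize_loopControl hU hU0 hτ (hnT n) hσ.le v u w
  -- all points on the closed trajectory belong to the lift
  have hper : ∀ (n : ℕ) (t : ℝ), IsPeriodic f (controlFlow f t (P n, y)) := fun n t =>
    ⟨τ + (n * T + σ), by have := hnT n; linarith, by
      rw [← hL.controlFlow_add, add_comm t, hL.controlFlow_add, hP]⟩
  have hperx : IsPeriodic f (u, x) := ⟨T, hT, hu⟩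
  have h1 : ∀ n, controlFlow f τ (P n, y) = ((P n).shift τ, x) := fun n => by
    refine Prod.ext rfl ?_
    change transition f τ y (P n) = x
    rw [← hv]
    exact hL.causal y hτ.le (hae n).1
  have h2 : ∀ n : ℕ, controlFlow f (n * T) ((P n).shift τ, x) = ((P n).shift (τ + n * T), x) := by
    intro n
    refine Prod.ext (Control.shift_shift _ _ _) ?_
    change transition f (n * T) x ((P n).shift τ) = x
    conv_rhs => rw [← hun n]
    exact hL.causal x (hnT n) (hae n).2.1
  have hmem0 : ∀ n, (P n, y) ∈ lift f U D := fun n =>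
    hL.mem_lift_of_periodic hU hU0 hacc hD ⟨_, by have := hnT n; linarith, hP n⟩ hy
  have hmem1 : ∀ n, ((P n).shift τ, x) ∈ lift f U D := fun n => by
    have := hper n τ
    rw [h1] at this
    exact hL.mem_lift_of_periodic hU hU0 hacc hD this hx
  have hmem2 : ∀ n : ℕ, ((P n).shift (τ + n * T), x) ∈ lift f U D := fun n => by
    have := hper n (τ + n * T)
    rw [hL.controlFlow_add, h1, h2] at this
    exact hL.mem_lift_of_periodic hU hU0 hacc hD this hx
  have hmemu : (u, x) ∈ lift f U D := hL.mem_lift_of_periodic hU hU0 hacc hD hperx hx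
  -- the restriction property for the three arcs
  have hcong : ∀ {t : ℝ} {u v : Control U} {z : M}, 0 < t → (u, z) ∈ lift f U D →
      (v, z) ∈ lift f U D → (∀ᵐ s : ℝ, 0 ≤ s → s < t → u.val s = v.val s) →
      κ t (u, z) = κ t (v, z) := by
    intro t u v z ht hu hv huv
    refine hrestr t u v z ht hu hv ?_
    filter_upwards [huv, (volume : Measure ℝ).ae_ne t] with s h3 h4 h5
    exact h3 h5.1 (lt_of_le_of_ne h5.2 h4)
  have hk0 : ∀ n, κ τ (P n, y) = κ τ (P 0, y) := fun n => hcong hτ (hmem0 n) (hmem0 0) (by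
    filter_upwards [(hae n).1, (hae 0).1] with s h3 h4 h5 h6
    exact (h3 h5 h6).trans (h4 h5 h6).symm)
  have hk1 : ∀ n : ℕ, 0 < n → κ (n * T) ((P n).shift τ, x) = κ (n * T) (u, x) := fun n hn =>
    hcong (by positivity) (hmem1 n) hmemu (hae n).2.1
  have hk2 : ∀ n : ℕ, κ σ ((P n).shift (τ + n * T), x) = κ σ ((P 0).shift (τ + (0 : ℕ) * T), x) :=
    fun n => hcong hσ (hmem2 n) (hmem2 0) (by
      filter_upwards [(hae n).2.2, (hae 0).2.2] with s h3 h4 h5 h6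
      exact (h3 h5 h6).trans (h4 h5 h6).symm)
  set c : ℝ := κ τ (P 0, y) + κ σ ((P 0).shift (τ + (0 : ℕ) * T), x) with hc
  have hbound : ∀ n : ℕ, 0 < n → κ (τ + (n * T + σ)) (P n, y) ≤ κ (n * T) (u, x) + c := by
    intro n hn
    have h3 := hsub τ (n * T + σ) (P n, y)
    have h4 := hsub (n * T) σ ((P n).shift τ, x)
    rw [h1, hk0] at h3
    rw [h2, hk1 n hn, hk2] at h4
    linarith
  have hnt : Tendsto (fun n : ℕ => (n : ℝ) * T) atTop atTop :=
    tendsto_natCast_atTop_atTop.atTop_mul_const hT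
  have hSt : Tendsto (fun n : ℕ => τ + ((n : ℝ) * T + σ)) atTop atTop :=
    tendsto_atTop_add_const_left _ _ (tendsto_atTop_add_const_right _ _ hnt)
  have hratio : Tendsto (fun n : ℕ => (n : ℝ) * T / (τ + (n * T + σ))) atTop (𝓝 1) := by
    have h3 : Tendsto (fun n : ℕ => 1 - (τ + σ) / (τ + ((n : ℝ) * T + σ))) atTop (𝓝 (1 - 0)) :=
      tendsto_const_nhds.sub (tendsto_const_nhds.div_atTop hSt)
    rw [sub_zero] at h3
    refine h3.congr fun n => ?_
    have : τ + ((n : ℝ) * T + σ) ≠ 0 := by have := hnT n; linarith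
    field_simp
    ring
  have hlim : Tendsto (fun n : ℕ => (1 / (n * T)) * κ (n * T) (u, x) *
      (n * T / (τ + (n * T + σ))) + c / (τ + (n * T + σ))) atTop (𝓝 l) := by
    have := ((hl.comp hnt).mul hratio).add (tendsto_const_nhds (x := c) |>.div_atTop hSt)
    rwa [mul_one, add_zero] at this
  obtain ⟨n, hn, hn0⟩ := ((hlim.eventually_lt_const hlr).and (eventually_gt_atTop 0)).exists
  refine ⟨n, lt_of_le_of_lt ?_ hn⟩
  have hS : 0 < τ + ((n : ℝ) * T + σ) := by have := hnT n; linarith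
  have hnT0 : (n : ℝ) * T ≠ 0 := by positivity
  rw [one_div, inv_mul_eq_div, div_mul_div_cancel₀ hnT0, ← add_div]
  exact div_le_div_of_nonneg_right (hbound n hn0) hS.le

/-- If all points near `y₀` are connected by trajectories of positive duration, for all parameters
near `α₀`, then `y₀` is in the interior of a control set for these parameters. -/
lemma eventually_exists_isControlSet {k : ℕ}
    {f : EuclideanSpace ℝ (Fin k) → Fin (m + 1) → (x : M) → TangentSpace (𝓡 d) x}
    {α₀ : EuclideanSpace ℝ (Fin k)} (hU : IsCompact U)
    (hU0 : (0 : EuclideanSpace ℝ (Fin m)) ∈ U)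
    (hL : ∀ᶠ α in 𝓝 α₀, TransitionLaws (f α) U) {y₀ : M}
    (h : ∀ᶠ q : (EuclideanSpace ℝ (Fin k) × M) × M in 𝓝 ((α₀, y₀), y₀), ∃ (u : Control U) (S : ℝ),
      0 < S ∧ transition (f q.1.1) S q.1.2 u = q.2) :
    ∀ᶠ α in 𝓝 α₀, ∃ C, IsControlSet (f α) U C ∧ y₀ ∈ interior C := by
  rw [nhds_prod_eq, nhds_prod_eq] at h
  obtain ⟨Pa, hPa, Pb, hPb, h1⟩ := eventually_prod_iff.1 h
  obtain ⟨Qa, hQa, Qb, hQb, h2⟩ := eventually_prod_iff.1 hPa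
  filter_upwards [hL, hQa] with α hLα hα
  have key : ∀ y y', Qb y → Pb y' →
      ∃ (u : Control U) (S : ℝ), 0 < S ∧ transition (f α) S y u = y' :=
    fun y y' hy hy' => h1 (h2 hα hy) hy'
  obtain ⟨u, S, hS, hu⟩ := key y₀ y₀ hQb.self_of_nhds hPb.self_of_nhds
  obtain ⟨C, hC, hCz⟩ := hLα.exists_isControlSet_of_loop hU hU0 hS hu
  refine ⟨C, hC, mem_interior_iff_mem_nhds.2 ?_⟩
  filter_upwards [hQb, hPb] with z hz hz'
  obtain ⟨u₁, S₁, hS₁, h₁⟩ := key y₀ z hQb.self_of_nhds hz'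
  obtain ⟨u₂, S₂, hS₂, h₂⟩ := key z y₀ hz hPb.self_of_nhds
  exact hCz z (mem_posOrbit.2 ⟨u₁, S₁, hS₁.le, h₁⟩) (mem_posOrbit.2 ⟨u₂, S₂, hS₂.le, h₂⟩)

end Estimate

section Closing

variable {d m k : ℕ} {M : Type*} [TopologicalSpace M] [ChartedSpace (EuclideanSpace ℝ (Fin d)) M]
  [IsManifold (𝓡 d) ∞ M] [T2Space M] [CompactSpace M] {U : Set (EuclideanSpace ℝ (Fin m))}
  {A : Set (EuclideanSpace ℝ (Fin k))}
  {f : EuclideanSpace ℝ (Fin k) → Fin (m + 1) → (x : M) → TangentSpace (𝓡 d) x}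

/-- Every point `x₀` in the interior of the control set lies on a loop through a point `y₀` of the
interior such that all trajectories near the loop, for all parameters near `α₀`, can be closed by
adjusting finitely many switching times. An arbitrary loop at `x₀` may be inserted. -/
lemma exists_closing_loops (hU : IsCompact U) (hU0 : (0 : EuclideanSpace ℝ (Fin m)) ∈ interior U)
    (hf : ∀ i : Fin (m + 1), ContMDiffOn ((𝓡 k).prod (𝓡 d)) (𝓡 d).tangent ∞
      (fun p : EuclideanSpace ℝ (Fin k) × M => (⟨p.2, f p.1 i p.2⟩ : TangentBundle (𝓡 d) M))
      (A ×ˢ univ)) (hc : ∀ α ∈ A, Complete (f α) U)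
    {α₀ : EuclideanSpace ℝ (Fin k)} (hα₀ : α₀ ∈ interior A) (hacc : LocallyAccessible (f α₀) U)
    {D : Set M} (hD : IsControlSet (f α₀) U D)
    (hlarc : ∀ x ∈ interior D, LieRankCondition (f α₀) x) {x₀ : M} (hx₀ : x₀ ∈ interior D) :
    ∃ y₀ ∈ interior D, ∃ (n : ℕ) (c : (Fin n → ℝ) → Control U) (s₀ : Fin n → ℝ) (τ : ℝ)
      (v : Control U), Continuous c ∧ 0 < ∑ i, s₀ i ∧ 0 < τ ∧ transition (f α₀) τ y₀ v = x₀ ∧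
      transition (f α₀) (∑ i, s₀ i) x₀ (c s₀) = y₀ ∧
      ∀ (b : ℝ) (u : Control U), 0 ≤ b → transition (f α₀) b x₀ u = x₀ → ∀ N ∈ 𝓝 s₀,
        ∀ᶠ q : (EuclideanSpace ℝ (Fin k) × M) × M in 𝓝 ((α₀, y₀), y₀), ∃ s ∈ N, 0 < ∑ i, s i ∧
          transition (f q.1.1) (τ + (b + ∑ i, s i)) q.1.2
            (loopControl hU (interior_subset hU0) τ b v u (c s)) = q.2 := by
  have hU0' := interior_subset hU0
  have hA : ∀ α ∈ interior A, TransitionLaws (f α) U := fun α hα =>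
    transitionLaws hU hf hα (hc α (interior_subset hα))
  have hL := hA α₀ hα₀
  obtain ⟨n, c, s₀, hcc, hs₀, hy₀, hreg⟩ :=
    exists_regular_arcs hU hU0 hf hc hα₀ isOpen_interior hx₀ hlarc
  set y₀ := transition (f α₀) (∑ i, s₀ i) x₀ (c s₀) with hy₀def
  obtain ⟨v₁, t₁, ht₁, hv₁⟩ := mem_posOrbit.1
    (hL.mem_posOrbit_of_mem_interior hU hU0' hacc hD (interior_subset hy₀) hx₀)
  -- the detour through `y₀` makes the time positive
  refine ⟨y₀, hy₀, n, c, s₀, t₁ + (∑ i, s₀ i + t₁), loopControl hU hU0' t₁ (∑ i, s₀ i) v₁ (c s₀) v₁,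
    hcc, hs₀, by linarith, ?_, rfl, ?_⟩
  · rw [hL.transition_loopControl hU hU0' ht₁ hs₀.le ht₁, hv₁, ← hy₀def, hv₁]
  intro b u hb hu N hN
  set τ := t₁ + (∑ i, s₀ i + t₁) with hτ
  set v := loopControl hU hU0' t₁ (∑ i, s₀ i) v₁ (c s₀) v₁
  have hτ0 : 0 ≤ τ := by linarith
  have hv : transition (f α₀) τ y₀ v = x₀ := by
    rw [hL.transition_loopControl hU hU0' ht₁ hs₀.le ht₁, hv₁, ← hy₀def, hv₁]
  have h1 : Tendsto (fun q : EuclideanSpace ℝ (Fin k) × M => transition (f q.1) τ q.2 v)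
      (𝓝 (α₀, y₀)) (𝓝 x₀) := by
    have := continuousAt_transition hU hf hc hα₀ τ y₀ v
    rwa [ContinuousAt, hv] at this
  have h2 : Tendsto (fun q : EuclideanSpace ℝ (Fin k) × M =>
      transition (f q.1) b (transition (f q.1) τ q.2 v) u) (𝓝 (α₀, y₀)) (𝓝 x₀) := by
    have h3 := continuousAt_transition hU hf hc hα₀ b x₀ u
    rw [ContinuousAt, hu] at h3
    exact h3.comp ((continuous_fst.tendsto (α₀, y₀)).prodMk_nhds h1)
  have h3 : Tendsto (fun q : (EuclideanSpace ℝ (Fin k) × M) × M =>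
      ((q.1.1, transition (f q.1.1) b (transition (f q.1.1) τ q.1.2 v) u), q.2))
      (𝓝 ((α₀, y₀), y₀)) (𝓝 ((α₀, x₀), y₀)) := by
    refine Tendsto.prodMk_nhds (Tendsto.prodMk_nhds ?_ ?_) (continuous_snd.tendsto _)
    · exact (continuous_fst.comp continuous_fst).tendsto _
    · exact h2.comp (continuous_fst.tendsto ((α₀, y₀), y₀))
  have h4 : ∀ᶠ q : (EuclideanSpace ℝ (Fin k) × M) × M in 𝓝 ((α₀, y₀), y₀), q.1.1 ∈ interior A :=
    ((continuous_fst.comp continuous_fst).tendsto ((α₀, y₀), y₀)).eventually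
      (isOpen_interior.eventually_mem hα₀)
  filter_upwards [h3.eventually (hreg N hN), h4] with q hq hqA
  obtain ⟨s, hsN, hs, hqs⟩ := hq
  exact ⟨s, hsN, hs, by
    rw [(hA _ hqA).transition_loopControl hU hU0' hτ0 hb hs.le]; exact hqs⟩

end Closing

end ControlAffine

namespace ControlAffine
/-! ### The Floquet spectrum for nearby parameters -/

section Floquet

variable {d m k : ℕ} {M : Type*} [TopologicalSpace M] [ChartedSpace (EuclideanSpace ℝ (Fin d)) M]
  {U : Set (EuclideanSpace ℝ (Fin m))} {A : Set (EuclideanSpace ℝ (Fin k))}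

/-- A loop through a point of `int D` yields an element of the Floquet spectrum that is bounded by
the value of the cocycle along the loop. -/
lemma TransitionLaws.exists_mem_floquetSpectrum_le
    {f : Fin (m + 1) → (x : M) → TangentSpace (𝓡 d) x} (hL : TransitionLaws f U)
    (hU : IsCompact U) (hU0 : (0 : EuclideanSpace ℝ (Fin m)) ∈ U) {κ : ℝ → Control U × M → ℝ}
    (hsub : IsSubadditive f κ) (hnn : ∀ t p, 0 ≤ κ t p)
    (hc : Continuous fun q : ℝ × (Control U × M) => κ q.1 q.2) {D : Set M} {y : M}
    (hy : y ∈ interior D) {S : ℝ} (hS : 0 < S) {u : Control U} (hu : transition f S y u = y) :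
    ∃ l ∈ floquetSpectrum f D κ, l ≤ κ S (Control.periodize hU hU0 S u, y) / S := by
  have hp := hL.controlFlow_periodize hU hU0 hS hu
  obtain ⟨l, hl, hle⟩ := exists_tendsto_of_periodic hL hU hsub hnn hc hS hp
  exact ⟨l, ⟨_, ⟨S, hS, hp⟩, hy, hl⟩, hle⟩

lemma nonneg_of_mem_floquetSpectrum {f : Fin (m + 1) → (x : M) → TangentSpace (𝓡 d) x}
    {κ : ℝ → Control U × M → ℝ} (hnn : ∀ t p, 0 ≤ κ t p) {D : Set M} {l : ℝ}
    (hl : l ∈ floquetSpectrum f D κ) : 0 ≤ l := by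
  obtain ⟨p, -, -, hl⟩ := hl
  refine ge_of_tendsto hl ?_
  filter_upwards [eventually_ge_atTop 0] with t ht
  exact mul_nonneg (one_div_nonneg.2 ht) (hnn t p)

/-- The mean value of the cocycle along a closed loop depends continuously on the duration and the
last arc of the loop and on the parameter. -/
lemma tendsto_cocycle_periodize_loopControl (hU : IsCompact U)
    (hU0 : (0 : EuclideanSpace ℝ (Fin m)) ∈ U)
    {κ : EuclideanSpace ℝ (Fin k) → ℝ → Control U × M → ℝ}
    (hκ : ContinuousOn
      (fun q : ℝ × EuclideanSpace ℝ (Fin k) × (Control U × M) => κ q.2.1 q.1 q.2.2)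
      {q | q.2.1 ∈ A}) {α₀ : EuclideanSpace ℝ (Fin k)} (hα₀ : α₀ ∈ interior A) {n : ℕ}
    {c : (Fin n → ℝ) → Control U} (hc : Continuous c) {s₀ : Fin n → ℝ} {τ b : ℝ}
    (hS : 0 < τ + (b + ∑ i, s₀ i)) (v u : Control U) (y : M) :
    Tendsto (fun q : EuclideanSpace ℝ (Fin k) × (Fin n → ℝ) =>
      κ q.1 (τ + (b + ∑ i, q.2 i)) (Control.periodize hU hU0 (τ + (b + ∑ i, q.2 i))
        (loopControl hU hU0 τ b v u (c q.2)), y) / (τ + (b + ∑ i, q.2 i)))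
      (𝓝 (α₀, s₀)) (𝓝 (κ α₀ (τ + (b + ∑ i, s₀ i)) (Control.periodize hU hU0
        (τ + (b + ∑ i, s₀ i)) (loopControl hU hU0 τ b v u (c s₀)), y) /
          (τ + (b + ∑ i, s₀ i)))) := by
  have hT : Tendsto (fun q : EuclideanSpace ℝ (Fin k) × (Fin n → ℝ) => τ + (b + ∑ i, q.2 i))
      (𝓝 (α₀, s₀)) (𝓝 (τ + (b + ∑ i, s₀ i))) := by
    have : Continuous fun q : EuclideanSpace ℝ (Fin k) × (Fin n → ℝ) => τ + (b + ∑ i, q.2 i) := by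
      fun_prop
    exact this.tendsto (α₀, s₀)
  have hcs : Tendsto (fun q : EuclideanSpace ℝ (Fin k) × (Fin n → ℝ) => c q.2)
      (𝓝 (α₀, s₀)) (𝓝 (c s₀)) := (hc.tendsto s₀).comp (continuous_snd.tendsto (α₀, s₀))
  have hl : Tendsto (fun q : EuclideanSpace ℝ (Fin k) × (Fin n → ℝ) =>
      loopControl hU hU0 τ b v u (c q.2)) (𝓝 (α₀, s₀))
      (𝓝 (loopControl hU hU0 τ b v u (c s₀))) :=
    Control.tendsto_cat hU hU0 tendsto_const_nhds tendsto_const_nhds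
      (Control.tendsto_cat hU hU0 tendsto_const_nhds tendsto_const_nhds hcs)
  have hP := Control.tendsto_periodize hU hU0 hS hT hl
  have hA : {q : ℝ × EuclideanSpace ℝ (Fin k) × (Control U × M) | q.2.1 ∈ A} ∈
      𝓝 (τ + (b + ∑ i, s₀ i), α₀, (Control.periodize hU hU0 (τ + (b + ∑ i, s₀ i))
        (loopControl hU hU0 τ b v u (c s₀)), y)) :=
    ((continuous_fst.comp continuous_snd).tendsto (τ + (b + ∑ i, s₀ i), α₀,
      (Control.periodize hU hU0 (τ + (b + ∑ i, s₀ i))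
        (loopControl hU hU0 τ b v u (c s₀)), y))).eventually (mem_interior_iff_mem_nhds.1 hα₀)
  have h1 := (hκ.continuousAt hA).tendsto.comp (hT.prodMk_nhds
    ((continuous_fst.tendsto (α₀, s₀)).prodMk_nhds (hP.prodMk_nhds (tendsto_const_nhds (x := y)))))
  exact h1.div hT hS.ne'

/-- A point that can be reached from all nearby points, and from which all nearby points can be
reached, for all nearby parameters, is an interior point of the control sets `D α`, by uniqueness of
the latter. -/
lemma eventually_isControlSet_and_mem_interior
    {f : EuclideanSpace ℝ (Fin k) → Fin (m + 1) → (x : M) → TangentSpace (𝓡 d) x} (hU : IsCompact U)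
    (hU0 : (0 : EuclideanSpace ℝ (Fin m)) ∈ U) {α₀ : EuclideanSpace ℝ (Fin k)}
    (hL : ∀ᶠ α in 𝓝 α₀, TransitionLaws (f α) U) {D : EuclideanSpace ℝ (Fin k) → Set M}
    (hD : ∀ᶠ α in 𝓝 α₀, ∀ C : Set M, IsControlSet (f α) U C →
      (interior (D α₀) ∩ interior C).Nonempty → C = D α) {y₀ : M} (hy₀ : y₀ ∈ interior (D α₀))
    (h : ∀ᶠ q : (EuclideanSpace ℝ (Fin k) × M) × M in 𝓝 ((α₀, y₀), y₀), ∃ (u : Control U) (S : ℝ),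
      0 < S ∧ transition (f q.1.1) S q.1.2 u = q.2) :
    ∀ᶠ α in 𝓝 α₀, IsControlSet (f α) U (D α) ∧ y₀ ∈ interior (D α) := by
  filter_upwards [eventually_exists_isControlSet hU hU0 hL h, hD] with α ⟨C, hC, hy⟩ hDα
  rw [← hDα C hC ⟨y₀, hy₀, hy⟩]
  exact ⟨hC, hy⟩

end Floquet

section Persistence

variable {d m k : ℕ} {M : Type*} [TopologicalSpace M] [T2Space M] [CompactSpace M]
  [ChartedSpace (EuclideanSpace ℝ (Fin d)) M] [IsManifold (𝓡 d) ∞ M]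
  {U : Set (EuclideanSpace ℝ (Fin m))} {A : Set (EuclideanSpace ℝ (Fin k))}
  {f : EuclideanSpace ℝ (Fin k) → Fin (m + 1) → (x : M) → TangentSpace (𝓡 d) x}

/-- The control sets `D α` persist for all parameters near `α₀`, and their interiors contain
periodic trajectories. -/
lemma eventually_isControlSet_and_floquetSpectrum_nonempty (hU : IsCompact U)
    (hU0 : (0 : EuclideanSpace ℝ (Fin m)) ∈ interior U)
    (hf : ∀ i : Fin (m + 1), ContMDiffOn ((𝓡 k).prod (𝓡 d)) (𝓡 d).tangent ∞
      (fun p : EuclideanSpace ℝ (Fin k) × M => (⟨p.2, f p.1 i p.2⟩ : TangentBundle (𝓡 d) M))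
      (A ×ˢ univ)) (hc : ∀ α ∈ A, Complete (f α) U)
    {α₀ : EuclideanSpace ℝ (Fin k)} (hα₀ : α₀ ∈ interior A) (hacc : LocallyAccessible (f α₀) U)
    {D : EuclideanSpace ℝ (Fin k) → Set M} (hD₀ : IsControlSet (f α₀) U (D α₀))
    (hD : ∀ᶠ α in 𝓝 α₀, ∀ C : Set M, IsControlSet (f α) U C →
      (interior (D α₀) ∩ interior C).Nonempty → C = D α)
    (hlarc : ∀ x ∈ interior (D α₀), LieRankCondition (f α₀) x)
    {κ : EuclideanSpace ℝ (Fin k) → ℝ → Control U × M → ℝ}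
    (hnn : ∀ α ∈ A, ∀ (t : ℝ) (p : Control U × M), 0 ≤ κ α t p)
    (hsub : ∀ α ∈ A, IsSubadditive (f α) (κ α))
    (hκ : ContinuousOn
      (fun q : ℝ × EuclideanSpace ℝ (Fin k) × (Control U × M) => κ q.2.1 q.1 q.2.2)
      {q | q.2.1 ∈ A})
    (hD₀int : (interior (D α₀)).Nonempty) :
    ∀ᶠ α in 𝓝 α₀, IsControlSet (f α) U (D α) ∧ (interior (D α₀) ∩ interior (D α)).Nonempty ∧
      (floquetSpectrum (f α) (D α) (κ α)).Nonempty := by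
  obtain ⟨x₀, hx₀⟩ := hD₀int
  have hA : ∀ᶠ α in 𝓝 α₀, α ∈ interior A := isOpen_interior.eventually_mem hα₀
  have hL : ∀ᶠ α in 𝓝 α₀, TransitionLaws (f α) U := hA.mono fun α hα =>
    transitionLaws hU hf hα (hc α (interior_subset hα))
  obtain ⟨y₀, hy₀, n, c, s₀, τ, v, -, -, hτ, -, -, hclose⟩ :=
    exists_closing_loops hU hU0 hf hc hα₀ hacc hD₀ hlarc hx₀
  have hloop : ∀ᶠ q : (EuclideanSpace ℝ (Fin k) × M) × M in 𝓝 ((α₀, y₀), y₀),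
      ∃ (u : Control U) (S : ℝ), 0 < S ∧ transition (f q.1.1) S q.1.2 u = q.2 := by
    filter_upwards [hclose 0 v le_rfl (hL.self_of_nhds.zero _ _) univ univ_mem]
      with q ⟨s, _, hs, hq⟩
    exact ⟨_, _, by linarith, hq⟩
  have hloop₀ : ∀ᶠ α in 𝓝 α₀, ∃ (u : Control U) (S : ℝ), 0 < S ∧ transition (f α) S y₀ u = y₀ :=
    (Continuous.tendsto (f := fun α => ((α, y₀), y₀)) (by fun_prop) α₀).eventually hloop
  filter_upwards [hA, hL, hloop₀, eventually_isControlSet_and_mem_interior hU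
    (interior_subset hU0) hL hD hy₀ hloop] with α hαA hLα ⟨u, S, hS, hu⟩ ⟨hC, hy⟩
  obtain ⟨l, hl, -⟩ := hLα.exists_mem_floquetSpectrum_le hU (interior_subset hU0)
    (hsub α (interior_subset hαA)) (hnn α (interior_subset hαA))
    (hκ.comp_continuous (f := fun q : ℝ × (Control U × M) => (q.1, α, q.2)) (by fun_prop)
      fun _ => (interior_subset hαA : α ∈ A)) hy hS hu
  exact ⟨hC, ⟨y₀, hy₀, hy⟩, l, hl⟩

/-- A periodic trajectory through `int (D α₀)` with growth rate less than `r` persists up to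
appending a detour: for all parameters near `α₀`, the Floquet spectrum over `D α` has an element
less than `r`. -/
lemma eventually_exists_mem_floquetSpectrum_lt (hU : IsCompact U)
    (hU0 : (0 : EuclideanSpace ℝ (Fin m)) ∈ interior U)
    (hf : ∀ i : Fin (m + 1), ContMDiffOn ((𝓡 k).prod (𝓡 d)) (𝓡 d).tangent ∞
      (fun p : EuclideanSpace ℝ (Fin k) × M => (⟨p.2, f p.1 i p.2⟩ : TangentBundle (𝓡 d) M))
      (A ×ˢ univ)) (hc : ∀ α ∈ A, Complete (f α) U)
    {α₀ : EuclideanSpace ℝ (Fin k)} (hα₀ : α₀ ∈ interior A) (hacc : LocallyAccessible (f α₀) U)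
    {D : EuclideanSpace ℝ (Fin k) → Set M} (hD₀ : IsControlSet (f α₀) U (D α₀))
    (hD : ∀ᶠ α in 𝓝 α₀, ∀ C : Set M, IsControlSet (f α) U C →
      (interior (D α₀) ∩ interior C).Nonempty → C = D α)
    (hlarc : ∀ x ∈ interior (D α₀), LieRankCondition (f α₀) x)
    {κ : EuclideanSpace ℝ (Fin k) → ℝ → Control U × M → ℝ}
    (hnn : ∀ α ∈ A, ∀ (t : ℝ) (p : Control U × M), 0 ≤ κ α t p)
    (hsub : ∀ α ∈ A, IsSubadditive (f α) (κ α))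
    (hκ : ContinuousOn
      (fun q : ℝ × EuclideanSpace ℝ (Fin k) × (Control U × M) => κ q.2.1 q.1 q.2.2)
      {q | q.2.1 ∈ A})
    (hrestr : RestrictionProperty (f α₀) (D α₀) (κ α₀))
    {l r : ℝ} (hl : l ∈ floquetSpectrum (f α₀) (D α₀) (κ α₀)) (hlr : l < r) :
    ∀ᶠ α in 𝓝 α₀, ∃ l' ∈ floquetSpectrum (f α) (D α) (κ α), l' < r := by
  obtain ⟨⟨u, x₀⟩, ⟨T, hT, hu⟩, hx₀, hl⟩ := hl
  have hU0' := interior_subset hU0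
  have hA : ∀ᶠ α in 𝓝 α₀, α ∈ interior A := isOpen_interior.eventually_mem hα₀
  have hL : ∀ᶠ α in 𝓝 α₀, TransitionLaws (f α) U := hA.mono fun α hα =>
    transitionLaws hU hf hα (hc α (interior_subset hα))
  obtain ⟨y₀, hy₀, n, c, s₀, τ, v, hcc, hs₀, hτ, hv, hw, hclose⟩ :=
    exists_closing_loops hU hU0 hf hc hα₀ hacc hD₀ hlarc hx₀
  have hL₀ := hL.self_of_nhds
  obtain ⟨j, hj⟩ := exists_cocycle_loop_lt hL₀ hU hU0' hacc hD₀ (hsub α₀ (interior_subset hα₀))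
    hrestr hx₀ hy₀ hτ hs₀ hT hv hw hu hl hlr
  have hb : 0 ≤ (j : ℝ) * T := by positivity
  have hub : transition (f α₀) (j * T) x₀ u = x₀ :=
    congrArg Prod.snd (hL₀.controlFlow_nat_mul hu j)
  -- the estimate for the loop persists for nearby parameters and switching times
  have hlt := (tendsto_cocycle_periodize_loopControl hU hU0' hκ hα₀ hcc
    (show 0 < τ + (j * T + ∑ i, s₀ i) by linarith) v u y₀).eventually_lt_const hj
  rw [nhds_prod_eq] at hlt
  obtain ⟨Pa, hPa, Ps, hPs, hP⟩ := eventually_prod_iff.1 hlt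
  have hclose' := hclose (j * T) u hb hub {s | Ps s} hPs
  have hloop : ∀ᶠ q : (EuclideanSpace ℝ (Fin k) × M) × M in 𝓝 ((α₀, y₀), y₀),
      ∃ (u : Control U) (S : ℝ), 0 < S ∧ transition (f q.1.1) S q.1.2 u = q.2 := by
    filter_upwards [hclose'] with q ⟨s, _, hs, hq⟩
    exact ⟨_, _, by linarith, hq⟩
  have hloop₀ := (Continuous.tendsto (f := fun α => ((α, y₀), y₀)) (by fun_prop) α₀).eventually
    hclose'
  filter_upwards [hA, hL, hPa, hloop₀, eventually_isControlSet_and_mem_interior hU hU0' hL hD hy₀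
    hloop] with α hαA hLα hα ⟨s, hsN, hs, hq⟩ ⟨_, hy⟩
  obtain ⟨l', hl', hle⟩ := hLα.exists_mem_floquetSpectrum_le hU hU0'
    (hsub α (interior_subset hαA)) (hnn α (interior_subset hαA))
    (hκ.comp_continuous (f := fun q : ℝ × (Control U × M) => (q.1, α, q.2)) (by fun_prop)
      fun _ => (interior_subset hαA : α ∈ A)) hy (by linarith) hq
  exact ⟨l', hl', hle.trans_lt (hP hα hsN)⟩

end Persistence

end ControlAffine

theorem mainTheorem7 {d m k : ℕ}
    {M : Type*} [TopologicalSpace M] [T2Space M] [CompactSpace M]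
    [ChartedSpace (EuclideanSpace ℝ (Fin d)) M] [IsManifold (𝓡 d) ∞ M]
    (U : Set (EuclideanSpace ℝ (Fin m))) (hUcompact : IsCompact U) (hUconvex : Convex ℝ U)
    (hU0 : 0 ∈ interior U)
    (A : Set (EuclideanSpace ℝ (Fin k))) (hA : IsCompact A)
    (f : EuclideanSpace ℝ (Fin k) → Fin (m + 1) → (x : M) → TangentSpace (𝓡 d) x)
    (hf : ∀ i : Fin (m + 1), ContMDiffOn ((𝓡 k).prod (𝓡 d)) (𝓡 d).tangent ∞
      (fun p : EuclideanSpace ℝ (Fin k) × M => (⟨p.2, f p.1 i p.2⟩ : TangentBundle (𝓡 d) M))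
      (A ×ˢ univ))
    (hcomplete : ∀ α ∈ A, Complete (f α) U)
    (α₀ : EuclideanSpace ℝ (Fin k)) (hα₀ : α₀ ∈ interior A)
    -- local accessibility near `α₀`
    (hacc : ∀ᶠ α in 𝓝 α₀, LocallyAccessible (f α) U)
    -- `D α₀` is a control set with nonempty interior, and for `α` near `α₀` no set other than `D α`
    -- is a control set whose interior meets that of `D α₀`
    (D : EuclideanSpace ℝ (Fin k) → Set M)
    (hD₀ : IsControlSet (f α₀) U (D α₀)) (hD₀int : (interior (D α₀)).Nonempty)
    (hDunique : ∀ᶠ α in 𝓝 α₀, ∀ C : Set M, IsControlSet (f α) U C →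
      (interior (D α₀) ∩ interior C).Nonempty → C = D α)
    -- the Lie algebra rank condition on `int (D α₀)`
    (hlarc : ∀ x ∈ interior (D α₀), LieRankCondition (f α₀) x)
    -- nonnegative subadditive cocycles with the restriction property, jointly continuous
    (κ : EuclideanSpace ℝ (Fin k) → ℝ → Control U × M → ℝ)
    (hκnonneg : ∀ α ∈ A, ∀ (t : ℝ) (p : Control U × M), 0 ≤ κ α t p)
    (hκsub : ∀ α ∈ A, IsSubadditive (f α) (κ α))
    (hκrestr : ∀ᶠ α in 𝓝 α₀, RestrictionProperty (f α) (D α) (κ α))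
    (hκcont : ContinuousOn
      (fun q : ℝ × EuclideanSpace ℝ (Fin k) × (Control U × M) => κ q.2.1 q.1 q.2.2)
      {q | q.2.1 ∈ A}) :
    (∀ᶠ α in 𝓝 α₀, IsControlSet (f α) U (D α) ∧
      (interior (D α₀) ∩ interior (D α)).Nonempty ∧
      (floquetSpectrum (f α) (D α) (κ α)).Nonempty) ∧
    UpperSemicontinuousAt (fun α => sInf (floquetSpectrum (f α) (D α) (κ α))) α₀ := by
  refine ⟨eventually_isControlSet_and_floquetSpectrum_nonempty hUcompact hU0 hf hcomplete hα₀
    hacc.self_of_nhds hD₀ hDunique hlarc hκnonneg hκsub hκcont hD₀int, fun r hr => ?_⟩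
  have hne := (eventually_isControlSet_and_floquetSpectrum_nonempty hUcompact hU0 hf hcomplete hα₀
    hacc.self_of_nhds hD₀ hDunique hlarc hκnonneg hκsub hκcont hD₀int).self_of_nhds.2.2
  obtain ⟨l, hl, hlr⟩ := exists_lt_of_csInf_lt hne hr
  filter_upwards [eventually_exists_mem_floquetSpectrum_lt hUcompact hU0 hf hcomplete hα₀
    hacc.self_of_nhds hD₀ hDunique hlarc hκnonneg hκsub hκcont hκrestr.self_of_nhds hl hlr,
    isOpen_interior.eventually_mem hα₀] with α ⟨l', hl', hlr'⟩ hα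
  exact (csInf_le ⟨0, fun _ h => nonneg_of_mem_floquetSpectrum
    (hκnonneg α (interior_subset hα)) h⟩ hl').trans_lt hlr'
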